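/- A complex supermanifold $\mathcal M$ (in the sense of Berezin, Kostant and Leites) is a Hausdorff, second countable space $M$ with a sheaf $\mathcal O_{\mathcal M}$ of supercommutative $\mathbb C$-superalgebras that is locally isomorphic to $(V,\mathcal O_V\otimes\Lambda(\mathbb C^n))$ for $V\subset\mathbb C^m$ open, with $\mathcal O_V$ the sheaf of holomorphic functions. Let $\mathcal O_{\mathcal M}^{(j)}$ ($j\ge 0$) be the $j$-th power of the ideal sheaf of nilpotent elements, with $\mathcal O_{\mathcal M}^{(0)}=\mathcal O_{\mathcal M}$. Let $Der(\mathcal O_{\mathcal M})$ be the sheaf of $\mathbb C$-linear superderivations (sums of even and odd ones) of $\mathcal O_{\mathcal M}$, and for $t\ge 0$ let $Der^{(t)}(\mathcal O_{\mathcal M})$ be the subsheaf of those $Y$ with $Y(\mathcal O_{\mathcal M}^{(j)})\subset \mathcal O_{\mathcal M}^{(j+t)}$ for all $j\ge 0$. Let $\mathcal V_{\mathcal M,\bar 0}^{(2)}$ be the space of even global sections of $Der^{(2)}(\mathcal O_{\mathcal M})$. For $t\in\mathbb N$, the supermanifold $\mathcal M$ is called strictly $t$-nildominated if for every open set $U\subset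 M$ $$\bigcap_{X\in \mathcal V_{\mathcal M,\bar 0}^{(2)}} \ker\Big([X,\cdot]: Der(\mathcal O_{\mathcal M})(U)\to Der(\mathcal O_{\mathcal M})(U)\Big)\subset Der^{(t)}(\mathcal O_{\mathcal M})(U).$$ The product of complex supermanifolds $\mathcal M'$ and $\mathcal M''$ is the complex supermanifold $\mathcal M'\times\mathcal M''$ with underlying space $M'\times M''$ and projections to $\mathcal M'$ and $\mathcal M''$, such that each point of $M'\times M''$ has a neighbourhood of the form $U'\times U''$, with coordinates $(z'|\xi')$ of $\mathcal M'$ on $U'$ and $(z''|\xi'')$ of $\mathcal M''$ on $U''$, on which the pulled back functions $(z',z''|\xi',\xi'')$ are coordinates of $\mathcal M'\times\mathcal M''$. **Corollary.** Let $t\in\mathbb N$ and let $\mathcal M'$ and $\mathcal M''$ be strictly $t$-nildominated complex supermanifolds. Then the product $\mathcal M'\times\mathcal M''$ is strictly $t$-nildominated. -/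

import Mathlib

open scoped TensorProduct
open TopologicalSpace

universe u v w

noncomputable section

/-- A topological space with a sheaf of supercommutative `ℂ`-superalgebras (the structure sheaf,
whose sections are called superfunctions). -/
structure SuperSpace where
  carrier : Type u
  [top : TopologicalSpace carrier]
  sheaf : TopCat.Sheaf (AlgCat.{u} ℂ) (TopCat.of carrier)
  /-- `parity U p` is the subspace of superfunctions on `U` of parity `p ∈ ℤ/2`. -/
  parity : ∀ U : Opens carrier, ZMod 2 →
    Submodule ℂ (sheaf.presheaf.obj (Opposite.op (U : Opens (TopCat.of carrier))))
  gradedMonoid : ∀ U, SetLike.GradedMonoid (parity U)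
  isInternal : ∀ U, DirectSum.IsInternal (parity U)
  map_parity : ∀ {U V : Opens carrier} (h : V ≤ U) (p : ZMod 2), ∀ f ∈ parity U p,
    (sheaf.presheaf.map
      (CategoryTheory.homOfLE (show (V : Opens (TopCat.of carrier)) ≤ U from h)).op).hom f
        ∈ parity V p
  superComm : ∀ (U : Opens carrier) (p q : ZMod 2), ∀ f ∈ parity U p, ∀ g ∈ parity U q,
    f * g = (-1 : ℂ) ^ (p.val * q.val) • (g * f)

attribute [instance] SuperSpace.top

namespace SuperSpace

/-- The algebra of superfunctions on the open set `U`. -/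
abbrev Sec (M : SuperSpace.{u}) (U : Opens M.carrier) : Type u :=
  M.sheaf.presheaf.obj (Opposite.op (U : Opens (TopCat.of M.carrier)))

/-- Restriction of superfunctions. -/
def res (M : SuperSpace.{u}) {U V : Opens M.carrier} (h : V ≤ U) : M.Sec U →ₐ[ℂ] M.Sec V :=
  (M.sheaf.presheaf.map
    (CategoryTheory.homOfLE (show (V : Opens (TopCat.of M.carrier)) ≤ U from h)).op).hom

/-- Morphisms: a continuous map together with a pullback of superfunctions by parity preserving
`ℂ`-algebra homomorphisms, compatible with restrictions. -/
structure Hom (M : SuperSpace.{u}) (N : SuperSpace.{v}) where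
  base : C(M.carrier, N.carrier)
  pull : ∀ U : Opens N.carrier, N.Sec U →ₐ[ℂ] M.Sec (Opens.comap base U)
  pull_res : ∀ {U V : Opens N.carrier} (h : V ≤ U) (f : N.Sec U),
    M.res (show Opens.comap base V ≤ Opens.comap base U from fun _ hx => h hx) (pull U f)
      = pull V (N.res h f)
  pull_parity : ∀ (U : Opens N.carrier) (p : ZMod 2), ∀ f ∈ N.parity U p,
    pull U f ∈ M.parity (Opens.comap base U) p

end SuperSpace

/-! ### Superdomains -/

/-- Holomorphic functions on an open subset of `ℂ^ι`. -/
def Holo (ι : Type*) [Fintype ι] (V : Opens (ι → ℂ)) : Subalgebra ℂ (V → ℂ) where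
  carrier := {f | ∃ g : (ι → ℂ) → ℂ, DifferentiableOn ℂ g V ∧ ∀ x : V, f x = g x}
  mul_mem' := by
    rintro a b ⟨g, hg, hga⟩ ⟨h, hh, hhb⟩
    exact ⟨fun x => g x * h x, hg.mul hh, fun x => by simp [hga, hhb]⟩
  add_mem' := by
    rintro a b ⟨g, hg, hga⟩ ⟨h, hh, hhb⟩
    exact ⟨fun x => g x + h x, hg.add hh, fun x => by simp [hga, hhb]⟩
  algebraMap_mem' := fun r => ⟨fun _ => r, differentiableOn_const r, fun _ => rfl⟩

/-- Restriction of holomorphic functions. -/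
def Holo.res {ι : Type*} [Fintype ι] {V W : Opens (ι → ℂ)} (h : W ≤ V) :
    Holo ι V →ₐ[ℂ] Holo ι W where
  toFun f := ⟨fun x => f.1 ⟨x.1, h x.2⟩, by
    obtain ⟨g, hg, hf⟩ := f.2
    exact ⟨g, hg.mono h, fun x => hf ⟨x.1, h x.2⟩⟩⟩
  map_one' := rfl
  map_mul' _ _ := rfl
  map_zero' := rfl
  map_add' _ _ := rfl
  commutes' _ := rfl

/-- Superfunctions on the open set `V` of the superdomain with even coordinates indexed by `ι` and
odd coordinates indexed by `κ`: holomorphic functions on `V` tensored with the Grassmann algebra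
on `κ` generators. -/
abbrev DomainSec (ι κ : Type*) [Fintype ι] [Fintype κ] (V : Opens (ι → ℂ)) : Type _ :=
  Holo ι V ⊗[ℂ] ExteriorAlgebra ℂ (κ → ℂ)

namespace DomainSec

variable {ι κ : Type*} [Fintype ι] [Fintype κ]

/-- Restriction of superfunctions on a superdomain. -/
def res {V W : Opens (ι → ℂ)} (h : W ≤ V) : DomainSec ι κ V →ₐ[ℂ] DomainSec ι κ W :=
  Algebra.TensorProduct.map (Holo.res h) (AlgHom.id ℂ (ExteriorAlgebra ℂ (κ → ℂ)))

/-- The superfunctions on a superdomain of parity `p`: those whose Grassmann components have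
parity `p`. -/
def parity (V : Opens (ι → ℂ)) (p : ZMod 2) : Submodule ℂ (DomainSec ι κ V) :=
  LinearMap.range (TensorProduct.map (LinearMap.id : Holo ι V →ₗ[ℂ] Holo ι V)
    (CliffordAlgebra.evenOdd (0 : QuadraticForm ℂ (κ → ℂ)) p).subtype)

/-- The `i`-th even coordinate function. -/
def z (κ : Type*) [Fintype κ] (V : Opens (ι → ℂ)) (i : ι) : DomainSec ι κ V :=
  (⟨fun x => x.1 i, fun x => x i, by fun_prop, fun _ => rfl⟩ : Holo ι V) ⊗ₜ[ℂ] 1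

open Classical in
/-- The `k`-th odd coordinate function. -/
def ξ (ι : Type*) [Fintype ι] {κ : Type*} [Fintype κ] (V : Opens (ι → ℂ)) (k : κ) :
    DomainSec ι κ V :=
  (1 : Holo ι V) ⊗ₜ[ℂ] ExteriorAlgebra.ι ℂ (Pi.single k (1 : ℂ))

end DomainSec

/-- A superchart: an isomorphism (of spaces with sheaves of superalgebras) from an open part of `M`
onto a superdomain with even coordinates indexed by `ι` and odd coordinates indexed by `κ`. -/
structure SuperChart (M : SuperSpace.{u}) (ι κ : Type) [Fintype ι] [Fintype κ] where
  base : OpenPartialHomeomorph M.carrier (ι → ℂ)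
  pull : ∀ V : Opens (ι → ℂ), (V : Set (ι → ℂ)) ⊆ base.target →
    (DomainSec ι κ V ≃ₐ[ℂ]
      M.Sec ⟨base.source ∩ base ⁻¹' V, base.isOpen_inter_preimage V.isOpen⟩)
  pull_res : ∀ {V W : Opens (ι → ℂ)} (h : W ≤ V) (hV : (V : Set (ι → ℂ)) ⊆ base.target)
    (f : DomainSec ι κ V),
    M.res (show (⟨base.source ∩ base ⁻¹' W, base.isOpen_inter_preimage W.isOpen⟩ :
        Opens M.carrier) ≤ ⟨base.source ∩ base ⁻¹' V, base.isOpen_inter_preimage V.isOpen⟩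
        from fun _ hx => ⟨hx.1, h hx.2⟩) (pull V hV f)
      = pull W (fun _ hx => hV (h hx)) (DomainSec.res h f)
  pull_parity : ∀ (V : Opens (ι → ℂ)) (hV : (V : Set (ι → ℂ)) ⊆ base.target) (p : ZMod 2),
    ∀ f ∈ DomainSec.parity V p, pull V hV f ∈
      M.parity ⟨base.source ∩ base ⁻¹' V, base.isOpen_inter_preimage V.isOpen⟩ p

namespace SuperChart

variable {M : SuperSpace.{u}} {ι κ : Type} [Fintype ι] [Fintype κ]

/-- The image of a chart, as an open subset of `ℂ^ι`. -/
def image (c : SuperChart M ι κ) : Opens (ι → ℂ) := ⟨c.base.target, c.base.open_target⟩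

/-- The domain of a chart, as an open subset (it is equal to `c.base.source`). -/
def dom (c : SuperChart M ι κ) : Opens M.carrier :=
  ⟨c.base.source ∩ c.base ⁻¹' c.image, c.base.isOpen_inter_preimage c.image.isOpen⟩

theorem coe_dom (c : SuperChart M ι κ) : (c.dom : Set M.carrier) = c.base.source :=
  Set.inter_eq_left.2 fun _ hx => c.base.map_source hx

/-- The even local coordinates of a chart, as superfunctions on its domain. -/
def z (c : SuperChart M ι κ) (i : ι) : M.Sec c.dom :=
  c.pull c.image subset_rfl (DomainSec.z κ c.image i)

/-- The odd local coordinates of a chart, as superfunctions on its domain. -/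
def ξ (c : SuperChart M ι κ) (k : κ) : M.Sec c.dom :=
  c.pull c.image subset_rfl (DomainSec.ξ ι c.image k)

end SuperChart

/-- A complex supermanifold: a Hausdorff, second countable space with a sheaf of supercommutative
`ℂ`-superalgebras that is locally isomorphic to superdomains `ℂ^{m|n}`. -/
structure ComplexSupermanifold extends SuperSpace.{u} where
  [t2 : T2Space carrier]
  [secondCountable : SecondCountableTopology carrier]
  exists_chart : ∀ x : carrier, ∃ (m n : ℕ) (c : SuperChart toSuperSpace (Fin m) (Fin n)),
    x ∈ c.dom

/-- `P`, with the morphisms `p'` and `p''`, is the product of `M'` and `M''`: the space `P` is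
locally, over products of chart domains of `M'` and `M''`, a superdomain whose coordinates are the
pulled back coordinates `(z', z'' | ξ', ξ'')`, and whose image in `ℂ^{m'+m''}` is the product of
the images of the charts of `M'` and `M''`. -/
def IsSuperProduct {M' : ComplexSupermanifold.{u}} {M'' : ComplexSupermanifold.{v}}
    {P : ComplexSupermanifold.{w}}
    (p' : P.toSuperSpace.Hom M'.toSuperSpace) (p'' : P.toSuperSpace.Hom M''.toSuperSpace) : Prop :=
  ∀ (x' : M'.carrier) (x'' : M''.carrier), ∃ (m' n' m'' n'' : ℕ)
    (c' : SuperChart M'.toSuperSpace (Fin m') (Fin n'))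
    (c'' : SuperChart M''.toSuperSpace (Fin m'') (Fin n''))
    (c : SuperChart P.toSuperSpace (Fin m' ⊕ Fin m'') (Fin n' ⊕ Fin n''))
    (h' : c.dom ≤ Opens.comap p'.base c'.dom) (h'' : c.dom ≤ Opens.comap p''.base c''.dom),
    x' ∈ c'.dom ∧ x'' ∈ c''.dom ∧
    (∀ y : P.carrier, p'.base y ∈ c'.dom → p''.base y ∈ c''.dom → y ∈ c.dom) ∧
    (∀ a : Fin m' ⊕ Fin m'' → ℂ, a ∈ c.image ↔
      (fun i => a (Sum.inl i)) ∈ c'.image ∧ (fun i => a (Sum.inr i)) ∈ c''.image) ∧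
    (∀ i, c.z (Sum.inl i) = P.res h' (p'.pull c'.dom (c'.z i))) ∧
    (∀ i, c.z (Sum.inr i) = P.res h'' (p''.pull c''.dom (c''.z i))) ∧
    (∀ k, c.ξ (Sum.inl k) = P.res h' (p'.pull c'.dom (c'.ξ k))) ∧
    (∀ k, c.ξ (Sum.inr k) = P.res h'' (p''.pull c''.dom (c''.ξ k)))

/-! ### Superderivations and their filtration -/

namespace SuperSpace

variable (M : SuperSpace.{u})

/-- `M.filt j U` is the space of sections over `U` of the `j`-th power of the ideal sheaf of
nilpotent superfunctions (all superfunctions for `j = 0`). -/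
def filt (j : ℕ) (U : Opens M.carrier) : Set (M.Sec U) :=
  {f | ∀ x ∈ U, ∃ (V : Opens M.carrier) (h : V ≤ U), x ∈ V ∧
    M.res h f ∈ (Ideal.span {g : M.Sec V | IsNilpotent g}) ^ j}

/-- Families of `ℂ`-linear maps on superfunctions, one for each open subset of `U`. This is a ring
under composition, so that `⁅X, Y⁆ = X * Y - Y * X`. -/
abbrev Family (U : Opens M.carrier) : Type u :=
  ∀ V : {V : Opens M.carrier // V ≤ U}, Module.End ℂ (M.Sec V.1)

variable {M}

/-- Restriction of a family to a smaller open set. -/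
def Family.restrict {U W : Opens M.carrier} (h : W ≤ U) (X : M.Family U) : M.Family W :=
  fun V => X ⟨V.1, V.2.trans h⟩

/-- `X` is a homogeneous superderivation of parity `p` of the restriction of the structure sheaf to
`U`: it commutes with restrictions, changes the parity by `p`, and satisfies the graded Leibniz
rule. -/
structure IsHomDer {U : Opens M.carrier} (p : ZMod 2) (X : M.Family U) : Prop where
  natural : ∀ (V W : {V : Opens M.carrier // V ≤ U}) (h : W.1 ≤ V.1) (f : M.Sec V.1),
    M.res h (X V f) = X W (M.res h f)
  map_parity : ∀ (V : {V : Opens M.carrier // V ≤ U}) (q : ZMod 2), ∀ f ∈ M.parity V.1 q,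
    X V f ∈ M.parity V.1 (p + q)
  leibniz : ∀ (V : {V : Opens M.carrier // V ≤ U}) (q : ZMod 2), ∀ f ∈ M.parity V.1 q,
    ∀ g : M.Sec V.1,
      X V (f * g) = X V f * g + (-1 : ℂ) ^ (p.val * q.val) • (f * X V g)

/-- `X` is a superderivation of the restriction of the structure sheaf to `U`: a sum of an even and
an odd one. -/
def IsDer {U : Opens M.carrier} (X : M.Family U) : Prop :=
  ∃ X₀ X₁ : M.Family U, IsHomDer 0 X₀ ∧ IsHomDer 1 X₁ ∧ X = X₀ + X₁

/-- `X` raises the degree in the filtration of the structure sheaf by at least `t`. -/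
def RaisesDegree {U : Opens M.carrier} (t : ℕ) (X : M.Family U) : Prop :=
  ∀ (V : {V : Opens M.carrier // V ≤ U}) (j : ℕ), ∀ f ∈ M.filt j V.1, X V f ∈ M.filt (j + t) V.1

/-- Strict `t`-nildominance: over every open set, each superderivation that commutes with all
global even superderivations of degree at least two has degree at least `t`. (As `X` is even, the
supercommutator with `X` is the ordinary commutator.) -/
def StrictlyNildominated (M : SuperSpace.{u}) (t : ℕ) : Prop :=
  ∀ (U : Opens M.carrier) (Y : M.Family U), IsDer Y →
    (∀ X : M.Family ⊤, IsHomDer 0 X → RaisesDegree 2 X → ⁅X.restrict (le_top : U ≤ ⊤), Y⁆ = 0) →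
    RaisesDegree t Y

end SuperSpace

end

/-!
A superderivation `Y` of a product which commutes with all even superderivations of degree at least
two commutes in particular with the lifts `X` of those superderivations `X'` of the first factor:
`X` acts as `X'` on functions pulled back from the first factor and annihilates those pulled back
from the second. Such a lift exists and is unique, since in a chart `(z', z'' | ξ', ξ'')` of the
product a superderivation is a first order differential operator, which is determined by its
(arbitrary) values on the coordinates (`SuperSpace.IsHomDer.ev_eq_derivVal`,
`SuperChart.exists_isHomDer`, `SuperSpace.exists_isLift`).

Let `f` be a superfunction on the first factor. Freeze the even coordinates `z''` in `Y(p'^* f)` and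
take the component along a monomial in `ξ''`. The result `D f` is again a superfunction on (an open
subset of) the first factor, and `D` is a superderivation: pullbacks of superfunctions on the first
factor are constant in the directions of the second, so that taking components is linear over them,
up to sign (`IsPullbackChart.exists_isDer_slice`). As `X` involves neither `∂/∂z''` nor `∂/∂ξ''`,
and its coefficients are pulled back from the first factor, taking components turns the action of
`X` into that of `X'`, and `[X, Y] = 0` gives `[X', D] = 0` (`IsProductChart.commutes_of_slice`). By
strict nildominance of the first factor, `D` has degree at least `t`. Hence all components of
`Y(z')` have degree at least `t` in `ξ'` and all components of `Y(ξ')` have degree at least `t + 1`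
in `ξ'`, so that `Y(z')` and `Y(ξ')` have degree at least `t` and `t + 1`
(`IsProductChart.ev_mem_degFiltration`). The same holds for `z''` and `ξ''` by symmetry, and the
degree of `Y` can be read off from its values on the coordinates (`SuperSpace.IsDer.raisesDegree`).

Superfunctions are handled through their values at the points of a chart, which are elements of a
Grassmann algebra (`SuperChart.ev`); they are determined by these values. Two facts on germs, both
consequences of Hadamard's lemma, make this effective: a homomorphism of algebras of germs, and a
superderivation of germs, is determined by what it does to the coordinates
(`DomainSec.germHom_eq`, `DomainSec.germDer_eq_zero`).
-/

noncomputable section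

/-! ### Contractions and the degree filtration of an exterior algebra -/

namespace ExteriorAlgebra

open CliffordAlgebra (involute contractLeft evenOdd)

section CommRing

variable {R M N : Type*} [CommRing R] [AddCommGroup M] [Module R M] [AddCommGroup N] [Module R N]

theorem ι_mul_eq_involute_mul_ι (v : M) (x : ExteriorAlgebra R M) :
    ι R v * x = involute x * ι R v := by
  induction x using CliffordAlgebra.left_induction with
  | algebraMap r => simp [Algebra.commutes]
  | add x y hx hy => simp [mul_add, add_mul, hx, hy]
  | ι_mul x m hx =>
    have h : ι R v * ι R m = -(ι R m * ι R v) := eq_neg_of_add_eq_zero_left (ι_add_mul_swap v m)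
    rw [map_mul, CliffordAlgebra.involute_ι, mul_assoc, ← hx, ← mul_assoc, ← mul_assoc, h]
    simp

/-- Contraction with a functional is an odd superderivation. -/
theorem contractLeft_mul (d : Module.Dual R M) (x y : ExteriorAlgebra R M) :
    contractLeft d (x * y) = contractLeft d x * y + involute x * contractLeft d y := by
  induction x using CliffordAlgebra.left_induction with
  | algebraMap r => simp [CliffordAlgebra.contractLeft_algebraMap_mul]
  | add a b ha hb => simp only [add_mul, map_add, ha, hb]; abel
  | ι_mul x m hx =>
    rw [mul_assoc, CliffordAlgebra.contractLeft_ι_mul, CliffordAlgebra.contractLeft_ι_mul, hx,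
      map_mul, CliffordAlgebra.involute_ι]
    simp only [sub_mul, mul_add, smul_mul_assoc, neg_mul, mul_assoc]
    abel

theorem involute_contractLeft (d : Module.Dual R M) (x : ExteriorAlgebra R M) :
    involute (contractLeft d x) = -contractLeft d (involute x) := by
  induction x using CliffordAlgebra.left_induction with
  | algebraMap r => simp
  | add a b ha hb => simp only [map_add, ha, hb]; abel
  | ι_mul x m hx =>
    rw [map_mul involute, CliffordAlgebra.involute_ι, neg_mul, map_neg,
      CliffordAlgebra.contractLeft_ι_mul, CliffordAlgebra.contractLeft_ι_mul, map_sub,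
      map_mul involute, CliffordAlgebra.involute_ι, map_smul, hx]
    simp

theorem contractLeft_map (f : M →ₗ[R] N) (d : Module.Dual R N) (x : ExteriorAlgebra R M) :
    contractLeft d (map f x) = map f (contractLeft (d ∘ₗ f) x) := by
  induction x using CliffordAlgebra.left_induction with
  | algebraMap r =>
    rw [AlgHom.commutes, CliffordAlgebra.contractLeft_algebraMap,
      CliffordAlgebra.contractLeft_algebraMap, map_zero]
  | add a b ha hb => simp only [map_add, ha, hb]
  | ι_mul x m hx =>
    have h : map f (CliffordAlgebra.ι (0 : QuadraticForm R M) m * x)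
      = CliffordAlgebra.ι (0 : QuadraticForm R N) (f m) * map f x := by
      rw [map_mul]; exact congrArg (· * _) (map_apply_ι f m)
    have h' : ∀ y, map f (CliffordAlgebra.ι (0 : QuadraticForm R M) m * y)
      = CliffordAlgebra.ι (0 : QuadraticForm R N) (f m) * map f y := fun y => by
      rw [map_mul]; exact congrArg (· * _) (map_apply_ι f m)
    rw [h, CliffordAlgebra.contractLeft_ι_mul, CliffordAlgebra.contractLeft_ι_mul, map_sub, hx,
      h', map_smul]
    rfl

theorem involute_map (f : M →ₗ[R] N) (x : ExteriorAlgebra R M) :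
    involute (map f x) = map f (involute x) := by
  have : (involute : CliffordAlgebra (0 : QuadraticForm R N) →ₐ[R] _).comp (map f)
      = (map f).comp (involute : CliffordAlgebra (0 : QuadraticForm R M) →ₐ[R] _) := by
    apply hom_ext
    ext v
    have e1 : map f (CliffordAlgebra.ι (0 : QuadraticForm R M) v)
      = CliffordAlgebra.ι (0 : QuadraticForm R N) (f v) := map_apply_ι f v
    simp only [ι, LinearMap.comp_apply, AlgHom.toLinearMap_apply, AlgHom.comp_apply,
      CliffordAlgebra.involute_ι, map_neg, e1]
  exact DFunLike.congr_fun this x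

theorem algebraMapInv_map (f : M →ₗ[R] N) (x : ExteriorAlgebra R M) :
    algebraMapInv (map f x) = algebraMapInv x := by
  have : (algebraMapInv : ExteriorAlgebra R N →ₐ[R] R).comp (map f) = algebraMapInv := by
    apply hom_ext
    ext v
    simp [algebraMapInv]
  exact DFunLike.congr_fun this x

theorem algebraMapInv_involute (x : ExteriorAlgebra R M) :
    algebraMapInv (involute x) = algebraMapInv x := by
  have : (algebraMapInv : ExteriorAlgebra R M →ₐ[R] R).comp
      (involute : CliffordAlgebra (0 : QuadraticForm R M) →ₐ[R] _) = algebraMapInv := by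
    apply hom_ext
    ext v
    simp [algebraMapInv, ι]
  exact DFunLike.congr_fun this x

variable (R M) in
/-- The elements of degree at least `n`, encoded as those whose iterated contractions with fewer
than `n` functionals have vanishing scalar part. -/
def degFiltration : ℕ → Submodule R (ExteriorAlgebra R M)
  | 0 => ⊤
  | n + 1 => LinearMap.ker (algebraMapInv (R := R) (M := M)).toLinearMap ⊓
      ⨅ d : Module.Dual R M, (degFiltration n).comap (contractLeft d)

theorem mem_degFiltration_succ {n : ℕ} {x : ExteriorAlgebra R M} :
    x ∈ degFiltration R M (n + 1) ↔
      algebraMapInv x = 0 ∧ ∀ d, contractLeft d x ∈ degFiltration R M n := by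
  simp [degFiltration]

theorem mem_degFiltration_one {x : ExteriorAlgebra R M} :
    x ∈ degFiltration R M 1 ↔ algebraMapInv x = 0 := by
  simp [degFiltration]

theorem mem_degFiltration_zero (x : ExteriorAlgebra R M) : x ∈ degFiltration R M 0 :=
  Submodule.mem_top

theorem degFiltration_antitone : Antitone (degFiltration R M) := by
  refine antitone_nat_of_succ_le fun n => ?_
  induction n with
  | zero => exact fun x _ => mem_degFiltration_zero x
  | succ n ih =>
    intro x hx
    rw [mem_degFiltration_succ] at hx ⊢
    exact ⟨hx.1, fun d => ih (hx.2 d)⟩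

theorem involute_mem_degFiltration {n : ℕ} {x : ExteriorAlgebra R M}
    (hx : x ∈ degFiltration R M n) : involute x ∈ degFiltration R M n := by
  induction n generalizing x with
  | zero => exact mem_degFiltration_zero _
  | succ n ih =>
    rw [mem_degFiltration_succ] at hx ⊢
    refine ⟨by rw [algebraMapInv_involute, hx.1], fun d => ?_⟩
    have := ih (hx.2 d)
    rw [involute_contractLeft] at this
    simpa using this

theorem map_mem_degFiltration (f : M →ₗ[R] N) {n : ℕ} {x : ExteriorAlgebra R M}
    (hx : x ∈ degFiltration R M n) : map f x ∈ degFiltration R N n := by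
  induction n generalizing x with
  | zero => exact mem_degFiltration_zero _
  | succ n ih =>
    rw [mem_degFiltration_succ] at hx ⊢
    refine ⟨by rw [algebraMapInv_map, hx.1], fun d => ?_⟩
    rw [contractLeft_map]
    exact ih (hx.2 _)

theorem mul_mem_degFiltration {i j : ℕ} {x y : ExteriorAlgebra R M}
    (hx : x ∈ degFiltration R M i) (hy : y ∈ degFiltration R M j) :
    x * y ∈ degFiltration R M (i + j) := by
  induction hn : i + j generalizing i j x y with
  | zero => exact mem_degFiltration_zero _
  | succ n ih =>
    rw [mem_degFiltration_succ]
    constructor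
    · rw [map_mul]
      rcases i with _ | i
      · obtain ⟨j, rfl⟩ : ∃ j', j = j' + 1 := ⟨n, by omega⟩
        rw [(mem_degFiltration_succ.1 hy).1, mul_zero]
      · rw [(mem_degFiltration_succ.1 hx).1, zero_mul]
    · intro d
      rw [contractLeft_mul]
      refine add_mem ?_ ?_
      · rcases i with _ | i
        · obtain rfl : j = n + 1 := by omega
          exact ih (mem_degFiltration_zero _) (degFiltration_antitone n.le_succ hy) (by omega)
        · exact ih ((mem_degFiltration_succ.1 hx).2 d) hy (by omega)
      · rcases j with _ | j
        · obtain rfl : i = n + 1 := by omega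
          exact ih (degFiltration_antitone n.le_succ (involute_mem_degFiltration hx))
            (mem_degFiltration_zero _) (by omega)
        · exact ih (involute_mem_degFiltration hx) ((mem_degFiltration_succ.1 hy).2 d) (by omega)

/-- Changing a linear map `r'` by a map of rank one, `r = r' + d(·)w`, changes the induced
homomorphism of exterior algebras by `x ↦ w · r(d ⌋ x)`. -/
theorem map_eq_map_add_ι_mul {r r' : M →ₗ[R] N} {d : Module.Dual R M} {w : N}
    (h : ∀ v, r v = r' v + d v • w) (x : ExteriorAlgebra R M) :
    map r x = map r' x + ι R w * map r (contractLeft d x) := by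
  have hm : ∀ (f : M →ₗ[R] N) (m : M) (y : ExteriorAlgebra R M),
      map f (CliffordAlgebra.ι (0 : QuadraticForm R M) m * y) = ι R (f m) * map f y :=
    fun f m y => by rw [map_mul]; exact congrArg (· * _) (map_apply_ι f m)
  induction x using CliffordAlgebra.left_induction with
  | algebraMap a => simp
  | add a b ha hb => rw [map_add, ha, hb, map_add, map_add, map_add, mul_add]; abel
  | ι_mul x m hx =>
    have h1 : ι R w * ι R (r m) = -(ι R (r' m) * ι R w) := by
      have := ι_add_mul_swap (R := R) w (r' m)
      rw [h, map_add, map_smul, mul_add, mul_smul_comm, ι_sq_zero, smul_zero, add_zero]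
      exact eq_neg_of_add_eq_zero_left this
    rw [CliffordAlgebra.contractLeft_ι_mul, map_sub, map_smul, hm, hm, hm, mul_sub,
      ← mul_assoc, h1]
    conv_lhs => rw [h, map_add, add_mul, hx, map_smul, mul_add]
    rw [hx]
    simp only [mul_add, mul_smul_comm, smul_mul_assoc, neg_mul, mul_assoc, smul_add]
    rw [← mul_assoc (ι R w) (ι R w), ι_sq_zero]
    simp only [zero_mul, smul_zero]
    abel

theorem map_zero_eq (x : ExteriorAlgebra R M) :
    map (0 : M →ₗ[R] N) x = algebraMap R _ (algebraMapInv x) := by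
  have : map (0 : M →ₗ[R] N) = (Algebra.ofId R _).comp algebraMapInv := by
    apply hom_ext
    ext v
    simp [algebraMapInv]
  exact DFunLike.congr_fun this x

theorem map_top_mul_range_pow_le (f : M →ₗ[R] N) (n : ℕ) {x : ExteriorAlgebra R M}
    (hx : x ∈ (⊤ : Submodule R (ExteriorAlgebra R M)) * LinearMap.range (ι R) ^ n) :
    map f x ∈ (⊤ : Submodule R (ExteriorAlgebra R N)) * LinearMap.range (ι R) ^ n := by
  have : ((⊤ : Submodule R (ExteriorAlgebra R M)) * LinearMap.range (ι R) ^ n).map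
      (map f).toLinearMap ≤ ⊤ * LinearMap.range (ι R) ^ n := by
    rw [Submodule.map_mul, Submodule.map_pow]
    refine mul_le_mul' le_top (pow_le_pow_left' ?_ n)
    rintro _ ⟨_, ⟨v, rfl⟩, rfl⟩
    exact ⟨f v, (map_apply_ι f v).symm⟩
  exact this ⟨x, hx, rfl⟩

theorem involute_top_mul_range_pow_le (n : ℕ) {x : ExteriorAlgebra R M}
    (hx : x ∈ (⊤ : Submodule R (ExteriorAlgebra R M)) * LinearMap.range (ι R) ^ n) :
    involute x ∈ (⊤ : Submodule R (ExteriorAlgebra R M)) * LinearMap.range (ι R) ^ n := by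
  have : ((⊤ : Submodule R (ExteriorAlgebra R M)) * LinearMap.range (ι R) ^ n).map
      (involute : CliffordAlgebra (0 : QuadraticForm R M) →ₐ[R] _).toLinearMap
        ≤ ⊤ * LinearMap.range (ι R) ^ n := by
    rw [Submodule.map_mul, Submodule.map_pow]
    refine mul_le_mul' le_top (pow_le_pow_left' ?_ n)
    rintro _ ⟨_, ⟨v, rfl⟩, rfl⟩
    exact ⟨-v, by simp [ι]⟩
  exact this ⟨x, hx, rfl⟩

/-- Elements of degree at least `n` are combinations of products that end in `n` generators. -/
theorem degFiltration_le_top_mul_range_pow {κ : Type*} [Fintype κ] (n : ℕ) :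
    degFiltration R (κ → R) n ≤ ⊤ * LinearMap.range (ι R) ^ n := by
  classical
  induction n with
  | zero => rw [pow_zero, mul_one]; exact le_top
  | succ n ih =>
    intro x hx
    rw [mem_degFiltration_succ] at hx
    -- `p S` keeps the coordinates in `S`; the coordinates are switched on one at a time
    let p : Finset κ → ((κ → R) →ₗ[R] (κ → R)) := fun S =>
      ∑ k ∈ S, (LinearMap.proj k : (κ → R) →ₗ[R] R).smulRight (Pi.single k (1 : R))
    have key : ∀ S : Finset κ, map (p S) x ∈
        (⊤ : Submodule R (ExteriorAlgebra R (κ → R))) * LinearMap.range (ι R) ^ (n + 1) := by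
      intro S
      induction S using Finset.induction_on with
      | empty =>
        simp only [p, Finset.sum_empty]
        rw [map_zero_eq, hx.1, map_zero]
        exact zero_mem _
      | insert k S hk hS =>
        rw [map_eq_map_add_ι_mul (r := p (insert k S)) (r' := p S) (d := LinearMap.proj k)
          (w := Pi.single k 1), ι_mul_eq_involute_mul_ι]
        · refine add_mem hS ?_
          rw [pow_succ, ← mul_assoc]
          exact Submodule.mul_mem_mul (involute_top_mul_range_pow_le n
            (map_top_mul_range_pow_le _ n (ih (hx.2 _)))) ⟨_, rfl⟩
        · intro v
          simp only [p, Finset.sum_insert hk, LinearMap.add_apply, LinearMap.smulRight_apply]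
          rw [add_comm]
    have h1 : p Finset.univ = LinearMap.id := by
      ext k l
      simp [p, Pi.single_apply, ite_apply]
    have := key Finset.univ
    rwa [h1, map_id] at this

end CommRing

/-! ### Parity in an exterior algebra -/

section Parity

variable {K V W : Type*} [Field K] [AddCommGroup V] [Module K V]
  [AddCommGroup W] [Module K W]

theorem zmod_two_cases (p : ZMod 2) : p = 0 ∨ p = 1 := by
  revert p; decide

theorem involute_of_mem_evenOdd {p : ZMod 2} {x : ExteriorAlgebra K V}
    (hx : x ∈ evenOdd (0 : QuadraticForm K V) p) : involute x = (-1 : K) ^ p.val • x := by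
  obtain rfl | rfl := zmod_two_cases p
  · rw [CliffordAlgebra.involute_eq_of_mem_even hx, ZMod.val_zero, pow_zero, one_smul]
  · rw [CliffordAlgebra.involute_eq_of_mem_odd hx, ZMod.val_one, pow_one, neg_one_smul]

theorem mem_evenOdd_iff_involute [CharZero K] {p : ZMod 2} {x : ExteriorAlgebra K V} :
    x ∈ evenOdd (0 : QuadraticForm K V) p ↔ involute x = (-1 : K) ^ p.val • x := by
  refine ⟨involute_of_mem_evenOdd, fun h => ?_⟩
  have hx : x ∈ evenOdd (0 : QuadraticForm K V) 0 ⊔ evenOdd (0 : QuadraticForm K V) 1 := by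
    rw [(CliffordAlgebra.evenOdd_isCompl (Q := (0 : QuadraticForm K V))).sup_eq_top]
    exact Submodule.mem_top
  obtain ⟨a, ha, b, hb, rfl⟩ := Submodule.mem_sup.1 hx
  rw [map_add, CliffordAlgebra.involute_eq_of_mem_even ha,
    CliffordAlgebra.involute_eq_of_mem_odd hb] at h
  have two : ∀ y : CliffordAlgebra (0 : QuadraticForm K V), y = -y → y = 0 := fun y hy => by
    have : (2 : K) • y = 0 := by rw [two_smul]; nth_rw 1 [hy]; simp
    exact (smul_eq_zero.1 this).resolve_left two_ne_zero
  obtain rfl | rfl := zmod_two_cases p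
  · rw [ZMod.val_zero, pow_zero, one_smul, add_right_inj] at h
    rw [two b h.symm, add_zero]
    exact ha
  · rw [ZMod.val_one, pow_one, neg_one_smul, neg_add, add_left_inj] at h
    rw [two a h, zero_add]
    exact hb

theorem map_mem_evenOdd [CharZero K] (f : V →ₗ[K] W) {p : ZMod 2} {x : ExteriorAlgebra K V}
    (hx : x ∈ evenOdd (0 : QuadraticForm K V) p) :
    map f x ∈ evenOdd (0 : QuadraticForm K W) p := by
  rw [mem_evenOdd_iff_involute] at hx ⊢
  rw [involute_map, hx, map_smul]

theorem neg_one_pow_val_add_one (p : ZMod 2) :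
    (-1 : K) ^ (p + 1).val = -(-1 : K) ^ p.val := by
  obtain rfl | rfl := zmod_two_cases p
  · rw [zero_add, ZMod.val_one, ZMod.val_zero, pow_one, pow_zero]
  · rw [show (1 + 1 : ZMod 2) = 0 from rfl, ZMod.val_one, ZMod.val_zero, pow_one, pow_zero, neg_neg]

theorem contractLeft_mem_evenOdd [CharZero K] (d : Module.Dual K V) {p : ZMod 2}
    {x : ExteriorAlgebra K V} (hx : x ∈ evenOdd (0 : QuadraticForm K V) p) :
    contractLeft d x ∈ evenOdd (0 : QuadraticForm K V) (p + 1) := by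
  rw [mem_evenOdd_iff_involute] at hx ⊢
  rw [involute_contractLeft, hx, map_smul, neg_one_pow_val_add_one, neg_smul]

theorem mul_comm_of_mem_evenOdd {p q : ZMod 2} {x y : ExteriorAlgebra K V}
    (hx : x ∈ evenOdd (0 : QuadraticForm K V) p) (hy : y ∈ evenOdd (0 : QuadraticForm K V) q) :
    x * y = (-1 : K) ^ (p.val * q.val) • (y * x) := by
  have h := CliffordAlgebra.map_mul_map_of_isOrtho_of_mem_evenOdd
    (QuadraticMap.Isometry.id (0 : QuadraticForm K V)) (QuadraticMap.Isometry.id _)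
    (fun _ _ => by simp [QuadraticMap.IsOrtho]) x y hx hy
  simp only [CliffordAlgebra.map_id, AlgHom.id_apply] at h
  rw [h]
  obtain rfl | rfl := zmod_two_cases p <;> obtain rfl | rfl := zmod_two_cases q
  all_goals
    simp only [mul_zero, mul_one, ZMod.val_zero, ZMod.val_one, pow_zero, one_smul, pow_one,
      uzpow_zero, neg_one_smul]
  rw [show (1 : ZMod 2) = ((1 : ℕ) : ZMod 2) from Nat.cast_one.symm, uzpow_natCast, pow_one,
    Units.neg_smul, one_smul]

end Parity

/-! ### Slices of an exterior algebra along a direct summand -/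

section Slice

variable {R M N : Type*} [CommRing R] [AddCommGroup M] [Module R M] [AddCommGroup N] [Module R N]

/-- The component of an element of `Λ M` along a list of directions transversal to a direct summand
`N` of `M`: contract with the functionals in the list, then project to `Λ N`. -/
def slice (r : M →ₗ[R] N) :
    List (Module.Dual R M) → (ExteriorAlgebra R M →ₗ[R] ExteriorAlgebra R N)
  | [] => (map r).toLinearMap
  | d :: J => slice r J ∘ₗ contractLeft d

variable {r : M →ₗ[R] N} {j : N →ₗ[R] M}

theorem map_retraction (hr : r ∘ₗ j = LinearMap.id) (x : ExteriorAlgebra R N) :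
    map r (map j x) = x := by
  rw [← AlgHom.comp_apply, map_comp_map, hr, map_id, AlgHom.id_apply]

theorem slice_mul_map (hr : r ∘ₗ j = LinearMap.id) {J : List (Module.Dual R M)}
    (hJ : ∀ d ∈ J, d ∘ₗ j = 0) (x : ExteriorAlgebra R M) (y : ExteriorAlgebra R N) :
    slice r J (x * map j y) = slice r J x * y := by
  induction J generalizing x with
  | nil => simp [slice, map_retraction hr]
  | cons d J ih =>
    simp only [List.mem_cons, forall_eq_or_imp] at hJ
    simp only [slice, LinearMap.comp_apply]
    rw [contractLeft_mul, contractLeft_map, hJ.1, map_zero, LinearMap.zero_apply, map_zero,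
      mul_zero, add_zero, ih hJ.2]

theorem slice_map_mul (hr : r ∘ₗ j = LinearMap.id) {J : List (Module.Dual R M)}
    (hJ : ∀ d ∈ J, d ∘ₗ j = 0) (x : ExteriorAlgebra R M) {y : ExteriorAlgebra R N} {s : R}
    (hy : involute y = s • y) :
    slice r J (map j y * x) = s ^ J.length • (y * slice r J x) := by
  induction J generalizing x with
  | nil => simp [slice, map_retraction hr]
  | cons d J ih =>
    simp only [List.mem_cons, forall_eq_or_imp] at hJ
    simp only [slice, LinearMap.comp_apply]
    rw [contractLeft_mul, contractLeft_map, hJ.1, map_zero, LinearMap.zero_apply, map_zero,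
      zero_mul, zero_add, involute_map, hy, map_smul, smul_mul_assoc, map_smul, ih hJ.2, smul_smul,
      List.length_cons, pow_succ']

theorem slice_contractLeft (J : List (Module.Dual R M)) (d : Module.Dual R N)
    (x : ExteriorAlgebra R M) :
    slice r J (contractLeft (d ∘ₗ r) x) = (-1 : R) ^ J.length • contractLeft d (slice r J x) := by
  induction J generalizing x with
  | nil => simp [slice, contractLeft_map]
  | cons d' J ih =>
    simp only [slice, LinearMap.comp_apply]
    rw [CliffordAlgebra.contractLeft_comm, map_neg, ih, List.length_cons, pow_succ]
    simp

/-- An element of `Λ M` has degree at least `n` if all its components along `N` have. -/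
theorem mem_degFiltration_of_slice (hr : r ∘ₗ j = LinearMap.id) {n : ℕ} {x : ExteriorAlgebra R M}
    (h : ∀ J : List (Module.Dual R M), (∀ d ∈ J, d ∘ₗ j = 0) →
      slice r J x ∈ degFiltration R N n) : x ∈ degFiltration R M n := by
  induction n generalizing x with
  | zero => exact mem_degFiltration_zero _
  | succ n ih =>
    rw [mem_degFiltration_succ]
    refine ⟨?_, fun d => ?_⟩
    · have := (mem_degFiltration_succ.1 (h [] (by simp))).1
      rwa [slice, AlgHom.toLinearMap_apply, algebraMapInv_map] at this
    · have hd : d = (d ∘ₗ j) ∘ₗ r + (d - (d ∘ₗ j) ∘ₗ r) := by abel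
      rw [hd, map_add, LinearMap.add_apply]
      refine add_mem (ih fun J hJ => ?_) (ih fun J hJ => ?_)
      · rw [slice_contractLeft]
        exact Submodule.smul_mem _ _ ((mem_degFiltration_succ.1 (h J hJ)).2 _)
      · refine degFiltration_antitone n.le_succ (h (_ :: J) ?_)
        simp only [List.mem_cons, forall_eq_or_imp]
        refine ⟨?_, hJ⟩
        rw [LinearMap.sub_comp, LinearMap.comp_assoc, hr, LinearMap.comp_id, sub_self]

theorem slice_mem_evenOdd {K V W : Type*} [Field K] [CharZero K] [AddCommGroup V] [Module K V]
    [AddCommGroup W] [Module K W] (r : V →ₗ[K] W) (J : List (Module.Dual K V)) {p : ZMod 2}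
    {x : ExteriorAlgebra K V} (hx : x ∈ evenOdd (0 : QuadraticForm K V) p) :
    slice r J x ∈ evenOdd (0 : QuadraticForm K W) (p + J.length) := by
  induction J generalizing x p with
  | nil => simpa [slice] using map_mem_evenOdd r hx
  | cons d J ih =>
    have := ih (contractLeft_mem_evenOdd d hx)
    rw [List.length_cons, Nat.cast_succ, add_comm (J.length : ZMod 2), ← add_assoc]
    exact this

end Slice

end ExteriorAlgebra

/-! ### Holomorphic functions of several variables -/

section SeveralVariables

open MeasureTheory Metric Set Filter Topology

/-- Differentiation under the integral sign for holomorphic integrands; the bound on the derivative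
near `x₀` comes from the Schwarz lemma. -/
theorem differentiableAt_integral_comp_affine {E : Type*} [NormedAddCommGroup E] [NormedSpace ℂ E]
    [FiniteDimensional ℂ E] {f : E → ℂ} {U : Set E} (hU : IsOpen U) (hf : DifferentiableOn ℂ f U)
    {k s : ℝ → ℂ} {γ : ℝ → E} (hk : Continuous k) (hs : Continuous s) (hγ : Continuous γ)
    {a b : ℝ} {x₀ : E} (hx₀ : ∀ t ∈ uIcc a b, s t • x₀ + γ t ∈ U) :
    DifferentiableAt ℂ (fun x => ∫ t in a..b, k t * f (s t • x + γ t)) x₀ := by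
  have : ProperSpace E := FiniteDimensional.proper ℂ E
  borelize E
  let Φ : E × ℝ → E := fun p => s p.2 • p.1 + γ p.2
  have hΦ : Continuous Φ := by fun_prop
  obtain ⟨A, B, hA, -, hxA, hIB, hAB⟩ := generalized_tube_lemma (isCompact_singleton (x := x₀))
    (isCompact_uIcc (a := a) (b := b)) (hU.preimage hΦ) (by
      rintro ⟨x, t⟩ ⟨hx, ht⟩
      obtain rfl : x = x₀ := hx
      exact hx₀ t ht)
  obtain ⟨δ, hδ, hδA⟩ : ∃ δ > 0, closedBall x₀ (2 * δ) ⊆ A := by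
    obtain ⟨ε, hε, h⟩ := nhds_basis_closedBall.mem_iff.1 (hA.mem_nhds (hxA rfl))
    exact ⟨ε / 2, by positivity, by rwa [mul_div_cancel₀ _ two_ne_zero]⟩
  have hmem : ∀ x ∈ closedBall x₀ (2 * δ), ∀ t ∈ uIcc a b, s t • x + γ t ∈ U :=
    fun x hx t ht => hAB (⟨hδA hx, hIB ht⟩ : (x, t) ∈ A ×ˢ B)
  obtain ⟨C, hC⟩ := ((isCompact_closedBall x₀ (2 * δ)).prod (isCompact_uIcc (a := a) (b := b))
    ).exists_bound_of_continuousOn (f := fun p => f (Φ p))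
    (hf.continuousOn.comp hΦ.continuousOn fun p hp => hmem p.1 hp.1 p.2 hp.2)
  obtain ⟨D, hD⟩ := (isCompact_uIcc (a := a) (b := b)).exists_bound_of_continuousOn
    hk.continuousOn
  have hball : ∀ {x}, x ∈ ball x₀ δ → x ∈ closedBall x₀ (2 * δ) := fun hx =>
    closedBall_subset_closedBall (by linarith) (ball_subset_closedBall hx)
  have hsub : uIoc a b ⊆ uIcc a b := uIoc_subset_uIcc
  have hder : ∀ x ∈ closedBall x₀ (2 * δ), ∀ t ∈ uIcc a b,
      HasFDerivAt (fun y => f (s t • y + γ t)) (s t • fderiv ℂ f (s t • x + γ t)) x := by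
    intro x hx t ht
    have h1 := (hf.differentiableAt (hU.mem_nhds (hmem x hx t ht))).hasFDerivAt
    have h2 : HasFDerivAt (fun y => s t • y + γ t) (s t • ContinuousLinearMap.id ℂ E) x :=
      ((hasFDerivAt_id x).const_smul (s t)).add_const (γ t)
    have h3 := h1.comp x h2
    rw [ContinuousLinearMap.comp_smul, ContinuousLinearMap.comp_id] at h3
    exact h3
  have hcont : ∀ x ∈ closedBall x₀ (2 * δ),
      ContinuousOn (fun t => k t * f (s t • x + γ t)) (uIcc a b) := fun x hx =>
    hk.continuousOn.mul (hf.continuousOn.comp (by fun_prop) fun t ht => hmem x hx t ht)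
  refine (intervalIntegral.hasFDerivAt_integral_of_dominated_of_fderiv_le
    (F' := fun x t => k t • (s t • fderiv ℂ f (s t • x + γ t)))
    (bound := fun _ => D * (2 * C / δ)) (ball_mem_nhds x₀ hδ) ?_ ?_ ?_ ?_ ?_ ?_).differentiableAt
  · filter_upwards [ball_mem_nhds x₀ hδ] with x hx
    exact ((hcont x (hball hx)).mono hsub).aestronglyMeasurable measurableSet_uIoc
  · exact (hcont x₀ (mem_closedBall_self (by positivity))).intervalIntegrable
  · have hm : Measurable (fun t => k t • (s t • fderiv ℂ f (s t • x₀ + γ t))) :=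
      hk.measurable.smul (hs.measurable.smul ((measurable_fderiv ℂ f).comp
        (by fun_prop : Continuous fun t => s t • x₀ + γ t).measurable))
    exact hm.aestronglyMeasurable
  · refine Eventually.of_forall fun t ht x hx => ?_
    rw [norm_smul]
    have hC' : ∀ y ∈ ball x δ, ‖f (s t • y + γ t)‖ ≤ C := fun y hy => by
      refine hC (y, t) ⟨?_, hsub ht⟩
      have := dist_triangle y x x₀
      rw [mem_ball] at hx hy
      rw [mem_closedBall]
      linarith
    have hyc : ∀ y ∈ ball x δ, y ∈ closedBall x₀ (2 * δ) := fun y hy => by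
      have := dist_triangle y x x₀
      rw [mem_ball] at hx hy
      rw [mem_closedBall]
      linarith
    have h1 : ‖s t • fderiv ℂ f (s t • x + γ t)‖ ≤ 2 * C / δ := by
      rw [← (hder x (hball hx) t (hsub ht)).fderiv]
      refine Complex.norm_fderiv_le_div_of_mapsTo_ball
        (fun y hy => (hder y (hyc y hy) t (hsub ht)).differentiableAt.differentiableWithinAt)
        (fun y hy => ?_) hδ
      rw [mem_closedBall, dist_eq_norm]
      refine (norm_sub_le _ _).trans ?_
      have := hC' y hy
      have := hC' x (mem_ball_self hδ)
      linarith
    exact mul_le_mul (hD t (hsub ht)) h1 (norm_nonneg _) ((norm_nonneg _).trans (hD t (hsub ht)))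
  · exact intervalIntegrable_const
  · refine Eventually.of_forall fun t ht x hx => ?_
    exact (hder x (hball hx) t (hsub ht)).const_mul (k t)

/-- Directional derivatives of holomorphic functions are holomorphic, by Cauchy's formula along
complex lines. -/
theorem DifferentiableOn.fderiv_apply_of_isOpen {E : Type*} [NormedAddCommGroup E] [NormedSpace ℂ E]
    [FiniteDimensional ℂ E] {f : E → ℂ} {U : Set E} (hU : IsOpen U) (hf : DifferentiableOn ℂ f U)
    (v : E) : DifferentiableOn ℂ (fun x => fderiv ℂ f x v) U := by
  intro x₀ hx₀
  obtain ⟨ε, hε, hεU⟩ := Metric.isOpen_iff.1 hU x₀ hx₀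
  let r : ℝ := ε / (2 * (‖v‖ + 1))
  have hr : 0 < r := by positivity
  have hmem : ∀ x ∈ ball x₀ (ε / 2), ∀ z ∈ closedBall (0 : ℂ) r, x + z • v ∈ U := by
    intro x hx z hz
    apply hεU
    rw [mem_ball, dist_eq_norm] at hx ⊢
    rw [mem_closedBall, dist_zero_right] at hz
    have h1 : ‖z • v‖ < ε / 2 := by
      rw [norm_smul]
      have : r * (‖v‖ + 1) = ε / 2 := by simp only [r]; field_simp
      nlinarith [norm_nonneg v, norm_nonneg z]
    calc ‖x + z • v - x₀‖ = ‖(x - x₀) + z • v‖ := by congr 1; abel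
      _ ≤ ‖x - x₀‖ + ‖z • v‖ := norm_add_le _ _
      _ < ε := by linarith
  have hline : ∀ (x : E) (z : ℂ), HasDerivAt (fun z : ℂ => x + z • v) v z := fun x z => by
    simpa using ((hasDerivAt_id z).smul_const v).const_add x
  have key : ∀ x ∈ ball x₀ (ε / 2), fderiv ℂ f x v = (2 * Real.pi * Complex.I : ℂ)⁻¹ *
      ∫ θ in (0 : ℝ)..2 * Real.pi, (_root_.deriv (circleMap 0 r) θ * ((circleMap 0 r θ) ^ 2)⁻¹) *
        f ((1 : ℂ) • x + circleMap 0 r θ • v) := by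
    intro x hx
    have hd : ∀ z ∈ closedBall (0 : ℂ) r,
        HasDerivAt (fun z : ℂ => f (x + z • v)) (fderiv ℂ f (x + z • v) v) z := fun z hz =>
      (hf.differentiableAt (hU.mem_nhds (hmem x hx z hz))).hasFDerivAt.comp_hasDerivAt z
        (hline x z)
    have hopen : IsOpen ((fun z : ℂ => x + z • v) ⁻¹' U) :=
      hU.preimage (by fun_prop)
    have h := Complex.two_pi_I_inv_smul_circleIntegral_sub_sq_inv_smul_of_differentiable hopen
      (c := 0) (w₀ := 0) (R := r) (f := fun z : ℂ => f (x + z • v)) (fun z hz => hmem x hx z hz)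
      (fun z hz => ((hf.differentiableAt (hU.mem_nhds hz)).hasFDerivAt.comp_hasDerivAt z
        (hline x z)).differentiableAt.differentiableWithinAt) (mem_ball_self hr)
    have h0 := (hd 0 (mem_closedBall_self hr.le)).deriv
    rw [zero_smul, add_zero] at h0
    rw [← h0, ← h, smul_eq_mul, circleIntegral]
    congr 1
    refine intervalIntegral.integral_congr fun θ _ => ?_
    simp only [sub_zero, smul_eq_mul, one_smul, mul_assoc]
  refine DifferentiableAt.differentiableWithinAt ?_
  refine DifferentiableAt.congr_of_eventuallyEq (DifferentiableAt.const_mul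
    (differentiableAt_integral_comp_affine hU hf (s := fun _ => 1)
      (γ := fun θ => circleMap 0 r θ • v)
      (k := fun θ => _root_.deriv (circleMap 0 r) θ * ((circleMap 0 r θ) ^ 2)⁻¹)
      (a := 0) (b := 2 * Real.pi) (x₀ := x₀) ?_ continuous_const ?_ ?_) _)
    (Filter.eventuallyEq_of_mem (ball_mem_nhds x₀ (by positivity)) key)
  · refine Continuous.mul ?_ (Continuous.inv₀ (by fun_prop) fun θ => ?_)
    · rw [show _root_.deriv (circleMap 0 r) = fun θ => circleMap 0 r θ * Complex.I from
        funext fun θ => by rw [deriv_circleMap]]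
      fun_prop
    · exact pow_ne_zero 2 (circleMap_ne_center hr.ne')
  · fun_prop
  · intro θ _
    rw [one_smul]
    exact hmem x₀ (mem_ball_self (by positivity)) _ (circleMap_mem_closedBall 0 hr.le θ)

/-- **Hadamard's lemma**: near `a`, a holomorphic function differs from its value at `a` by a
combination of the functions `xᵢ - aᵢ` with holomorphic coefficients. -/
theorem DifferentiableOn.exists_eq_add_sum_mul {ι : Type*} [Fintype ι] {f : (ι → ℂ) → ℂ}
    {U : Set (ι → ℂ)} (hU : IsOpen U) (hf : DifferentiableOn ℂ f U) {a : ι → ℂ} (ha : a ∈ U) :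
    ∃ ε > 0, ball a ε ⊆ U ∧ ∃ g : ι → (ι → ℂ) → ℂ, (∀ i, DifferentiableOn ℂ (g i) (ball a ε)) ∧
      ∀ x ∈ ball a ε, f x = f a + ∑ i, (x i - a i) * g i x := by
  classical
  obtain ⟨ε, hε, hεU⟩ := Metric.isOpen_iff.1 hU a ha
  let e : ι → ι → ℂ := fun i => Pi.single i 1
  have hmem : ∀ x ∈ ball a ε, ∀ t ∈ uIcc (0 : ℝ) 1, (t : ℂ) • x + (1 - t : ℂ) • a ∈ ball a ε := by
    intro x hx t ht
    rw [uIcc_of_le zero_le_one] at ht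
    have := (convex_ball a ε) hx (mem_ball_self hε) ht.1 (sub_nonneg.2 ht.2) (by ring)
    simpa [Complex.real_smul, ← Complex.coe_smul] using this
  refine ⟨ε, hε, hεU, fun i x => ∫ t in (0 : ℝ)..1, (fun _ => (1 : ℂ)) t *
    fderiv ℂ f ((t : ℂ) • x + (1 - t : ℂ) • a) (e i), fun i x hx => ?_, fun x hx => ?_⟩
  · exact (differentiableAt_integral_comp_affine (f := fun y => fderiv ℂ f y (e i)) hU
      (hf.fderiv_apply_of_isOpen hU (e i)) continuous_const Complex.continuous_ofReal
      (by fun_prop) fun t ht => hεU (hmem x hx t ht)).differentiableWithinAt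
  · have hcont : ∀ i, ContinuousOn (fun t : ℝ =>
        fderiv ℂ f ((t : ℂ) • x + (1 - t : ℂ) • a) (e i)) (uIcc 0 1) := fun i =>
      (hf.fderiv_apply_of_isOpen hU (e i)).continuousOn.comp
        (by fun_prop) fun t ht => hεU (hmem x hx t ht)
    have hder : ∀ t ∈ uIcc (0 : ℝ) 1, HasDerivAt
        (fun t : ℝ => f ((t : ℂ) • x + (1 - t : ℂ) • a))
        (∑ i, (x i - a i) * fderiv ℂ f ((t : ℂ) • x + (1 - t : ℂ) • a) (e i)) t := by
      intro t ht
      have h1 := (hf.differentiableAt (hU.mem_nhds (hεU (hmem x hx t ht)))).hasFDerivAt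
      have h2 : HasDerivAt (fun t : ℂ => t • x + (1 - t) • a) (x - a) (t : ℂ) := by
        have h := (HasDerivAt.smul_const (hasDerivAt_id' (t : ℂ)) x).fun_add
          (HasDerivAt.smul_const ((hasDerivAt_id' (t : ℂ)).const_sub 1) a)
        rwa [one_smul, neg_one_smul, ← sub_eq_add_neg] at h
      have h3 := (h1.comp_hasDerivAt (t : ℂ) h2).comp_ofReal
      have h4 : x - a = ∑ i, (x i - a i) • e i := by
        ext j
        simp [e, Finset.sum_apply, Pi.single_apply]
      have h5 : ∀ L : (ι → ℂ) →L[ℂ] ℂ, L (x - a) = ∑ i, (x i - a i) * L (e i) := fun L => by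
        rw [h4, map_sum]
        simp
      rw [h5] at h3
      exact h3
    have hint := intervalIntegral.integral_eq_sub_of_hasDerivAt hder
      (ContinuousOn.intervalIntegrable (continuousOn_finsetSum _ fun i _ =>
        continuousOn_const.mul (hcont i)))
    rw [intervalIntegral.integral_finsetSum fun i _ => ContinuousOn.intervalIntegrable
      (u := fun t : ℝ => (x i - a i) * fderiv ℂ f ((t : ℂ) • x + (1 - t : ℂ) • a) (e i))
      (continuousOn_const.mul (hcont i))] at hint
    simp only [intervalIntegral.integral_const_mul, Complex.ofReal_one, one_smul, sub_self,
      zero_smul, add_zero, Complex.ofReal_zero, sub_zero, zero_add] at hint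
    simp only [one_mul]
    rw [hint]
    ring

end SeveralVariables

/-! ### Holomorphic functions on open sets -/

namespace Holo

variable {ι : Type*} [Fintype ι] {V W : Opens (ι → ℂ)}

/-- The extension of a holomorphic function by zero. -/
def ext0 (f : Holo ι V) (x : ι → ℂ) : ℂ :=
  open Classical in if h : x ∈ V then f.1 ⟨x, h⟩ else 0

theorem ext0_of_mem (f : Holo ι V) {x : ι → ℂ} (h : x ∈ V) : (ext0 f) x = f.1 ⟨x, h⟩ := by
  simp [ext0, h]

theorem differentiableOn_ext0 (f : Holo ι V) : DifferentiableOn ℂ (ext0 f) V := by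
  obtain ⟨g, hg, h⟩ := f.2
  exact hg.congr fun x hx => ((ext0_of_mem f) hx).trans (h ⟨x, hx⟩)

theorem differentiableAt_ext0 (f : Holo ι V) {x : ι → ℂ} (h : x ∈ V) :
    DifferentiableAt ℂ (ext0 f) x :=
  (differentiableOn_ext0 f).differentiableAt (V.isOpen.mem_nhds h)

/-- A holomorphic function as a section. -/
def mk' (V : Opens (ι → ℂ)) (g : (ι → ℂ) → ℂ) (hg : DifferentiableOn ℂ g V) : Holo ι V :=
  ⟨fun x => g x, g, hg, fun _ => rfl⟩

/-- Evaluation at a point. -/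
def eval (a : V) : Holo ι V →ₐ[ℂ] ℂ := (Pi.evalAlgHom ℂ (fun _ : V => ℂ) a).comp (Holo ι V).val

theorem eval_apply (a : V) (f : Holo ι V) : eval a f = f.1 a := rfl

open Filter Topology in
theorem ext0_eventuallyEq {f : Holo ι V} {x : ι → ℂ} (h : x ∈ V) {g : (ι → ℂ) → ℂ}
    (hg : ∀ y : V, f.1 y = g y) : (ext0 f) =ᶠ[𝓝 x] g := by
  filter_upwards [V.isOpen.mem_nhds h] with y hy
  rw [(ext0_of_mem f) hy]
  exact hg ⟨y, hy⟩

open Classical in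
/-- The partial derivative with respect to the `i`-th coordinate. -/
def pderiv (i : ι) : Holo ι V →ₗ[ℂ] Holo ι V where
  toFun f := mk' V (fun x => fderiv ℂ (ext0 f) x (Pi.single i 1))
    ((differentiableOn_ext0 f).fderiv_apply_of_isOpen V.isOpen _)
  map_add' f g := by
    ext x
    have : fderiv ℂ (ext0 (f + g)) x = fderiv ℂ (ext0 f) x + fderiv ℂ (ext0 g) x := by
      rw [← fderiv_add ((differentiableAt_ext0 f) x.2) ((differentiableAt_ext0 g) x.2)]
      refine (ext0_eventuallyEq x.2 fun y => ?_).fderiv_eq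
      simp [ext0_of_mem _ y.2]
    simp [mk', this]
  map_smul' c f := by
    ext x
    have : fderiv ℂ (ext0 (c • f)) x = c • fderiv ℂ (ext0 f) x := by
      rw [← fderiv_const_smul ((differentiableAt_ext0 f) x.2)]
      refine (ext0_eventuallyEq x.2 fun y => ?_).fderiv_eq
      simp [ext0_of_mem _ y.2]
    simp [mk', this]

open Classical in
theorem pderiv_apply (i : ι) (f : Holo ι V) (x : V) :
    (pderiv i f).1 x = fderiv ℂ (ext0 f) x (Pi.single i 1) := rfl

theorem pderiv_mul (i : ι) (f g : Holo ι V) :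
    pderiv i (f * g) = pderiv i f * g + f * pderiv i g := by
  classical
  ext x
  have : fderiv ℂ (ext0 (f * g)) x =
      (ext0 f) x • fderiv ℂ (ext0 g) x + (ext0 g) x • fderiv ℂ (ext0 f) x := by
    rw [← fderiv_mul ((differentiableAt_ext0 f) x.2) ((differentiableAt_ext0 g) x.2)]
    refine (ext0_eventuallyEq x.2 fun y => ?_).fderiv_eq
    simp [ext0_of_mem _ y.2]
  have h : ∀ (a b : Holo ι V), (a * b).1 x = a.1 x * b.1 x ∧ (a + b).1 x = a.1 x + b.1 x :=
    fun _ _ => ⟨rfl, rfl⟩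
  rw [(h _ _).2, (h _ _).1, (h _ _).1, pderiv_apply, pderiv_apply, pderiv_apply, this,
    ext0_of_mem _ x.2, ext0_of_mem _ x.2]
  simp
  ring

theorem pderiv_res (h : W ≤ V) (i : ι) (f : Holo ι V) :
    pderiv i (res h f) = res h (pderiv i f) := by
  classical
  ext x
  have e : (res h (pderiv i f)).1 x = (pderiv i f).1 ⟨x.1, h x.2⟩ := rfl
  rw [e, pderiv_apply, pderiv_apply]
  congr 1
  refine (ext0_eventuallyEq x.2 fun y => ?_).fderiv_eq
  rw [ext0_of_mem _ (h y.2)]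
  rfl

variable (V) in
/-- The `i`-th coordinate function. -/
def coord (i : ι) : Holo ι V := ⟨fun x => x.1 i, fun x => x i, by fun_prop, fun _ => rfl⟩

open Classical in
theorem pderiv_coord (i j : ι) :
    pderiv i (coord V j) = algebraMap ℂ (Holo ι V) (if j = i then 1 else 0) := by
  ext x
  rw [pderiv_apply]
  have : fderiv ℂ (ext0 (coord V j)) x = ContinuousLinearMap.proj j := by
    rw [(ext0_eventuallyEq x.2 (g := fun y => y j) fun y => rfl).fderiv_eq]
    exact (ContinuousLinearMap.proj (R := ℂ) (φ := fun _ : ι => ℂ) j).fderiv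
  rw [this]
  have e : (algebraMap ℂ (Holo ι V) (if j = i then 1 else 0)).1 x = if j = i then 1 else 0 := rfl
  rw [e]
  simp [Pi.single_apply]

/-- Hadamard's lemma for sections. -/
theorem exists_res_eq_add_sum (f : Holo ι V) {a : ι → ℂ} (ha : a ∈ V) :
    ∃ (W : Opens (ι → ℂ)) (h : W ≤ V) (_ : a ∈ W) (g : ι → Holo ι W),
      res h f = algebraMap ℂ _ (f.1 ⟨a, ha⟩) +
        ∑ i, (coord W i - algebraMap ℂ _ (a i)) * g i := by
  obtain ⟨ε, hε, hV, g, hg, h⟩ := (differentiableOn_ext0 f).exists_eq_add_sum_mul V.isOpen ha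
  let W : Opens (ι → ℂ) := ⟨Metric.ball a ε, Metric.isOpen_ball⟩
  refine ⟨W, hV, Metric.mem_ball_self hε, fun i => mk' W (g i) (hg i), ?_⟩
  ext x
  have e1 : (res (V := V) (W := W) hV f).1 x = (ext0 f) x := ((ext0_of_mem f) (hV x.2)).symm
  have e2 : (algebraMap ℂ (Holo ι W) (f.1 ⟨a, ha⟩) +
      ∑ i, (coord W i - algebraMap ℂ _ (a i)) * mk' W (g i) (hg i)).1 x =
      f.1 ⟨a, ha⟩ + ∑ i, (x.1 i - a i) * g i x := by
    change eval x (_ + _) = _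
    rw [map_add, map_sum]
    simp only [map_mul, map_sub]
    rfl
  rw [e1, e2, h x.1 x.2, (ext0_of_mem f) ha]

end Holo

/-! ### Superfunctions on superdomains as functions with values in a Grassmann algebra -/

/-- The Grassmann algebra on generators indexed by `κ`. -/
abbrev Grassmann (κ : Type*) : Type _ := ExteriorAlgebra ℂ (κ → ℂ)

instance Grassmann.finite (κ : Type*) [Fintype κ] : Module.Finite ℂ (Grassmann κ) :=
  Module.Finite.of_basis ((Pi.basisFun ℂ κ).reindex (Fintype.equivFin κ)).ExteriorAlgebra

namespace DomainSec

instance instRing (ι κ : Type*) [Fintype ι] [Fintype κ] (V : Opens (ι → ℂ)) :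
    Ring (DomainSec ι κ V) :=
  Algebra.TensorProduct.instRing

variable {ι κ : Type*} [Fintype ι] [Fintype κ] {V W : Opens (ι → ℂ)}

/-- The value of a superfunction at a point, an element of the Grassmann algebra. -/
def eval {a : ι → ℂ} (ha : a ∈ V) : DomainSec ι κ V →ₐ[ℂ] Grassmann κ :=
  Algebra.TensorProduct.lift ((Algebra.ofId ℂ (Grassmann κ)).comp (Holo.eval ⟨a, ha⟩))
    (AlgHom.id ℂ _) (by
      intro f x
      rw [AlgHom.comp_apply, Algebra.ofId_apply]
      exact Algebra.commute_algebraMap_left _ _)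

theorem eval_tmul {a : ι → ℂ} (ha : a ∈ V) (f : Holo ι V) (x : Grassmann κ) :
    eval ha (f ⊗ₜ[ℂ] x) = f.1 ⟨a, ha⟩ • x := by
  rw [eval, Algebra.TensorProduct.lift_tmul, Algebra.smul_def]
  rfl

theorem res_tmul (h : W ≤ V) (f : Holo ι V) (x : Grassmann κ) :
    res h (f ⊗ₜ[ℂ] x) = (Holo.res h f) ⊗ₜ[ℂ] x := rfl

theorem eval_res (h : W ≤ V) {a : ι → ℂ} (ha : a ∈ W) (F : DomainSec ι κ V) :
    eval ha (res h F) = eval (h ha) F := by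
  induction F using TensorProduct.induction_on with
  | zero => simp
  | tmul f x => rw [res_tmul, eval_tmul, eval_tmul]; rfl
  | add F G hF hG => rw [map_add, map_add, map_add, hF, hG]

/-- Apply a linear map to the values of a superfunction. -/
def mapValues (V : Opens (ι → ℂ)) (L : Grassmann κ →ₗ[ℂ] Grassmann κ) :
    DomainSec ι κ V →ₗ[ℂ] DomainSec ι κ V :=
  TensorProduct.map LinearMap.id L

theorem eval_mapValues (L : Grassmann κ →ₗ[ℂ] Grassmann κ) {a : ι → ℂ} (ha : a ∈ V)
    (F : DomainSec ι κ V) : eval ha (mapValues V L F) = L (eval ha F) := by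
  induction F using TensorProduct.induction_on with
  | zero => simp
  | tmul f x => rw [mapValues, TensorProduct.map_tmul, eval_tmul, eval_tmul, map_smul]; rfl
  | add F G hF hG => rw [map_add, map_add, map_add, hF, hG, map_add]

/-- The holomorphic function obtained by applying a functional to the values of a
superfunction. -/
def coeff (l : Module.Dual ℂ (Grassmann κ)) : DomainSec ι κ V →ₗ[ℂ] Holo ι V :=
  (TensorProduct.rid ℂ (Holo ι V)).toLinearMap ∘ₗ TensorProduct.map LinearMap.id l

theorem coeff_tmul (l : Module.Dual ℂ (Grassmann κ)) (f : Holo ι V) (x : Grassmann κ) :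
    coeff l (f ⊗ₜ[ℂ] x) = l x • f := by
  simp [coeff]

theorem coeff_apply (l : Module.Dual ℂ (Grassmann κ)) (F : DomainSec ι κ V) {a : ι → ℂ}
    (ha : a ∈ V) : (coeff l F).1 ⟨a, ha⟩ = l (eval ha F) := by
  rw [← Holo.eval_apply]
  induction F using TensorProduct.induction_on with
  | zero => simp
  | tmul f x =>
    rw [coeff_tmul, eval_tmul, map_smul, map_smul, smul_eq_mul, smul_eq_mul, mul_comm]
    rfl
  | add F G hF hG => rw [map_add, map_add, map_add, hF, hG, map_add]

theorem eq_sum_coeff_tmul (F : DomainSec ι κ V) :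
    F = ∑ k, coeff ((Module.finBasis ℂ (Grassmann κ)).coord k) F ⊗ₜ[ℂ]
      Module.finBasis ℂ (Grassmann κ) k := by
  induction F using TensorProduct.induction_on with
  | zero => simp
  | tmul f x =>
    simp only [coeff_tmul, TensorProduct.smul_tmul, ← TensorProduct.tmul_sum]
    congr 1
    exact ((Module.finBasis ℂ (Grassmann κ)).sum_repr x).symm
  | add F G hF hG =>
    simp only [map_add, TensorProduct.add_tmul, Finset.sum_add_distrib]
    rw [← hF, ← hG]

theorem ext_eval {F G : DomainSec ι κ V} (h : ∀ a (ha : a ∈ V), eval ha F = eval ha G) :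
    F = G := by
  rw [eq_sum_coeff_tmul F, eq_sum_coeff_tmul G]
  refine Finset.sum_congr rfl fun k _ => ?_
  congr 1
  ext x
  rw [coeff_apply _ _ x.2, coeff_apply _ _ x.2, h]

/-- A function with values in the Grassmann algebra all of whose components are holomorphic is a
superfunction. -/
theorem exists_eval_eq (G : (ι → ℂ) → Grassmann κ)
    (hG : ∀ l : Module.Dual ℂ (Grassmann κ), DifferentiableOn ℂ (fun x => l (G x)) V) :
    ∃ F : DomainSec ι κ V, ∀ a (ha : a ∈ V), eval ha F = G a := by
  refine ⟨∑ k, Holo.mk' V _ (hG ((Module.finBasis ℂ (Grassmann κ)).coord k)) ⊗ₜ[ℂ]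
      Module.finBasis ℂ (Grassmann κ) k, fun a ha => ?_⟩
  rw [map_sum]
  simp only [eval_tmul]
  exact (Module.finBasis ℂ (Grassmann κ)).sum_repr (G a)

theorem eval_mem_evenOdd {p : ZMod 2} {F : DomainSec ι κ V} (hF : F ∈ parity V p) {a : ι → ℂ}
    (ha : a ∈ V) : eval ha F ∈ CliffordAlgebra.evenOdd (0 : QuadraticForm ℂ (κ → ℂ)) p := by
  obtain ⟨F, rfl⟩ := hF
  induction F using TensorProduct.induction_on with
  | zero => rw [map_zero, map_zero]; exact zero_mem _
  | tmul f x =>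
    rw [TensorProduct.map_tmul]
    exact (eval_tmul ha f x.1).symm ▸ Submodule.smul_mem _ _ x.2
  | add F G hF hG => rw [map_add, map_add]; exact add_mem hF hG

theorem exists_add_mem_parity (F : DomainSec ι κ V) :
    ∃ F₀ ∈ parity V 0, ∃ F₁ ∈ parity V 1, F = F₀ + F₁ := by
  induction F using TensorProduct.induction_on with
  | zero => exact ⟨0, zero_mem _, 0, zero_mem _, by simp⟩
  | tmul f x =>
    have hx : x ∈ CliffordAlgebra.evenOdd (0 : QuadraticForm ℂ (κ → ℂ)) 0 ⊔
        CliffordAlgebra.evenOdd (0 : QuadraticForm ℂ (κ → ℂ)) 1 := by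
      rw [(CliffordAlgebra.evenOdd_isCompl (Q := (0 : QuadraticForm ℂ (κ → ℂ)))).sup_eq_top]
      exact Submodule.mem_top
    obtain ⟨b, hb, c, hc, rfl⟩ := Submodule.mem_sup.1 hx
    exact ⟨f ⊗ₜ[ℂ] b, ⟨f ⊗ₜ[ℂ] ⟨b, hb⟩, rfl⟩, f ⊗ₜ[ℂ] c, ⟨f ⊗ₜ[ℂ] ⟨c, hc⟩, rfl⟩,
      TensorProduct.tmul_add _ _ _⟩
  | add F G hF hG =>
    obtain ⟨F₀, h₀, F₁, h₁, rfl⟩ := hF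
    obtain ⟨G₀, k₀, G₁, k₁, rfl⟩ := hG
    exact ⟨_, add_mem h₀ k₀, _, add_mem h₁ k₁, add_add_add_comm _ _ _ _⟩

/-- A superfunction with values in a subspace `S` is a combination of products of holomorphic
functions with elements of `S`. -/
theorem mem_span_of_eval_mem {S : Submodule ℂ (Grassmann κ)} {F : DomainSec ι κ V}
    (hF : ∀ a (ha : a ∈ V), eval ha F ∈ S) :
    F ∈ Submodule.span ℂ {G : DomainSec ι κ V | ∃ (f : Holo ι V), ∃ x ∈ S, G = f ⊗ₜ[ℂ] x} := by
  obtain ⟨g, hg⟩ := S.subtype.exists_leftInverse_of_injective S.ker_subtype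
  have h : F = mapValues V (S.subtype ∘ₗ g) F := by
    refine ext_eval fun a ha => ?_
    rw [eval_mapValues]
    exact congrArg S.subtype (LinearMap.congr_fun hg ⟨_, hF a ha⟩).symm
  rw [h]
  clear h hF
  induction F using TensorProduct.induction_on with
  | zero => rw [map_zero]; exact zero_mem _
  | tmul f x => exact Submodule.subset_span ⟨f, _, (g x).2, rfl⟩
  | add F G hF hG => rw [map_add]; exact add_mem hF hG

/-- The partial derivative with respect to an even coordinate. -/
def pderiv (i : ι) : DomainSec ι κ V →ₗ[ℂ] DomainSec ι κ V :=
  TensorProduct.map (Holo.pderiv i) LinearMap.id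

theorem pderiv_tmul (i : ι) (f : Holo ι V) (x : Grassmann κ) :
    pderiv i (f ⊗ₜ[ℂ] x) = Holo.pderiv i f ⊗ₜ[ℂ] x := rfl

theorem pderiv_mul (i : ι) (F G : DomainSec ι κ V) :
    pderiv i (F * G) = pderiv i F * G + F * pderiv i G := by
  induction F using TensorProduct.induction_on with
  | zero => simp
  | tmul f x =>
    induction G using TensorProduct.induction_on with
    | zero => simp
    | tmul g y =>
      simp only [Algebra.TensorProduct.tmul_mul_tmul, pderiv_tmul, Holo.pderiv_mul,
        TensorProduct.add_tmul]
    | add F G hF hG => rw [mul_add, map_add, hF, hG, map_add, mul_add, mul_add]; abel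
  | add F F' hF hG => rw [add_mul, map_add, hF, hG, map_add, add_mul, add_mul]; abel

theorem pderiv_res (h : W ≤ V) (i : ι) (F : DomainSec ι κ V) :
    pderiv i (res h F) = res h (pderiv i F) := by
  induction F using TensorProduct.induction_on with
  | zero => simp
  | tmul f x => rw [res_tmul, pderiv_tmul, pderiv_tmul, res_tmul, Holo.pderiv_res]
  | add F G hF hG => simp only [map_add, hF, hG]

open Classical in
theorem coeff_eval_pderiv (l : Module.Dual ℂ (Grassmann κ)) (i : ι) (F : DomainSec ι κ V)
    {a : ι → ℂ} (ha : a ∈ V) :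
    l (eval ha (pderiv i F)) = fderiv ℂ (Holo.ext0 (coeff l F)) a (Pi.single i 1) := by
  have : coeff l (pderiv i F) = Holo.pderiv i (coeff l F) := by
    induction F using TensorProduct.induction_on with
    | zero => simp
    | tmul f x => rw [pderiv_tmul, coeff_tmul, coeff_tmul, map_smul]
    | add F G hF hG => simp only [map_add, hF, hG]
  rw [← coeff_apply, this, Holo.pderiv_apply]

/-- Partial derivatives of a superfunction with values in a subspace have values in this
subspace. -/
theorem eval_pderiv_mem {S : Submodule ℂ (Grassmann κ)} {F : DomainSec ι κ V}
    (hF : ∀ a (ha : a ∈ V), eval ha F ∈ S) (i : ι) {a : ι → ℂ} (ha : a ∈ V) :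
    eval ha (pderiv i F) ∈ S := by
  classical
  by_contra hS
  obtain ⟨l, hl, hSl⟩ := Submodule.exists_le_ker_of_notMem hS
  apply hl
  have : coeff l F = 0 := by
    ext x
    rw [coeff_apply _ _ x.2]
    exact hSl (hF _ x.2)
  rw [coeff_eval_pderiv, this]
  have h0 : Holo.ext0 (0 : Holo ι V) = fun _ => 0 := by
    ext x
    by_cases hx : x ∈ V
    · rw [Holo.ext0_of_mem _ hx]; rfl
    · simp [Holo.ext0, hx]
  rw [h0]
  simp

theorem z_eq (i : ι) : z κ V i = Holo.coord V i ⊗ₜ[ℂ] 1 := rfl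

theorem res_z (h : W ≤ V) (i : ι) : res h (z κ V i) = z κ W i := rfl

theorem eval_z {a : ι → ℂ} (ha : a ∈ V) (i : ι) :
    eval ha (z κ V i) = algebraMap ℂ (Grassmann κ) (a i) := by
  rw [z_eq, eval_tmul, Algebra.algebraMap_eq_smul_one]
  rfl

open Classical in
theorem eval_ξ {a : ι → ℂ} (ha : a ∈ V) (k : κ) :
    eval ha (ξ ι V k) = ExteriorAlgebra.ι ℂ (Pi.single k 1) := by
  rw [ξ, eval_tmul]
  exact one_smul _ _

open Classical in
theorem pderiv_z (i j : ι) :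
    pderiv i (z κ V j) = algebraMap ℂ _ (if j = i then 1 else 0) := by
  rw [z_eq, pderiv_tmul, Holo.pderiv_coord]
  rfl

theorem pderiv_ξ (i : ι) (k : κ) : pderiv i (ξ ι V k) = 0 := by
  have : Holo.pderiv i (1 : Holo ι V) = 0 := by
    have h := Holo.pderiv_mul i (1 : Holo ι V) 1
    rw [mul_one, one_mul, mul_one] at h
    exact left_eq_add.1 h
  rw [ξ, pderiv_tmul, this, TensorProduct.zero_tmul]

theorem one_tmul_ι (v : κ → ℂ) :
    (1 : Holo ι V) ⊗ₜ[ℂ] ExteriorAlgebra.ι ℂ v = ∑ k, v k • ξ ι V k := by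
  classical
  have hv : v = ∑ k, v k • (Pi.single k 1 : κ → ℂ) := by
    ext j
    simp [Finset.sum_apply, Pi.single_apply]
  conv_lhs => rw [hv]
  rw [map_sum, TensorProduct.tmul_sum]
  refine Finset.sum_congr rfl fun k _ => ?_
  rw [map_smul, TensorProduct.tmul_smul, ξ]

/-! ### Homomorphisms and derivations on germs of superfunctions -/

section Germs

variable {V₀ : Opens (ι → ℂ)} {a : ι → ℂ} {A : Type*} [Ring A] [Algebra ℂ A]
  {α : ∀ V : Opens (ι → ℂ), a ∈ V → V ≤ V₀ → DomainSec ι κ V →ₐ[ℂ] A}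

/-- A homomorphism on germs at `a` maps the coordinates to complex numbers only if these are the
coordinates of `a`: otherwise a germ of the form `zᵢ - bᵢ` is invertible. -/
theorem germHom_z_eq [Nontrivial A]
    (hα : ∀ (V W : Opens (ι → ℂ)) (hV : a ∈ V) (hW : a ∈ W) (hV₀ : V ≤ V₀) (h : W ≤ V)
      (F : DomainSec ι κ V), α W hW (h.trans hV₀) (res h F) = α V hV hV₀ F)
    (ha : a ∈ V₀) {i : ι} {b : ℂ} (hb : α V₀ ha le_rfl (z κ V₀ i) = algebraMap ℂ A b) :
    b = a i := by
  by_contra hne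
  let W : Opens (ι → ℂ) :=
    ⟨{x | x ∈ V₀ ∧ x i ≠ b}, V₀.isOpen.inter (isOpen_ne.preimage (continuous_apply i))⟩
  have haW : a ∈ W := ⟨ha, fun h => hne h.symm⟩
  have hW : W ≤ V₀ := fun x hx => hx.1
  let g : Holo ι W := Holo.mk' W (fun x => (x i - b)⁻¹) (by
      intro x hx
      have hd : DifferentiableAt ℂ (fun x : ι → ℂ => x i - b) x := by fun_prop
      exact (hd.fun_inv (sub_ne_zero.2 hx.2)).differentiableWithinAt)
  have h1 : (z κ W i - algebraMap ℂ _ b) * (g ⊗ₜ[ℂ] 1) = 1 := by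
    refine ext_eval fun x hx => ?_
    rw [map_mul, map_sub, eval_z, AlgHom.commutes, eval_tmul, map_one, ← map_sub,
      ← Algebra.smul_def, smul_smul]
    have : (x i - b) * g.1 ⟨x, hx⟩ = 1 := mul_inv_cancel₀ (sub_ne_zero.2 hx.2)
    rw [this, one_smul]
  have h2 := congrArg (α W haW (hW.trans le_rfl)) h1
  have h3 : α W haW (hW.trans le_rfl) (z κ W i) = algebraMap ℂ A b := by
    rw [← hb, ← res_z hW, hα]
  rw [map_mul, map_sub, h3, AlgHom.commutes, sub_self, zero_mul, map_one] at h2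
  exact zero_ne_one h2

/-- On germs of holomorphic functions, a homomorphism that maps the coordinates to those of `a` is
evaluation at `a`, by Hadamard's lemma. -/
theorem germHom_holo
    (hα : ∀ (V W : Opens (ι → ℂ)) (hV : a ∈ V) (hW : a ∈ W) (hV₀ : V ≤ V₀) (h : W ≤ V)
      (F : DomainSec ι κ V), α W hW (h.trans hV₀) (res h F) = α V hV hV₀ F)
    (hz : ∀ V hV hV₀ i, α V hV hV₀ (z κ V i) = algebraMap ℂ A (a i))
    (V : Opens (ι → ℂ)) (hV : a ∈ V) (hV₀ : V ≤ V₀) (f : Holo ι V) :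
    α V hV hV₀ (f ⊗ₜ[ℂ] 1) = algebraMap ℂ A (f.1 ⟨a, hV⟩) := by
  obtain ⟨W, h, hW, g, hg⟩ := Holo.exists_res_eq_add_sum f hV
  have e : ∀ c : ℂ, (algebraMap ℂ (Holo ι W) c) ⊗ₜ[ℂ] (1 : Grassmann κ)
    = algebraMap ℂ (DomainSec ι κ W) c := fun c => rfl
  rw [← hα V W hV hW hV₀ h, res_tmul, hg, TensorProduct.add_tmul, TensorProduct.sum_tmul, map_add,
    map_sum, e, AlgHom.commutes, add_eq_left]
  refine Finset.sum_eq_zero fun i _ => ?_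
  rw [← mul_one (1 : Grassmann κ), ← Algebra.TensorProduct.tmul_mul_tmul, map_mul,
    TensorProduct.sub_tmul, map_sub, e, ← z_eq, hz, AlgHom.commutes, sub_self, zero_mul]

/-- A homomorphism on germs of superfunctions is determined by its values on the coordinates. -/
theorem germHom_eq
    (hα : ∀ (V W : Opens (ι → ℂ)) (hV : a ∈ V) (hW : a ∈ W) (hV₀ : V ≤ V₀) (h : W ≤ V)
      (F : DomainSec ι κ V), α W hW (h.trans hV₀) (res h F) = α V hV hV₀ F)
    (hz : ∀ V hV hV₀ i, α V hV hV₀ (z κ V i) = algebraMap ℂ A (a i))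
    {β : Grassmann κ →ₐ[ℂ] A}
    (hξ : ∀ V hV hV₀ k, α V hV hV₀ (ξ ι V k) = β (eval hV (ξ ι V k)))
    (V : Opens (ι → ℂ)) (hV : a ∈ V) (hV₀ : V ≤ V₀) (F : DomainSec ι κ V) :
    α V hV hV₀ F = β (eval hV F) := by
  have h1 : (α V hV hV₀).comp Algebra.TensorProduct.includeRight = β := by
    apply ExteriorAlgebra.hom_ext
    ext1 v
    have h2 := congrArg (β ∘ eval (κ := κ) hV) (one_tmul_ι (V := V) v)
    simp only [Function.comp_apply, eval_tmul, map_sum, map_smul, ← hξ V hV hV₀] at h2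
    have h3 := congrArg (α V hV hV₀) (one_tmul_ι (V := V) v)
    simp only [map_sum, map_smul] at h3
    have h4 : β (ExteriorAlgebra.ι ℂ v) = α V hV hV₀ (1 ⊗ₜ[ℂ] ExteriorAlgebra.ι ℂ v) := by
      rw [h3, ← h2]
      exact (one_smul ℂ _).symm
    exact h4.symm
  induction F using TensorProduct.induction_on with
  | zero => simp
  | tmul f x =>
    have h : f ⊗ₜ[ℂ] x = (f ⊗ₜ[ℂ] (1 : Grassmann κ)) * ((1 : Holo ι V) ⊗ₜ[ℂ] x) := by
      rw [Algebra.TensorProduct.tmul_mul_tmul, mul_one, one_mul]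
    rw [eval_tmul, map_smul, h, map_mul, germHom_holo hα hz, ← h1, Algebra.smul_def]
    rfl
  | add F G hF hG => rw [map_add, hF, hG, map_add, map_add]

/-- A superderivation on germs of superfunctions that vanishes on the coordinates is zero. The sign
`s` is that of its parity. -/
theorem germDer_eq_zero
    (hz : ∀ V hV hV₀ i, α V hV hV₀ (z κ V i) = algebraMap ℂ A (a i))
    {δ : ∀ V : Opens (ι → ℂ), a ∈ V → V ≤ V₀ → DomainSec ι κ V →ₗ[ℂ] A}
    (hδ : ∀ (V W : Opens (ι → ℂ)) (hV : a ∈ V) (hW : a ∈ W) (hV₀ : V ≤ V₀) (h : W ≤ V)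
      (F : DomainSec ι κ V), δ W hW (h.trans hV₀) (res h F) = δ V hV hV₀ F)
    {s : ℂ}
    (hδ0 : ∀ V hV hV₀ (F G : DomainSec ι κ V), F ∈ parity V 0 →
      δ V hV hV₀ (F * G) = δ V hV hV₀ F * α V hV hV₀ G + α V hV hV₀ F * δ V hV hV₀ G)
    (hδ1 : ∀ V hV hV₀ (F G : DomainSec ι κ V), F ∈ parity V 1 →
      δ V hV hV₀ (F * G) = δ V hV hV₀ F * α V hV hV₀ G + s • (α V hV hV₀ F * δ V hV hV₀ G))
    (hδz : ∀ V hV hV₀ i, δ V hV hV₀ (z κ V i) = 0)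
    (hδξ : ∀ V hV hV₀ k, δ V hV hV₀ (ξ ι V k) = 0)
    (V : Opens (ι → ℂ)) (hV : a ∈ V) (hV₀ : V ≤ V₀) (F : DomainSec ι κ V) :
    δ V hV hV₀ F = 0 := by
  have heven : ∀ (V : Opens (ι → ℂ)) (f : Holo ι V), f ⊗ₜ[ℂ] (1 : Grassmann κ) ∈ parity V 0 :=
    fun V f => ⟨f ⊗ₜ[ℂ] ⟨1, Submodule.one_le.1 (CliffordAlgebra.one_le_evenOdd_zero _)⟩, rfl⟩
  have hodd : ∀ (V : Opens (ι → ℂ)) (v : κ → ℂ),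
      (1 : Holo ι V) ⊗ₜ[ℂ] (ExteriorAlgebra.ι ℂ v) ∈ parity (κ := κ) V 1 :=
    fun V v => ⟨1 ⊗ₜ[ℂ] ⟨_, CliffordAlgebra.ι_mem_evenOdd_one _ v⟩, rfl⟩
  have hδ_one : ∀ V hV hV₀, δ V hV hV₀ 1 = 0 := fun V hV hV₀ => by
    have := hδ0 V hV hV₀ 1 1 (heven V 1)
    rw [mul_one, map_one (α V hV hV₀), mul_one, one_mul] at this
    exact left_eq_add.1 this
  have hδ_const : ∀ V hV hV₀ c, δ V hV hV₀ (algebraMap ℂ _ c) = 0 := fun V hV hV₀ c => by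
    rw [Algebra.algebraMap_eq_smul_one, map_smul, hδ_one, smul_zero]
  -- values on the Grassmann algebra
  have h1 : ∀ V hV hV₀ (x : Grassmann κ), δ V hV hV₀ ((1 : Holo ι V) ⊗ₜ[ℂ] x) = 0 := by
    intro V hV hV₀ x
    induction x using CliffordAlgebra.left_induction with
    | algebraMap r =>
      have : (1 : Holo ι V) ⊗ₜ[ℂ] (algebraMap ℂ (Grassmann κ) r) = algebraMap ℂ _ r :=
        (Algebra.TensorProduct.algebraMap_apply' r).symm
      exact this ▸ hδ_const V hV hV₀ r
    | add x y hx hy => rw [TensorProduct.tmul_add, map_add, hx, hy, add_zero]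
    | ι_mul x v hx =>
      have e : (1 : Holo ι V) ⊗ₜ[ℂ] (CliffordAlgebra.ι (0 : QuadraticForm ℂ (κ → ℂ)) v * x)
        = ((1 : Holo ι V) ⊗ₜ[ℂ] ExteriorAlgebra.ι ℂ v) * ((1 : Holo ι V) ⊗ₜ[ℂ] x) := by
        rw [Algebra.TensorProduct.tmul_mul_tmul, mul_one]
      rw [e, hδ1 _ _ _ _ _ (hodd V v), hx, mul_zero, smul_zero, add_zero, one_tmul_ι, map_sum]
      simp [hδξ]
  -- values on holomorphic functions
  have h2 : ∀ V hV hV₀ (f : Holo ι V), δ V hV hV₀ (f ⊗ₜ[ℂ] (1 : Grassmann κ)) = 0 := by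
    intro V hV hV₀ f
    obtain ⟨W, h, hW, g, hg⟩ := Holo.exists_res_eq_add_sum f hV
    have e : ∀ c : ℂ, (algebraMap ℂ (Holo ι W) c) ⊗ₜ[ℂ] (1 : Grassmann κ)
      = algebraMap ℂ (DomainSec ι κ W) c := fun c => rfl
    rw [← hδ V W hV hW hV₀ h, res_tmul, hg, TensorProduct.add_tmul, TensorProduct.sum_tmul,
      map_add, map_sum, e, hδ_const, zero_add]
    refine Finset.sum_eq_zero fun i _ => ?_
    rw [← mul_one (1 : Grassmann κ), ← Algebra.TensorProduct.tmul_mul_tmul,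
      hδ0 _ _ _ _ _ (heven W _), TensorProduct.sub_tmul, map_sub, map_sub, e, ← z_eq, hz, hδz,
      AlgHom.commutes, hδ_const, sub_self, sub_self, zero_mul, zero_mul, add_zero]
  induction F using TensorProduct.induction_on with
  | zero => simp
  | tmul f x =>
    have h : f ⊗ₜ[ℂ] x = (f ⊗ₜ[ℂ] (1 : Grassmann κ)) * ((1 : Holo ι V) ⊗ₜ[ℂ] x) := by
      rw [Algebra.TensorProduct.tmul_mul_tmul, mul_one, one_mul]
    rw [h, hδ0 _ _ _ _ _ (heven V f), h1, h2, zero_mul, mul_zero, add_zero]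
  | add F G hF hG => rw [map_add, hF, hG, add_zero]

end Germs

end DomainSec

/-! ### Sections of the structure sheaf -/

namespace SuperSpace

variable {M : SuperSpace.{u}}

theorem res_res {U V W : Opens M.carrier} (h : V ≤ U) (h' : W ≤ V) (f : M.Sec U) :
    M.res h' (M.res h f) = M.res (h'.trans h) f := by
  have := M.sheaf.presheaf.map_comp
    (CategoryTheory.homOfLE (show (V : Opens (TopCat.of M.carrier)) ≤ U from h)).op
    (CategoryTheory.homOfLE (show (W : Opens (TopCat.of M.carrier)) ≤ V from h')).op
  exact (DFunLike.congr_fun (congrArg AlgCat.Hom.hom this) f).symm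

theorem res_self {U : Opens M.carrier} (h : U ≤ U) (f : M.Sec U) : M.res h f = f :=
  DFunLike.congr_fun (congrArg AlgCat.Hom.hom (M.sheaf.presheaf.map_id (Opposite.op U))) f

theorem eq_of_locally_eq {U : Opens M.carrier} {f g : M.Sec U}
    (h : ∀ x ∈ U, ∃ (V : Opens M.carrier) (hV : V ≤ U), x ∈ V ∧ M.res hV f = M.res hV g) :
    f = g := by
  choose! V hV hx hfg using h
  refine M.sheaf.eq_of_locally_eq' (fun x : U => V x) U
    (fun x => CategoryTheory.homOfLE (hV x x.2)) (fun x hxU => ?_) f g (fun x => hfg x x.2)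
  exact Opens.mem_iSup.2 ⟨⟨x, hxU⟩, hx x hxU⟩

theorem exists_gluing {U : Opens M.carrier} {I : Type*} (O : I → Opens M.carrier)
    (hO : ∀ i, O i ≤ U) (hcover : ∀ x ∈ U, ∃ i, x ∈ O i) (s : ∀ i, M.Sec (O i))
    (hs : ∀ i j, M.res (inf_le_left : O i ⊓ O j ≤ O i) (s i)
      = M.res (inf_le_right : O i ⊓ O j ≤ O j) (s j)) :
    ∃ f : M.Sec U, ∀ i, M.res (hO i) f = s i := by
  obtain ⟨f, hf, -⟩ := M.sheaf.existsUnique_gluing' O U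
    (fun i => CategoryTheory.homOfLE (hO i)) (fun x hx => Opens.mem_iSup.2 (hcover x hx)) s
    (fun i j => hs i j)
  exact ⟨f, hf⟩

theorem eq_zero_of_mem_parity {U : Opens M.carrier} {f : M.Sec U} {p q : ZMod 2} (hpq : p ≠ q)
    (hp : f ∈ M.parity U p) (hq : f ∈ M.parity U q) : f = 0 :=
  (Submodule.disjoint_def.1 ((M.isInternal U).submodule_iSupIndep.pairwiseDisjoint hpq)) f hp hq

end SuperSpace

/-! ### Evaluation of superfunctions in a chart -/

namespace SuperChart

variable {M : SuperSpace.{u}} {ι κ : Type} [Fintype ι] [Fintype κ] (c : SuperChart M ι κ)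

/-- The part of the chart domain over an open set of coordinate values. -/
def pre (V : Opens (ι → ℂ)) : Opens M.carrier :=
  ⟨c.base.source ∩ c.base ⁻¹' V, c.base.isOpen_inter_preimage V.isOpen⟩

/-- The set of coordinate values of the points of an open set. -/
def push (W : Opens M.carrier) : Opens (ι → ℂ) :=
  ⟨c.base.target ∩ c.base.symm ⁻¹' W, c.base.isOpen_inter_preimage_symm W.isOpen⟩

theorem mem_dom {x : M.carrier} : x ∈ c.dom ↔ x ∈ c.base.source :=
  Set.ext_iff.1 c.coe_dom x

theorem push_le_image (W : Opens M.carrier) : c.push W ≤ c.image := fun _ h => h.1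

theorem base_mem_push {W : Opens M.carrier} {x : M.carrier} (hx : x ∈ W) (hc : x ∈ c.dom) :
    c.base x ∈ c.push W := by
  have hs := c.mem_dom.1 hc
  exact ⟨c.base.map_source hs, by rw [Set.mem_preimage, c.base.left_inv hs]; exact hx⟩

theorem pre_push_le (W : Opens M.carrier) : c.pre (c.push W) ≤ W := by
  rintro x ⟨hs, -, hx⟩
  rw [Set.mem_preimage, c.base.left_inv hs] at hx
  exact hx

theorem le_pre_push {W : Opens M.carrier} (hW : W ≤ c.dom) : W ≤ c.pre (c.push W) :=
  fun _ hx => ⟨c.mem_dom.1 (hW hx), c.base_mem_push hx (hW hx)⟩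

theorem pre_mono {V V' : Opens (ι → ℂ)} (h : V ≤ V') : c.pre V ≤ c.pre V' :=
  fun _ hx => ⟨hx.1, h hx.2⟩

theorem push_mono {W W' : Opens M.carrier} (h : W ≤ W') : c.push W ≤ c.push W' :=
  fun _ hx => ⟨hx.1, h hx.2⟩

theorem pre_le_dom (V : Opens (ι → ℂ)) : c.pre V ≤ c.dom :=
  fun _ hx => c.mem_dom.2 hx.1

theorem push_pre_le (V : Opens (ι → ℂ)) : c.push (c.pre V) ≤ V := by
  rintro a ⟨ha, -, h⟩
  rw [Set.mem_preimage, c.base.right_inv ha] at h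
  exact h

theorem symm_mem_dom {a : ι → ℂ} (ha : a ∈ c.image) : c.base.symm a ∈ c.dom :=
  c.mem_dom.2 (c.base.map_target ha)

theorem base_symm {a : ι → ℂ} (ha : a ∈ c.image) : c.base (c.base.symm a) = a :=
  c.base.right_inv ha

theorem base_mem_image {x : M.carrier} (hx : x ∈ c.dom) : c.base x ∈ c.image :=
  c.base.map_source (c.mem_dom.1 hx)

/-- The isomorphism given by a chart, with a superdomain as source. -/
def pullSec {V : Opens (ι → ℂ)} (hV : V ≤ c.image) : DomainSec ι κ V ≃ₐ[ℂ] M.Sec (c.pre V) :=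
  c.pull V hV

theorem pullSec_mem_parity {V : Opens (ι → ℂ)} (hV : V ≤ c.image) {p : ZMod 2}
    {F : DomainSec ι κ V} (hF : F ∈ DomainSec.parity V p) :
    c.pullSec hV F ∈ M.parity (c.pre V) p :=
  c.pull_parity V hV p F hF

theorem res_pullSec {V V' : Opens (ι → ℂ)} (h : V' ≤ V) (hV : V ≤ c.image)
    (F : DomainSec ι κ V) :
    M.res (c.pre_mono h) (c.pullSec hV F) = c.pullSec (h.trans hV) (DomainSec.res h F) :=
  c.pull_res h hV F

/-- The expression of a superfunction in the coordinates of a chart. -/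
def toDomain (W : Opens M.carrier) : M.Sec W →ₐ[ℂ] DomainSec ι κ (c.push W) :=
  (c.pullSec (c.push_le_image W)).symm.toAlgHom.comp (M.res (c.pre_push_le W))

/-- The superfunction with a given expression in the coordinates of a chart. -/
def ofDomain {W : Opens M.carrier} (hW : W ≤ c.dom) :
    DomainSec ι κ (c.push W) →ₐ[ℂ] M.Sec W :=
  (M.res (c.le_pre_push hW)).comp (c.pullSec (c.push_le_image W)).toAlgHom

theorem pull_toDomain {W : Opens M.carrier} (f : M.Sec W) :
    c.pullSec (c.push_le_image W) (c.toDomain W f) = M.res (c.pre_push_le W) f :=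
  (c.pullSec _).apply_symm_apply _

theorem toDomain_ofDomain {W : Opens M.carrier} (hW : W ≤ c.dom) (F : DomainSec ι κ (c.push W)) :
    c.toDomain W (c.ofDomain hW F) = F := by
  apply (c.pullSec (c.push_le_image W)).injective
  rw [pull_toDomain]
  exact (SuperSpace.res_res _ _ _).trans (SuperSpace.res_self _ _)

theorem toDomain_res {W W' : Opens M.carrier} (h : W' ≤ W) (f : M.Sec W) :
    c.toDomain W' (M.res h f) = DomainSec.res (c.push_mono h) (c.toDomain W f) := by
  apply (c.pullSec (c.push_le_image W')).injective
  rw [pull_toDomain, ← c.res_pullSec (c.push_mono h) (c.push_le_image W), pull_toDomain]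
  exact (SuperSpace.res_res _ _ _).trans (SuperSpace.res_res _ _ _).symm

theorem toDomain_pull {V : Opens (ι → ℂ)} (hV : V ≤ c.image)
    (F : DomainSec ι κ V) :
    c.toDomain (c.pre V) (c.pullSec hV F) = DomainSec.res (c.push_pre_le V) F := by
  apply (c.pullSec (c.push_le_image (c.pre V))).injective
  rw [pull_toDomain]
  exact c.res_pullSec (c.push_pre_le V) hV F

theorem toDomain_injective {W : Opens M.carrier} (hW : W ≤ c.dom) :
    Function.Injective (c.toDomain W) := by
  intro f g h
  have h' := congrArg (c.ofDomain hW) h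
  have key : ∀ f : M.Sec W, c.ofDomain hW (c.toDomain W f) = f := fun f => by
    have : c.ofDomain hW (c.toDomain W f) = M.res (c.le_pre_push hW)
      (c.pullSec (c.push_le_image W) (c.toDomain W f)) := rfl
    rw [this, pull_toDomain]
    exact (SuperSpace.res_res _ _ _).trans (SuperSpace.res_self _ _)
  rwa [key, key] at h'

/-- The value of a superfunction at a point of a chart domain, an element of the Grassmann algebra
on the odd coordinates. -/
def ev {W : Opens M.carrier} {x : M.carrier} (hx : x ∈ W) (hc : x ∈ c.dom) :
    M.Sec W →ₐ[ℂ] Grassmann κ :=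
  (DomainSec.eval (c.base_mem_push hx hc)).comp (c.toDomain W)

/-- The value at a point of the partial derivative of a superfunction with respect to an even
coordinate. -/
def evPderiv (i : ι) {W : Opens M.carrier} {x : M.carrier} (hx : x ∈ W) (hc : x ∈ c.dom) :
    M.Sec W →ₗ[ℂ] Grassmann κ :=
  (DomainSec.eval (c.base_mem_push hx hc)).toLinearMap ∘ₗ DomainSec.pderiv i ∘ₗ
    (c.toDomain W).toLinearMap

theorem ev_apply {W : Opens M.carrier} {x : M.carrier} (hx : x ∈ W) (hc : x ∈ c.dom)
    (f : M.Sec W) : c.ev hx hc f = DomainSec.eval (c.base_mem_push hx hc) (c.toDomain W f) := rfl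

theorem evPderiv_apply (i : ι) {W : Opens M.carrier} {x : M.carrier} (hx : x ∈ W) (hc : x ∈ c.dom)
    (f : M.Sec W) : c.evPderiv i hx hc f =
      DomainSec.eval (c.base_mem_push hx hc) (DomainSec.pderiv i (c.toDomain W f)) := rfl

theorem ev_res {W W' : Opens M.carrier} (h : W' ≤ W) {x : M.carrier} (hx : x ∈ W')
    (hc : x ∈ c.dom) (f : M.Sec W) : c.ev hx hc (M.res h f) = c.ev (h hx) hc f := by
  rw [ev_apply, toDomain_res, DomainSec.eval_res, ev_apply]

theorem evPderiv_res (i : ι) {W W' : Opens M.carrier} (h : W' ≤ W) {x : M.carrier} (hx : x ∈ W')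
    (hc : x ∈ c.dom) (f : M.Sec W) : c.evPderiv i hx hc (M.res h f) = c.evPderiv i (h hx) hc f := by
  rw [evPderiv_apply, toDomain_res, DomainSec.pderiv_res, DomainSec.eval_res, evPderiv_apply]

theorem ev_pull {V : Opens (ι → ℂ)} (hV : V ≤ c.image)
    (F : DomainSec ι κ V) {x : M.carrier} (hx : x ∈ c.pre V) (hc : x ∈ c.dom) :
    c.ev hx hc (c.pullSec hV F) = DomainSec.eval hx.2 F := by
  have h := c.toDomain_pull hV F
  exact (congrArg (DomainSec.eval (c.base_mem_push hx hc)) h).trans (DomainSec.eval_res _ _ _)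

theorem evPderiv_pull (i : ι) {V : Opens (ι → ℂ)} (hV : V ≤ c.image)
    (F : DomainSec ι κ V) {x : M.carrier} (hx : x ∈ c.pre V) (hc : x ∈ c.dom) :
    c.evPderiv i hx hc (c.pullSec hV F) = DomainSec.eval hx.2 (DomainSec.pderiv i F) := by
  have h := c.toDomain_pull hV F
  have h' := congrArg (fun G => DomainSec.eval (c.base_mem_push hx hc) (DomainSec.pderiv i G)) h
  refine h'.trans ?_
  simp only [DomainSec.pderiv_res, DomainSec.eval_res]

/-- Superfunctions on a part of a chart domain are determined by their values. -/
theorem eq_of_ev_eq {W : Opens M.carrier} (hW : W ≤ c.dom) {f g : M.Sec W}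
    (h : ∀ x (hx : x ∈ W), c.ev hx (hW hx) f = c.ev hx (hW hx) g) : f = g := by
  refine c.toDomain_injective hW (DomainSec.ext_eval fun a ha => ?_)
  have hx : c.base.symm a ∈ W := ha.2
  have := h _ hx
  rw [ev_apply, ev_apply] at this
  simpa only [c.base_symm ha.1] using this

theorem ev_ofDomain {W : Opens M.carrier} (hW : W ≤ c.dom) (F : DomainSec ι κ (c.push W))
    {x : M.carrier} (hx : x ∈ W) (hc : x ∈ c.dom) :
    c.ev hx hc (c.ofDomain hW F) = DomainSec.eval (c.base_mem_push hx hc) F := by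
  rw [ev_apply, toDomain_ofDomain]

theorem ev_z {x : M.carrier} (hx hc : x ∈ c.dom) (i : ι) :
    c.ev hx hc (c.z i) = algebraMap ℂ _ (c.base x i) :=
  (c.ev_pull le_rfl _ hx hc).trans (DomainSec.eval_z _ _)

open Classical in
theorem ev_ξ {x : M.carrier} (hx hc : x ∈ c.dom) (k : κ) :
    c.ev hx hc (c.ξ k) = ExteriorAlgebra.ι ℂ (Pi.single k 1) :=
  (c.ev_pull le_rfl _ hx hc).trans (DomainSec.eval_ξ _ _)

open Classical in
theorem evPderiv_z {x : M.carrier} (hx hc : x ∈ c.dom) (i j : ι) :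
    c.evPderiv i hx hc (c.z j) = algebraMap ℂ _ (if j = i then 1 else 0) := by
  refine (c.evPderiv_pull i le_rfl _ hx hc).trans ?_
  rw [DomainSec.pderiv_z, AlgHom.commutes]

theorem evPderiv_ξ {x : M.carrier} (hx hc : x ∈ c.dom) (i : ι) (k : κ) :
    c.evPderiv i hx hc (c.ξ k) = 0 := by
  refine (c.evPderiv_pull i le_rfl _ hx hc).trans ?_
  rw [DomainSec.pderiv_ξ, map_zero]

theorem evPderiv_mul (i : ι) {W : Opens M.carrier} {x : M.carrier} (hx : x ∈ W) (hc : x ∈ c.dom)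
    (f g : M.Sec W) : c.evPderiv i hx hc (f * g) =
      c.evPderiv i hx hc f * c.ev hx hc g + c.ev hx hc f * c.evPderiv i hx hc g := by
  simp only [evPderiv_apply, ev_apply, map_mul, DomainSec.pderiv_mul, map_add]

theorem eval_mem_of_ev_mem {S : Submodule ℂ (Grassmann κ)} {W : Opens M.carrier} {f : M.Sec W}
    (h : ∀ x (hx : x ∈ W) (hc : x ∈ c.dom), c.ev hx hc f ∈ S) {a : ι → ℂ} (ha : a ∈ c.push W) :
    DomainSec.eval ha (c.toDomain W f) ∈ S := by
  have hx : c.base.symm a ∈ W := ha.2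
  have := h _ hx (c.symm_mem_dom ha.1)
  rw [ev_apply] at this
  simpa only [c.base_symm ha.1] using this

theorem evPderiv_mem {S : Submodule ℂ (Grassmann κ)} {W : Opens M.carrier} {f : M.Sec W}
    (h : ∀ x (hx : x ∈ W) (hc : x ∈ c.dom), c.ev hx hc f ∈ S) (i : ι) {x : M.carrier}
    (hx : x ∈ W) (hc : x ∈ c.dom) : c.evPderiv i hx hc f ∈ S :=
  DomainSec.eval_pderiv_mem (fun _ ha => c.eval_mem_of_ev_mem h ha) i _

/-! ### Parity and nilpotency in terms of values -/

theorem toDomain_mem_parity {W : Opens M.carrier} {p : ZMod 2} {f : M.Sec W}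
    (hf : f ∈ M.parity W p) : c.toDomain W f ∈ DomainSec.parity (c.push W) p := by
  obtain ⟨F₀, h₀, F₁, h₁, h⟩ := DomainSec.exists_add_mem_parity (c.toDomain W f)
  have hpull := c.pull_toDomain f
  rw [h, map_add] at hpull
  have k₀ := c.pullSec_mem_parity (c.push_le_image W) h₀
  have k₁ := c.pullSec_mem_parity (c.push_le_image W) h₁
  have kf := M.map_parity (c.pre_push_le W) p f hf
  have kf' : M.res (c.pre_push_le W) f ∈ M.parity _ p := kf
  rw [← hpull] at kf'
  obtain rfl | rfl := ExteriorAlgebra.zmod_two_cases p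
  · have h0 := SuperSpace.eq_zero_of_mem_parity zero_ne_one
      ((Submodule.add_mem_iff_right _ k₀).1 kf') k₁
    have : F₁ = 0 := (c.pullSec (c.push_le_image W)).injective
      (h0.trans (map_zero _).symm)
    rw [h, this, add_zero]
    exact h₀
  · have h0 := SuperSpace.eq_zero_of_mem_parity zero_ne_one k₀
      ((Submodule.add_mem_iff_left _ k₁).1 kf')
    have : F₀ = 0 := (c.pullSec (c.push_le_image W)).injective
      (h0.trans (map_zero _).symm)
    rw [h, this, zero_add]
    exact h₁

theorem ev_mem_evenOdd {W : Opens M.carrier} {p : ZMod 2} {f : M.Sec W}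
    (hf : f ∈ M.parity W p) {x : M.carrier} (hx : x ∈ W) (hc : x ∈ c.dom) :
    c.ev hx hc f ∈ CliffordAlgebra.evenOdd (0 : QuadraticForm ℂ (κ → ℂ)) p :=
  DomainSec.eval_mem_evenOdd (c.toDomain_mem_parity hf) _

end SuperChart

namespace SuperSpace

variable {M : SuperSpace.{u}}

theorem exists_add_mem_parity {U : Opens M.carrier} (f : M.Sec U) :
    ∃ f₀ ∈ M.parity U 0, ∃ f₁ ∈ M.parity U 1, f = f₀ + f₁ := by
  have h : f ∈ ⨆ p, M.parity U p := by
    rw [(M.isInternal U).submodule_iSup_eq_top]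
    exact Submodule.mem_top
  have h2 : (⨆ p, M.parity U p) ≤ M.parity U 0 ⊔ M.parity U 1 := iSup_le fun p => by
    obtain rfl | rfl := ExteriorAlgebra.zmod_two_cases p
    · exact le_sup_left
    · exact le_sup_right
  obtain ⟨f₀, h₀, f₁, h₁, h⟩ := Submodule.mem_sup.1 (h2 h)
  exact ⟨f₀, h₀, f₁, h₁, h.symm⟩

/-- Parity can be checked locally. -/
theorem mem_parity_of_locally {U : Opens M.carrier} {f : M.Sec U} {p : ZMod 2}
    (h : ∀ x ∈ U, ∃ (V : Opens M.carrier) (hV : V ≤ U), x ∈ V ∧ M.res hV f ∈ M.parity V p) :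
    f ∈ M.parity U p := by
  obtain ⟨f₀, h₀, f₁, h₁, rfl⟩ := exists_add_mem_parity f
  obtain rfl | rfl := ExteriorAlgebra.zmod_two_cases p
  · have : f₁ = 0 := eq_of_locally_eq fun x hx => by
      obtain ⟨V, hV, hxV, hf⟩ := h x hx
      refine ⟨V, hV, hxV, ?_⟩
      have k₀ : M.res hV f₀ ∈ M.parity V 0 := M.map_parity hV 0 f₀ h₀
      have k₁ : M.res hV f₁ ∈ M.parity V 1 := M.map_parity hV 1 f₁ h₁
      rw [map_add, Submodule.add_mem_iff_right _ k₀] at hf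
      rw [eq_zero_of_mem_parity zero_ne_one hf k₁, map_zero]
    rw [this, add_zero]
    exact h₀
  · have : f₀ = 0 := eq_of_locally_eq fun x hx => by
      obtain ⟨V, hV, hxV, hf⟩ := h x hx
      refine ⟨V, hV, hxV, ?_⟩
      have k₀ : M.res hV f₀ ∈ M.parity V 0 := M.map_parity hV 0 f₀ h₀
      have k₁ : M.res hV f₁ ∈ M.parity V 1 := M.map_parity hV 1 f₁ h₁
      rw [map_add, Submodule.add_mem_iff_left _ k₁] at hf
      rw [eq_zero_of_mem_parity zero_ne_one k₀ hf, map_zero]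
    rw [this, zero_add]
    exact h₁

end SuperSpace

namespace SuperChart

variable {M : SuperSpace.{u}} {ι κ : Type} [Fintype ι] [Fintype κ] (c : SuperChart M ι κ)

open ExteriorAlgebra (degFiltration)

theorem mem_parity_of_ev_mem {W : Opens M.carrier} (hW : W ≤ c.dom) {p : ZMod 2} {f : M.Sec W}
    (h : ∀ x (hx : x ∈ W), c.ev hx (hW hx) f ∈
      CliffordAlgebra.evenOdd (0 : QuadraticForm ℂ (κ → ℂ)) p) : f ∈ M.parity W p := by
  have hdisj : ∀ x : Grassmann κ, x ∈ CliffordAlgebra.evenOdd (0 : QuadraticForm ℂ (κ → ℂ)) 0 →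
      x ∈ CliffordAlgebra.evenOdd (0 : QuadraticForm ℂ (κ → ℂ)) 1 → x = 0 :=
    Submodule.disjoint_def.1 (CliffordAlgebra.evenOdd_isCompl (Q := (0 : QuadraticForm ℂ _))).1
  obtain ⟨f₀, h₀, f₁, h₁, rfl⟩ := SuperSpace.exists_add_mem_parity f
  obtain rfl | rfl := ExteriorAlgebra.zmod_two_cases p
  · have : f₁ = 0 := c.eq_of_ev_eq hW fun x hx => by
      have hf := h x hx
      rw [map_add, Submodule.add_mem_iff_right _ (c.ev_mem_evenOdd h₀ hx (hW hx))] at hf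
      rw [hdisj _ hf (c.ev_mem_evenOdd h₁ hx (hW hx)), map_zero]
    rw [this, add_zero]
    exact h₀
  · have : f₀ = 0 := c.eq_of_ev_eq hW fun x hx => by
      have hf := h x hx
      rw [map_add, Submodule.add_mem_iff_left _ (c.ev_mem_evenOdd h₁ hx (hW hx))] at hf
      rw [hdisj _ (c.ev_mem_evenOdd h₀ hx (hW hx)) hf, map_zero]
    rw [this, zero_add]
    exact h₁

theorem ev_mem_degFiltration_of_mem_pow {W : Opens M.carrier} {x : M.carrier} (hx : x ∈ W)
    (hc : x ∈ c.dom) {j : ℕ} {f : M.Sec W}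
    (hf : f ∈ (Ideal.span {g : M.Sec W | IsNilpotent g}) ^ j) :
    c.ev hx hc f ∈ degFiltration ℂ (κ → ℂ) j := by
  have h1 : ∀ g ∈ Ideal.span {g : M.Sec W | IsNilpotent g},
      c.ev hx hc g ∈ degFiltration ℂ (κ → ℂ) 1 := by
    intro g hg
    rw [ExteriorAlgebra.mem_degFiltration_one]
    induction hg using Submodule.span_induction with
    | mem g hg =>
      exact (IsNilpotent.map (IsNilpotent.map hg (c.ev hx hc))
        (ExteriorAlgebra.algebraMapInv (R := ℂ) (M := κ → ℂ))).eq_zero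
    | zero => simp
    | add a b _ _ ha hb => rw [map_add, map_add, ha, hb, add_zero]
    | smul r a _ ha => rw [smul_eq_mul, map_mul, map_mul, ha, mul_zero]
  induction j generalizing f with
  | zero => exact ExteriorAlgebra.mem_degFiltration_zero _
  | succ j ih =>
    rw [Submodule.pow_succ] at hf
    induction hf using Submodule.mul_induction_on' with
    | mem_mul_mem a ha b hb =>
      rw [map_mul]
      exact ExteriorAlgebra.mul_mem_degFiltration (ih ha) (h1 b hb)
    | add a _ b _ ha hb => rw [map_add]; exact add_mem ha hb

theorem ev_mem_degFiltration {W : Opens M.carrier} {j : ℕ} {f : M.Sec W} (hf : f ∈ M.filt j W)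
    {x : M.carrier} (hx : x ∈ W) (hc : x ∈ c.dom) :
    c.ev hx hc f ∈ degFiltration ℂ (κ → ℂ) j := by
  obtain ⟨V, hV, hxV, h⟩ := hf x hx
  rw [← c.ev_res hV hxV]
  exact c.ev_mem_degFiltration_of_mem_pow hxV hc h

theorem pull_mem_pow {V : Opens (ι → ℂ)} (hV : V ≤ c.image) {j : ℕ}
    {F : DomainSec ι κ V} (hF : ∀ a (ha : a ∈ V), DomainSec.eval ha F ∈ degFiltration ℂ (κ → ℂ) j) :
    c.pullSec hV F ∈ (Ideal.span {g : M.Sec (c.pre V) | IsNilpotent g}) ^ j := by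
  have key : ∀ (j : ℕ) (x : Grassmann κ), x ∈ (⊤ : Submodule ℂ (Grassmann κ)) *
      LinearMap.range (ExteriorAlgebra.ι ℂ) ^ j → c.pullSec hV (1 ⊗ₜ[ℂ] x) ∈
        (Ideal.span {g : M.Sec (c.pre V) | IsNilpotent g}) ^ j := by
    intro j
    induction j with
    | zero =>
      intro x _
      rw [Submodule.pow_zero, Ideal.one_eq_top]
      exact Submodule.mem_top
    | succ j ih =>
      intro x hx
      rw [pow_succ, ← mul_assoc] at hx
      rw [Submodule.pow_succ]
      induction hx using Submodule.mul_induction_on' with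
      | mem_mul_mem a ha b hb =>
        obtain ⟨v, rfl⟩ := hb
        have e : (1 : Holo ι V) ⊗ₜ[ℂ] (a * ExteriorAlgebra.ι ℂ v) =
            ((1 : Holo ι V) ⊗ₜ[ℂ] a) * ((1 : Holo ι V) ⊗ₜ[ℂ] ExteriorAlgebra.ι ℂ v) := by
          rw [Algebra.TensorProduct.tmul_mul_tmul, mul_one]
        rw [e, map_mul]
        refine Submodule.mul_mem_mul (ih a ha) (Ideal.subset_span ⟨2, ?_⟩)
        rw [← map_pow, pow_two, Algebra.TensorProduct.tmul_mul_tmul, ExteriorAlgebra.ι_sq_zero,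
          TensorProduct.tmul_zero, map_zero]
      | add a _ b _ ha hb => rw [TensorProduct.tmul_add, map_add]; exact add_mem ha hb
  have hle : Submodule.span ℂ {G : DomainSec ι κ V | ∃ (f : Holo ι V),
      ∃ x ∈ degFiltration ℂ (κ → ℂ) j, G = f ⊗ₜ[ℂ] x} ≤
      (((Ideal.span {g : M.Sec (c.pre V) | IsNilpotent g}) ^ j).restrictScalars ℂ).comap
        (c.pullSec hV).toLinearMap := by
    refine Submodule.span_le.2 ?_
    rintro _ ⟨f, x, hx, rfl⟩
    have e : f ⊗ₜ[ℂ] x = (f ⊗ₜ[ℂ] (1 : Grassmann κ)) * ((1 : Holo ι V) ⊗ₜ[ℂ] x) := by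
      rw [Algebra.TensorProduct.tmul_mul_tmul, mul_one, one_mul]
    have h := Ideal.mul_mem_left _ (c.pullSec hV (f ⊗ₜ[ℂ] (1 : Grassmann κ)))
      (key j x (ExteriorAlgebra.degFiltration_le_top_mul_range_pow j hx))
    rw [← map_mul, ← e] at h
    exact h
  exact hle (DomainSec.mem_span_of_eval_mem hF)

end SuperChart

namespace SuperSpace

variable {M : SuperSpace.{u}}

open ExteriorAlgebra (degFiltration)

/-- A superfunction lies in the `j`-th power of the nilpotent ideal if its values, in suitable
charts, have degree at least `j`. -/
theorem mem_filt_of_ev_mem {j : ℕ} {U : Opens M.carrier} {f : M.Sec U}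
    (h : ∀ x ∈ U, ∃ (ι κ : Type) (_ : Fintype ι) (_ : Fintype κ) (c : SuperChart M ι κ),
      x ∈ c.dom ∧ ∀ y (hy : y ∈ U) (hc : y ∈ c.dom), c.ev hy hc f ∈ degFiltration ℂ (κ → ℂ) j) :
    f ∈ M.filt j U := by
  intro x hx
  obtain ⟨ι, κ, _, _, c, hc, hf⟩ := h x hx
  refine ⟨c.pre (c.push U), c.pre_push_le U, ⟨c.mem_dom.1 hc, c.base_mem_push hx hc⟩, ?_⟩
  rw [← c.pull_toDomain]
  exact c.pull_mem_pow _ fun a ha => c.eval_mem_of_ev_mem hf ha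

theorem mem_filt_zero {U : Opens M.carrier} (f : M.Sec U) : f ∈ M.filt 0 U := by
  intro x hx
  refine ⟨U, le_rfl, hx, ?_⟩
  rw [Submodule.pow_zero, Ideal.one_eq_top]
  exact Submodule.mem_top

theorem mem_filt_one_of_isNilpotent {U : Opens M.carrier} {f : M.Sec U} (hf : IsNilpotent f) :
    f ∈ M.filt 1 U := by
  intro x hx
  refine ⟨U, le_rfl, hx, ?_⟩
  rw [res_self, Submodule.pow_one]
  exact Ideal.subset_span hf

end SuperSpace

/-! ### Superderivations in coordinates -/

namespace SuperChart

open SuperSpace ExteriorAlgebra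

variable {M : SuperSpace.{u}} {ι κ : Type} [Fintype ι] [Fintype κ] (c : SuperChart M ι κ)

/-- The value at a point of `∑ Aᵢ ∂f/∂zᵢ + ∑ Bₖ ∂f/∂ξₖ`, for given values `A`, `B` of the
coefficients. -/
def derivVal (A : ι → Grassmann κ) (B : κ → Grassmann κ) {W : Opens M.carrier} {x : M.carrier}
    (hx : x ∈ W) (hc : x ∈ c.dom) : M.Sec W →ₗ[ℂ] Grassmann κ :=
  (∑ i, LinearMap.mulLeft ℂ (A i) ∘ₗ c.evPderiv i hx hc) +
    ∑ k, LinearMap.mulLeft ℂ (B k) ∘ₗ CliffordAlgebra.contractLeft (LinearMap.proj k) ∘ₗ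
      (c.ev hx hc).toLinearMap

theorem derivVal_apply (A : ι → Grassmann κ) (B : κ → Grassmann κ) {W : Opens M.carrier}
    {x : M.carrier} (hx : x ∈ W) (hc : x ∈ c.dom) (f : M.Sec W) :
    c.derivVal A B hx hc f = (∑ i, A i * c.evPderiv i hx hc f) +
      ∑ k, B k * CliffordAlgebra.contractLeft (LinearMap.proj k) (c.ev hx hc f) := by
  simp [derivVal, LinearMap.sum_apply]

theorem derivVal_res (A : ι → Grassmann κ) (B : κ → Grassmann κ) {W W' : Opens M.carrier}
    (h : W' ≤ W) {x : M.carrier} (hx : x ∈ W') (hc : x ∈ c.dom) (f : M.Sec W) :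
    c.derivVal A B hx hc (M.res h f) = c.derivVal A B (h hx) hc f := by
  simp only [derivVal_apply, ev_res, evPderiv_res]

theorem derivVal_add (A A' : ι → Grassmann κ) (B B' : κ → Grassmann κ) {W : Opens M.carrier}
    {x : M.carrier} (hx : x ∈ W) (hc : x ∈ c.dom) (f : M.Sec W) :
    c.derivVal (fun i => A i + A' i) (fun k => B k + B' k) hx hc f =
      c.derivVal A B hx hc f + c.derivVal A' B' hx hc f := by
  simp only [derivVal_apply, add_mul, Finset.sum_add_distrib]
  abel

theorem derivVal_z (A : ι → Grassmann κ) (B : κ → Grassmann κ) {x : M.carrier}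
    (hx hc : x ∈ c.dom) (j : ι) : c.derivVal A B hx hc (c.z j) = A j := by
  classical
  have h : ∀ r : ℂ, A j * algebraMap ℂ (Grassmann κ) r = r • A j := fun r => by
    rw [← Algebra.commutes, Algebra.smul_def]
  rw [derivVal_apply, ev_z]
  simp only [evPderiv_z, CliffordAlgebra.contractLeft_algebraMap, mul_zero,
    Finset.sum_const_zero, add_zero]
  rw [Finset.sum_eq_single j]
  · simp
  · intro i _ hi
    simp [Ne.symm hi]
  · simp

theorem derivVal_ξ (A : ι → Grassmann κ) (B : κ → Grassmann κ) {x : M.carrier}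
    (hx hc : x ∈ c.dom) (j : κ) : c.derivVal A B hx hc (c.ξ j) = B j := by
  classical
  rw [derivVal_apply, ev_ξ]
  have h : ∀ k : κ, CliffordAlgebra.contractLeft (LinearMap.proj k : Module.Dual ℂ (κ → ℂ))
      (ExteriorAlgebra.ι ℂ (Pi.single j (1 : ℂ))) =
        algebraMap ℂ (Grassmann κ) (if k = j then 1 else 0) := fun k => by
    refine (CliffordAlgebra.contractLeft_ι _ _ _).trans ?_
    simp [Pi.single_apply]
  simp only [evPderiv_ξ, mul_zero, Finset.sum_const_zero, zero_add, h]
  rw [Finset.sum_eq_single j]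
  · simp
  · intro i _ hi
    simp [hi]
  · simp

theorem involute_ev {W : Opens M.carrier} {q : ZMod 2} {f : M.Sec W} (hf : f ∈ M.parity W q)
    {x : M.carrier} (hx : x ∈ W) (hc : x ∈ c.dom) :
    CliffordAlgebra.involute (c.ev hx hc f) = (-1 : ℂ) ^ q.val • c.ev hx hc f :=
  involute_of_mem_evenOdd (c.ev_mem_evenOdd hf hx hc)

/-- The graded Leibniz rule for first order operators with homogeneous coefficients. -/
theorem derivVal_mul {p q : ZMod 2} {A : ι → Grassmann κ} {B : κ → Grassmann κ}
    (hA : ∀ i, A i ∈ CliffordAlgebra.evenOdd (0 : QuadraticForm ℂ (κ → ℂ)) p)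
    (hB : ∀ k, B k ∈ CliffordAlgebra.evenOdd (0 : QuadraticForm ℂ (κ → ℂ)) (p + 1))
    {W : Opens M.carrier} {x : M.carrier} (hx : x ∈ W) (hc : x ∈ c.dom) {f : M.Sec W}
    (hf : f ∈ M.parity W q) (g : M.Sec W) :
    c.derivVal A B hx hc (f * g) = c.derivVal A B hx hc f * c.ev hx hc g +
      (-1 : ℂ) ^ (p.val * q.val) • (c.ev hx hc f * c.derivVal A B hx hc g) := by
  have hfx := c.ev_mem_evenOdd hf hx hc
  have h1 : ∀ i y, A i * (c.ev hx hc f * y) =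
      (-1 : ℂ) ^ (p.val * q.val) • (c.ev hx hc f * (A i * y)) := fun i y => by
    rw [← mul_assoc, mul_comm_of_mem_evenOdd (hA i) hfx, smul_mul_assoc, mul_assoc]
  have h2 : ∀ k y, B k * (CliffordAlgebra.involute (c.ev hx hc f) * y) =
      (-1 : ℂ) ^ (p.val * q.val) • (c.ev hx hc f * (B k * y)) := fun k y => by
    rw [c.involute_ev hf, smul_mul_assoc, mul_smul_comm, ← mul_assoc,
      mul_comm_of_mem_evenOdd (hB k) hfx, smul_mul_assoc, mul_assoc, smul_smul]
    congr 1
    obtain rfl | rfl := zmod_two_cases p <;> obtain rfl | rfl := zmod_two_cases q <;>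
      simp [ZMod.val_one, show (1 + 1 : ZMod 2) = 0 from rfl]
  simp only [derivVal_apply, evPderiv_mul, map_mul, contractLeft_mul, mul_add, add_mul,
    Finset.sum_add_distrib, Finset.sum_mul, Finset.mul_sum, smul_add, Finset.smul_sum, h1, h2,
    mul_assoc]
  abel

theorem derivVal_mem_evenOdd {p q : ZMod 2} {A : ι → Grassmann κ} {B : κ → Grassmann κ}
    (hA : ∀ i, A i ∈ CliffordAlgebra.evenOdd (0 : QuadraticForm ℂ (κ → ℂ)) p)
    (hB : ∀ k, B k ∈ CliffordAlgebra.evenOdd (0 : QuadraticForm ℂ (κ → ℂ)) (p + 1))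
    {W : Opens M.carrier} {x : M.carrier} (hx : x ∈ W) (hc : x ∈ c.dom) {f : M.Sec W}
    (hf : f ∈ M.parity W q) : c.derivVal A B hx hc f ∈
      CliffordAlgebra.evenOdd (0 : QuadraticForm ℂ (κ → ℂ)) (p + q) := by
  rw [derivVal_apply]
  refine add_mem (Submodule.sum_mem _ fun i _ => ?_) (Submodule.sum_mem _ fun k _ => ?_)
  · exact SetLike.mul_mem_graded (hA i)
      (c.evPderiv_mem (fun y hy hcy => c.ev_mem_evenOdd hf hy hcy) i hx hc)
  · have h := SetLike.mul_mem_graded (hB k)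
      (contractLeft_mem_evenOdd (LinearMap.proj k) (c.ev_mem_evenOdd hf hx hc))
    have e : p + 1 + (q + 1) = p + q := by
      rw [add_add_add_comm, show (1 + 1 : ZMod 2) = 0 from rfl, add_zero]
    rwa [e] at h

theorem derivVal_mem_degFiltration {t j : ℕ} {A : ι → Grassmann κ} {B : κ → Grassmann κ}
    (hA : ∀ i, A i ∈ degFiltration ℂ (κ → ℂ) t) (hB : ∀ k, B k ∈ degFiltration ℂ (κ → ℂ) (t + 1))
    {W : Opens M.carrier} {x : M.carrier} (hx : x ∈ W) (hc : x ∈ c.dom) {f : M.Sec W}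
    (hf : f ∈ M.filt j W) : c.derivVal A B hx hc f ∈ degFiltration ℂ (κ → ℂ) (j + t) := by
  have hev := fun y (hy : y ∈ W) (hcy : y ∈ c.dom) => c.ev_mem_degFiltration hf hy hcy
  rw [derivVal_apply]
  refine add_mem (Submodule.sum_mem _ fun i _ => ?_) (Submodule.sum_mem _ fun k _ => ?_)
  · rw [add_comm]
    exact mul_mem_degFiltration (hA i) (c.evPderiv_mem hev i hx hc)
  · rcases j with _ | j
    · exact degFiltration_antitone (by omega)
        (mul_mem_degFiltration (hB k) (mem_degFiltration_zero _))
    · rw [show j + 1 + t = t + 1 + j by omega]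
      exact mul_mem_degFiltration (hB k) ((mem_degFiltration_succ.1 (hev x hx hc)).2 _)

end SuperChart

namespace SuperSpace

open ExteriorAlgebra

variable {M : SuperSpace.{u}}

namespace Family

variable {ι κ : Type} [Fintype ι] [Fintype κ] {U : Opens M.carrier}

/-- The value of a family of operators on an even coordinate of a chart. -/
def onZ (Y : M.Family U) (c : SuperChart M ι κ) (i : ι) : M.Sec (U ⊓ c.dom) :=
  Y ⟨U ⊓ c.dom, inf_le_left⟩ (M.res inf_le_right (c.z i))

/-- The value of a family of operators on an odd coordinate of a chart. -/
def onξ (Y : M.Family U) (c : SuperChart M ι κ) (k : κ) : M.Sec (U ⊓ c.dom) :=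
  Y ⟨U ⊓ c.dom, inf_le_left⟩ (M.res inf_le_right (c.ξ k))

end Family

section Formula

variable {ι κ : Type} [Fintype ι] [Fintype κ] {U : Opens M.carrier} (c : SuperChart M ι κ)

theorem _root_.SuperChart.z_mem_parity (i : ι) : c.z i ∈ M.parity c.dom 0 :=
  c.pullSec_mem_parity (le_refl c.image)
    ⟨Holo.coord c.image i ⊗ₜ[ℂ] ⟨1, Submodule.one_le.1 (CliffordAlgebra.one_le_evenOdd_zero _)⟩,
      rfl⟩

theorem _root_.SuperChart.ξ_mem_parity (k : κ) : c.ξ k ∈ M.parity c.dom 1 := by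
  classical
  exact c.pullSec_mem_parity (le_refl c.image)
    ⟨1 ⊗ₜ[ℂ] ⟨_, CliffordAlgebra.ι_mem_evenOdd_one _ (Pi.single k 1)⟩, by
      rw [TensorProduct.map_tmul, DomainSec.ξ]; congr!⟩

theorem IsHomDer.onZ_mem_parity {p : ZMod 2} {Y : M.Family U} (hY : IsHomDer p Y) (i : ι) :
    Y.onZ c i ∈ M.parity (U ⊓ c.dom) p := by
  have := hY.map_parity ⟨U ⊓ c.dom, inf_le_left⟩ 0 _
    (M.map_parity (inf_le_right : U ⊓ c.dom ≤ c.dom) 0 _ (c.z_mem_parity i))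
  rwa [add_zero] at this

theorem IsHomDer.onξ_mem_parity {p : ZMod 2} {Y : M.Family U} (hY : IsHomDer p Y) (k : κ) :
    Y.onξ c k ∈ M.parity (U ⊓ c.dom) (p + 1) :=
  hY.map_parity ⟨U ⊓ c.dom, inf_le_left⟩ 1 _
    (M.map_parity (inf_le_right : U ⊓ c.dom ≤ c.dom) 1 _ (c.ξ_mem_parity k))

/-- A superderivation is determined by its values on the coordinates of a chart:
`Y f = ∑ Y(zᵢ) ∂f/∂zᵢ + ∑ Y(ξₖ) ∂f/∂ξₖ`. -/
theorem IsHomDer.ev_eq_derivVal {p : ZMod 2} {Y : M.Family U} (hY : IsHomDer p Y)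
    (V : {V : Opens M.carrier // V ≤ U}) {x : M.carrier} (hx : x ∈ V.1) (hc : x ∈ c.dom)
    (f : M.Sec V.1) : c.ev hx hc (Y V f) =
      c.derivVal (fun i => c.ev (W := U ⊓ c.dom) ⟨V.2 hx, hc⟩ hc (Y.onZ c i))
        (fun k => c.ev (W := U ⊓ c.dom) ⟨V.2 hx, hc⟩ hc (Y.onξ c k)) hx hc f := by
  have hxU : x ∈ U := V.2 hx
  set A := fun i => c.ev (W := U ⊓ c.dom) ⟨hxU, hc⟩ hc (Y.onZ c i) with hAdef
  set B := fun k => c.ev (W := U ⊓ c.dom) ⟨hxU, hc⟩ hc (Y.onξ c k) with hBdef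
  have hA : ∀ i, A i ∈ CliffordAlgebra.evenOdd (0 : QuadraticForm ℂ (κ → ℂ)) p :=
    fun i => c.ev_mem_evenOdd (hY.onZ_mem_parity c i) _ hc
  have hB : ∀ k, B k ∈ CliffordAlgebra.evenOdd (0 : QuadraticForm ℂ (κ → ℂ)) (p + 1) :=
    fun k => c.ev_mem_evenOdd (hY.onξ_mem_parity c k) _ hc
  have hpre : ∀ {V : Opens (ι → ℂ)}, V ≤ c.push U → c.pre V ≤ U :=
    fun h => (c.pre_mono h).trans (c.pre_push_le U)
  have him : ∀ {V : Opens (ι → ℂ)}, V ≤ c.push U → V ≤ c.image :=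
    fun h => h.trans (c.push_le_image U)
  have hmem : ∀ {V : Opens (ι → ℂ)}, c.base x ∈ V → x ∈ c.pre V :=
    fun h => ⟨c.mem_dom.1 hc, h⟩
  have hnat : ∀ (W W' : {V : Opens M.carrier // V ≤ U}) (h : W'.1 ≤ W.1) (hx : x ∈ W'.1)
      (f : M.Sec W.1), c.ev hx hc (Y W' (M.res h f)) = c.ev (h hx) hc (Y W f) :=
    fun W W' h hx f => by rw [← hY.natural W W' h f, c.ev_res]
  -- on germs at `x`: `α` is evaluation, and `δ` is the difference of the two sides
  let α : ∀ V : Opens (ι → ℂ), c.base x ∈ V → V ≤ c.push U → DomainSec ι κ V →ₐ[ℂ] Grassmann κ :=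
    fun V hV hV₀ => (c.ev (hmem hV) hc).comp (c.pullSec (him hV₀)).toAlgHom
  let δ : ∀ V : Opens (ι → ℂ), c.base x ∈ V → V ≤ c.push U → DomainSec ι κ V →ₗ[ℂ] Grassmann κ :=
    fun V hV hV₀ => ((c.ev (hmem hV) hc).toLinearMap ∘ₗ Y ⟨c.pre V, hpre hV₀⟩ -
      c.derivVal A B (hmem hV) hc) ∘ₗ (c.pullSec (him hV₀)).toLinearMap
  have hα : ∀ V hV hV₀ F, α V hV hV₀ F = c.ev (hmem hV) hc (c.pullSec (him hV₀) F) :=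
    fun _ _ _ _ => rfl
  have hδ : ∀ V hV hV₀ F, δ V hV hV₀ F =
      c.ev (hmem hV) hc (Y ⟨c.pre V, hpre hV₀⟩ (c.pullSec (him hV₀) F)) -
        c.derivVal A B (hmem hV) hc (c.pullSec (him hV₀) F) := fun _ _ _ _ => rfl
  have hmul : ∀ (q : ZMod 2) V hV hV₀ (F G : DomainSec ι κ V), F ∈ DomainSec.parity V q →
      δ V hV hV₀ (F * G) = δ V hV hV₀ F * α V hV hV₀ G +
        (-1 : ℂ) ^ (p.val * q.val) • (α V hV hV₀ F * δ V hV hV₀ G) := by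
    intro q V hV hV₀ F G hF
    have hF' := c.pullSec_mem_parity (him hV₀) hF
    rw [hδ V hV hV₀, map_mul, hY.leibniz ⟨c.pre V, hpre hV₀⟩ q _ hF', c.derivVal_mul hA hB _ _ hF',
      hδ V hV hV₀, hδ V hV hV₀, hα V hV hV₀, hα V hV hV₀, map_add, map_smul, map_mul,
      map_mul, sub_mul, mul_sub, smul_sub]
    abel
  have hz : ∀ (V : Opens (ι → ℂ)) (hV₀ : V ≤ c.push U) (i : ι),
      c.pullSec (him hV₀) (DomainSec.z κ V i) =
      M.res (c.pre_le_dom V) (c.z i) := by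
    intro V hV₀ i
    exact (c.res_pullSec (him hV₀) le_rfl (DomainSec.z κ c.image i)).symm
  have hξ : ∀ (V : Opens (ι → ℂ)) (hV₀ : V ≤ c.push U) (k : κ),
      c.pullSec (him hV₀) (DomainSec.ξ ι V k) =
      M.res (c.pre_le_dom V) (c.ξ k) := by
    intro V hV₀ k
    exact (c.res_pullSec (him hV₀) le_rfl (DomainSec.ξ ι c.image k)).symm
  have key := DomainSec.germDer_eq_zero (α := α) (δ := δ) (s := (-1 : ℂ) ^ p.val)
    (fun V hV hV₀ i => by
      rw [hα V hV hV₀, hz V hV₀, c.ev_res, c.ev_z])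
    (fun V W hV hW hV₀ h F => by
      rw [hδ V hV hV₀, hδ W hW (h.trans hV₀), ← c.res_pullSec h (him hV₀), c.derivVal_res]
      congr 1
      exact hnat ⟨_, hpre hV₀⟩ ⟨_, hpre (h.trans hV₀)⟩ (c.pre_mono h) _ _)
    (fun V hV hV₀ F G hF => by simpa using hmul 0 V hV hV₀ F G hF)
    (fun V hV hV₀ F G hF => by simpa [ZMod.val_one] using hmul 1 V hV hV₀ F G hF)
    (fun V hV hV₀ i => by
      rw [hδ V hV hV₀, hz V hV₀, c.derivVal_res, c.derivVal_z, hAdef, sub_eq_zero]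
      have h : c.pre V ≤ U ⊓ c.dom := le_inf (hpre hV₀) (c.pre_le_dom V)
      have := hnat ⟨U ⊓ c.dom, inf_le_left⟩ ⟨c.pre V, hpre hV₀⟩ h (hmem hV)
        (M.res inf_le_right (c.z i))
      rwa [res_res] at this)
    (fun V hV hV₀ k => by
      rw [hδ V hV hV₀, hξ V hV₀, c.derivVal_res, c.derivVal_ξ, hBdef, sub_eq_zero]
      have h : c.pre V ≤ U ⊓ c.dom := le_inf (hpre hV₀) (c.pre_le_dom V)
      have := hnat ⟨U ⊓ c.dom, inf_le_left⟩ ⟨c.pre V, hpre hV₀⟩ h (hmem hV)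
        (M.res inf_le_right (c.ξ k))
      rwa [res_res] at this)
    (c.push V.1) (c.base_mem_push hx hc) (c.push_mono V.2) (c.toDomain V.1 f)
  rw [hδ _ (c.base_mem_push hx hc) (c.push_mono V.2), c.pull_toDomain,
    c.derivVal_res, sub_eq_zero] at key
  rw [← key]
  exact (hnat V ⟨_, _⟩ (c.pre_push_le V.1) _ f).symm

theorem IsDer.ev_eq_derivVal {Y : M.Family U} (hY : IsDer Y)
    (V : {V : Opens M.carrier // V ≤ U}) {x : M.carrier} (hx : x ∈ V.1) (hc : x ∈ c.dom)
    (f : M.Sec V.1) : c.ev hx hc (Y V f) =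
      c.derivVal (fun i => c.ev (W := U ⊓ c.dom) ⟨V.2 hx, hc⟩ hc (Y.onZ c i))
        (fun k => c.ev (W := U ⊓ c.dom) ⟨V.2 hx, hc⟩ hc (Y.onξ c k)) hx hc f := by
  obtain ⟨Y₀, Y₁, h₀, h₁, rfl⟩ := hY
  have hz : ∀ i, (Y₀ + Y₁).onZ c i = Y₀.onZ c i + Y₁.onZ c i := fun _ => rfl
  have hξ : ∀ k, (Y₀ + Y₁).onξ c k = Y₀.onξ c k + Y₁.onξ c k := fun _ => rfl
  simp only [hz, hξ, map_add]
  rw [c.derivVal_add, ← h₀.ev_eq_derivVal, ← h₁.ev_eq_derivVal, ← map_add]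
  rfl

end Formula

/-- The degree of a superderivation can be read off from its values on coordinates. -/
theorem IsDer.raisesDegree {U : Opens M.carrier} {Y : M.Family U} (hY : IsDer Y) {t : ℕ}
    (h : ∀ x ∈ U, ∃ (ι κ : Type) (_ : Fintype ι) (_ : Fintype κ) (c : SuperChart M ι κ),
      x ∈ c.dom ∧ ∀ y (hy : y ∈ U) (hc : y ∈ c.dom),
        (∀ i, c.ev (W := U ⊓ c.dom) ⟨hy, hc⟩ hc (Y.onZ c i) ∈ degFiltration ℂ (κ → ℂ) t) ∧
        ∀ k, c.ev (W := U ⊓ c.dom) ⟨hy, hc⟩ hc (Y.onξ c k) ∈ degFiltration ℂ (κ → ℂ) (t + 1)) :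
    RaisesDegree t Y := by
  intro V j f hf
  refine mem_filt_of_ev_mem fun x hx => ?_
  obtain ⟨ι, κ, _, _, c, hc, hY'⟩ := h x (V.2 hx)
  refine ⟨ι, κ, _, _, c, hc, fun y hy hcy => ?_⟩
  rw [hY.ev_eq_derivVal c V hy hcy]
  exact c.derivVal_mem_degFiltration (hY' y (V.2 hy) hcy).1 (hY' y (V.2 hy) hcy).2 hy hcy hf

section

variable {ι κ : Type} [Fintype ι] [Fintype κ] {U : Opens M.carrier} (c : SuperChart M ι κ)

theorem RaisesDegree.ev_onZ_mem {Y : M.Family U} {t : ℕ} (hY : RaisesDegree t Y)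
    {x : M.carrier} (hx : x ∈ U) (hc : x ∈ c.dom) (i : ι) :
    c.ev (W := U ⊓ c.dom) ⟨hx, hc⟩ hc (Y.onZ c i) ∈ degFiltration ℂ (κ → ℂ) t := by
  have := c.ev_mem_degFiltration (hY ⟨U ⊓ c.dom, inf_le_left⟩ 0 _ (mem_filt_zero
    (M.res inf_le_right (c.z i)))) ⟨hx, hc⟩ hc
  rwa [zero_add] at this

theorem RaisesDegree.ev_onξ_mem {Y : M.Family U} {t : ℕ} (hY : RaisesDegree t Y)
    {x : M.carrier} (hx : x ∈ U) (hc : x ∈ c.dom) (k : κ) :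
    c.ev (W := U ⊓ c.dom) ⟨hx, hc⟩ hc (Y.onξ c k) ∈ degFiltration ℂ (κ → ℂ) (t + 1) := by
  have hsq : DomainSec.ξ ι c.image k ^ 2 = 0 := by
    rw [pow_two, DomainSec.ξ, Algebra.TensorProduct.tmul_mul_tmul, ExteriorAlgebra.ι_sq_zero,
      TensorProduct.tmul_zero]
  have hnil : IsNilpotent (c.ξ k) :=
    IsNilpotent.map (⟨2, hsq⟩ : IsNilpotent (DomainSec.ξ ι c.image k)) (c.pullSec (le_refl c.image))
  have := c.ev_mem_degFiltration (hY ⟨U ⊓ c.dom, inf_le_left⟩ 1 _ (mem_filt_one_of_isNilpotent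
    (hnil.map (M.res inf_le_right)))) ⟨hx, hc⟩ hc
  rwa [add_comm] at this

/-- First order operators with prescribed homogeneous coefficients are superderivations. -/
theorem _root_.SuperChart.exists_isHomDer {p : ZMod 2} (A : ι → M.Sec c.dom) (B : κ → M.Sec c.dom)
    (hA : ∀ i, A i ∈ M.parity c.dom p) (hB : ∀ k, B k ∈ M.parity c.dom (p + 1)) :
    ∃ T : M.Family c.dom, IsHomDer p T ∧
      ∀ (V : {V : Opens M.carrier // V ≤ c.dom}) (x : M.carrier) (hx : x ∈ V.1) (f : M.Sec V.1),
        c.ev hx (V.2 hx) (T V f) = c.derivVal (fun i => c.ev (V.2 hx) (V.2 hx) (A i))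
          (fun k => c.ev (V.2 hx) (V.2 hx) (B k)) hx (V.2 hx) f := by
  let D : ∀ V : {V : Opens M.carrier // V ≤ c.dom}, DomainSec ι κ (c.push V.1) →ₗ[ℂ]
      DomainSec ι κ (c.push V.1) := fun V =>
    (∑ i, LinearMap.mulLeft ℂ (c.toDomain V.1 (M.res V.2 (A i))) ∘ₗ DomainSec.pderiv i) +
      ∑ k, LinearMap.mulLeft ℂ (c.toDomain V.1 (M.res V.2 (B k))) ∘ₗ
        DomainSec.mapValues _ (CliffordAlgebra.contractLeft (LinearMap.proj k))
  let T : M.Family c.dom := fun V =>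
    (c.ofDomain V.2).toLinearMap ∘ₗ D V ∘ₗ (c.toDomain V.1).toLinearMap
  have hT : ∀ (V : {V : Opens M.carrier // V ≤ c.dom}) (x : M.carrier) (hx : x ∈ V.1)
      (f : M.Sec V.1),
        c.ev hx (V.2 hx) (T V f) = c.derivVal (fun i => c.ev (V.2 hx) (V.2 hx) (A i))
          (fun k => c.ev (V.2 hx) (V.2 hx) (B k)) hx (V.2 hx) f := by
    intro V x hx f
    have e : T V f = c.ofDomain V.2 (D V (c.toDomain V.1 f)) := rfl
    rw [e, c.ev_ofDomain]
    simp only [D, LinearMap.add_apply, LinearMap.sum_apply, LinearMap.comp_apply,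
      LinearMap.mulLeft_apply, map_add, map_sum, map_mul, DomainSec.eval_mapValues]
    simp only [← c.ev_apply hx (V.2 hx), ← c.evPderiv_apply _ hx (V.2 hx), c.ev_res,
      c.derivVal_apply]
  have hAx : ∀ x (hx : x ∈ c.dom) i, c.ev hx hx (A i) ∈
      CliffordAlgebra.evenOdd (0 : QuadraticForm ℂ (κ → ℂ)) p :=
    fun x hx i => c.ev_mem_evenOdd (hA i) _ _
  have hBx : ∀ x (hx : x ∈ c.dom) i, c.ev hx hx (B i) ∈
      CliffordAlgebra.evenOdd (0 : QuadraticForm ℂ (κ → ℂ)) (p + 1) :=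
    fun x hx i => c.ev_mem_evenOdd (hB i) _ _
  refine ⟨T, ⟨fun V W h f => ?_, fun V q f hf => ?_, fun V q f hf g => ?_⟩, hT⟩
  · refine c.eq_of_ev_eq W.2 fun x hx => ?_
    rw [c.ev_res, hT V x (h hx), hT W x hx, c.derivVal_res]
  · refine c.mem_parity_of_ev_mem V.2 fun x hx => ?_
    rw [hT V x hx]
    exact c.derivVal_mem_evenOdd (hAx x _) (hBx x _) _ _ hf
  · refine c.eq_of_ev_eq V.2 fun x hx => ?_
    rw [hT V x hx, c.derivVal_mul (hAx x _) (hBx x _) _ _ hf, map_add, map_smul, map_mul, map_mul,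
      hT V x hx, hT V x hx]

end

/-- Superderivations given on the members of an open cover and agreeing on overlaps glue. -/
theorem exists_isHomDer_of_cover {p : ZMod 2} {I : Type*} (O : I → Opens M.carrier)
    (hO : ∀ x, ∃ i, x ∈ O i) (T : ∀ i, M.Family (O i)) (hT : ∀ i, IsHomDer p (T i))
    (hTT : ∀ i j (V : Opens M.carrier) (hi : V ≤ O i) (hj : V ≤ O j),
      T i ⟨V, hi⟩ = T j ⟨V, hj⟩) :
    ∃ X : M.Family ⊤, IsHomDer p X ∧
      ∀ i (V : Opens M.carrier) (h : V ≤ O i), X ⟨V, le_top⟩ = T i ⟨V, h⟩ := by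
  have hex : ∀ (V : Opens M.carrier) (f : M.Sec V), ∃ g : M.Sec V, ∀ i,
      M.res (inf_le_left : V ⊓ O i ≤ V) g = T i ⟨V ⊓ O i, inf_le_right⟩ (M.res inf_le_left f) := by
    intro V f
    refine exists_gluing (fun i => V ⊓ O i) (fun i => inf_le_left)
      (fun x hx => (hO x).imp fun i hi => ⟨hx, hi⟩) _ fun i j => ?_
    have hi : (V ⊓ O i) ⊓ (V ⊓ O j) ≤ O i := inf_le_left.trans inf_le_right
    have hj : (V ⊓ O i) ⊓ (V ⊓ O j) ≤ O j := inf_le_right.trans inf_le_right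
    have e1 := (hT i).natural ⟨V ⊓ O i, inf_le_right⟩ ⟨_, hi⟩ inf_le_left (M.res inf_le_left f)
    have e2 := (hT j).natural ⟨V ⊓ O j, inf_le_right⟩ ⟨_, hj⟩ inf_le_right (M.res inf_le_left f)
    rw [e1, e2, res_res, res_res, hTT i j _ hi hj]
  choose X hX using hex
  have hXT : ∀ (V : Opens M.carrier) (f : M.Sec V) i (W : Opens M.carrier) (hW : W ≤ V)
      (hi : W ≤ O i), M.res hW (X V f) = T i ⟨W, hi⟩ (M.res hW f) := by
    intro V f i W hW hi
    have h := congrArg (M.res (le_inf hW hi : W ≤ V ⊓ O i)) (hX V f i)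
    have e := (hT i).natural ⟨V ⊓ O i, inf_le_right⟩ ⟨W, hi⟩ (le_inf hW hi) (M.res inf_le_left f)
    rw [e, res_res, res_res] at h
    exact h
  have hloc : ∀ (V : Opens M.carrier) (f g : M.Sec V), (∀ i,
      M.res (inf_le_left : V ⊓ O i ≤ V) f = M.res (inf_le_left : V ⊓ O i ≤ V) g) → f = g := by
    intro V f g h
    refine eq_of_locally_eq fun x hx => ?_
    obtain ⟨i, hi⟩ := hO x
    exact ⟨V ⊓ O i, inf_le_left, ⟨hx, hi⟩, h i⟩
  let X' : M.Family ⊤ := fun V =>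
    { toFun := X V.1
      map_add' := fun f g => hloc _ _ _ fun i => by
        rw [map_add, hX, hX, hX, map_add, map_add]
      map_smul' := fun r f => hloc _ _ _ fun i => by
        rw [map_smul, hX, hX, map_smul, map_smul]; rfl }
  have hX' : ∀ V f, X' V f = X V.1 f := fun _ _ => rfl
  refine ⟨X', ⟨fun V W h f => ?_, fun V q f hf => ?_, fun V q f hf g => ?_⟩, fun i V h => ?_⟩
  · refine hloc _ _ _ fun i => ?_
    rw [hX', hX', hX, res_res, hXT V.1 f i _ _ inf_le_right, res_res]
  · refine mem_parity_of_locally fun x hx => ?_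
    obtain ⟨i, hi⟩ := hO x
    refine ⟨V.1 ⊓ O i, inf_le_left, ⟨hx, hi⟩, ?_⟩
    rw [hX', hX]
    exact (hT i).map_parity ⟨V.1 ⊓ O i, inf_le_right⟩ q _
      (M.map_parity (inf_le_left : V.1 ⊓ O i ≤ V.1) q f hf)
  · refine hloc _ _ _ fun i => ?_
    have hf' : M.res (inf_le_left : V.1 ⊓ O i ≤ V.1) f ∈ M.parity _ q :=
      M.map_parity (inf_le_left : V.1 ⊓ O i ≤ V.1) q f hf
    rw [hX', hX, map_mul, (hT i).leibniz ⟨V.1 ⊓ O i, inf_le_right⟩ q _ hf', map_add, map_smul,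
      map_mul, map_mul, hX', hX', hX, hX]
  · ext f
    have := hXT V f i V le_rfl h
    rwa [res_self, res_self] at this

end SuperSpace

/-! ### The chain rule -/

namespace DomainSec

variable {ι κ ι₂ κ₂ : Type*} [Fintype ι] [Fintype κ] [Fintype ι₂] [Fintype κ₂]

open Filter Topology

/-- If `F` is obtained from `G` by the substitution `φ` and a linear map `L` on values, then its
partial derivatives are directional derivatives of `G`. -/
theorem coeff_eval_pderiv_comp {V : Opens (ι → ℂ)} {V₂ : Opens (ι₂ → ℂ)} {F : DomainSec ι κ V}
    {G : DomainSec ι₂ κ₂ V₂} {φ : (ι → ℂ) → ι₂ → ℂ} {L : Grassmann κ₂ →ₗ[ℂ] Grassmann κ}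
    (H : ∀ a (ha : a ∈ V), ∃ hb : φ a ∈ V₂, eval ha F = L (eval hb G))
    {a : ι → ℂ} (ha : a ∈ V) {φ' : (ι → ℂ) →L[ℂ] ι₂ → ℂ} (hφ : HasFDerivAt φ φ' a) (i : ι)
    (l : Module.Dual ℂ (Grassmann κ)) :
    open Classical in l (eval ha (pderiv i F)) =
      fderiv ℂ (Holo.ext0 (coeff (l ∘ₗ L) G)) (φ a) (φ' (Pi.single i 1)) := by
  classical
  obtain ⟨hb, -⟩ := H a ha
  have h : Holo.ext0 (coeff l F) =ᶠ[𝓝 a] fun x => Holo.ext0 (coeff (l ∘ₗ L) G) (φ x) := by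
    refine Holo.ext0_eventuallyEq ha fun y => ?_
    obtain ⟨hy, e⟩ := H y y.2
    rw [coeff_apply l F y.2, e, Holo.ext0_of_mem _ hy, coeff_apply _ G hy]
    rfl
  rw [coeff_eval_pderiv, h.fderiv_eq]
  have := ((Holo.differentiableAt_ext0 (coeff (l ∘ₗ L) G) hb).hasFDerivAt.comp a hφ).fderiv
  rw [Function.comp_def] at this
  rw [this]
  rfl

theorem eq_of_dual_eq {x y : Grassmann κ} (h : ∀ l : Module.Dual ℂ (Grassmann κ), l x = l y) :
    x = y := by
  by_contra hne
  exact sub_ne_zero.2 hne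
    ((Module.forall_dual_apply_eq_zero_iff ℂ (x - y)).1 fun l => by rw [map_sub, h, sub_self])

end DomainSec

namespace SuperChart

variable {M : SuperSpace.{u}} {P : SuperSpace.{w}} {ι κ ι₂ κ₂ : Type} [Fintype ι] [Fintype κ]
  [Fintype ι₂] [Fintype κ₂] (c : SuperChart M ι κ) (C : SuperChart P ι₂ κ₂)

section

variable {W : Opens M.carrier} {W₂ : Opens P.carrier} {f : M.Sec W} {G : P.Sec W₂}
  {φ : (ι → ℂ) → ι₂ → ℂ} {L : Grassmann κ₂ →ₗ[ℂ] Grassmann κ}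
  -- `f` is obtained from `G` by the substitution `φ` of coordinates and the map `L` on values
  (H : ∀ x (hx : x ∈ W) (hc : x ∈ c.dom), ∃ (y : P.carrier) (hy : y ∈ W₂) (hC : y ∈ C.dom),
    C.base y = φ (c.base x) ∧ c.ev hx hc f = L (C.ev hy hC G))
  {x : M.carrier} (hx : x ∈ W) (hc : x ∈ c.dom) {φ' : (ι → ℂ) →L[ℂ] ι₂ → ℂ}
  (hφ : HasFDerivAt φ φ' (c.base x))

include H

theorem exists_eval_toDomain_eq (a : ι → ℂ) (ha : a ∈ c.push W) : ∃ hb : φ a ∈ C.push W₂,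
    DomainSec.eval ha (c.toDomain W f) = L (DomainSec.eval hb (C.toDomain W₂ G)) := by
  obtain ⟨y, hy, hC, e, h⟩ := H (c.base.symm a) ha.2 (c.symm_mem_dom ha.1)
  rw [c.base_symm ha.1] at e
  rw [ev_apply, ev_apply] at h
  have hb : C.base y ∈ C.push W₂ := C.base_mem_push hy hC
  refine ⟨e ▸ hb, ?_⟩
  simpa only [c.base_symm ha.1, e] using h

include hφ

open Classical in
theorem evPderiv_comp {y : P.carrier} (hy : y ∈ W₂) (hC : y ∈ C.dom)
    (hyx : C.base y = φ (c.base x)) {i : ι} {j : ι₂}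
    (hij : φ' (Pi.single i 1) = Pi.single j 1) :
    c.evPderiv i hx hc f = L (C.evPderiv j hy hC G) := by
  refine DomainSec.eq_of_dual_eq fun l => ?_
  rw [evPderiv_apply, DomainSec.coeff_eval_pderiv_comp (c.exists_eval_toDomain_eq C H) _ hφ, hij,
    ← hyx, evPderiv_apply, ← LinearMap.comp_apply, DomainSec.coeff_eval_pderiv]

open Classical in
theorem evPderiv_comp_eq_zero {i : ι} (hi : φ' (Pi.single i 1) = 0) :
    c.evPderiv i hx hc f = 0 := by
  refine DomainSec.eq_of_dual_eq fun l => ?_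
  rw [evPderiv_apply, DomainSec.coeff_eval_pderiv_comp (c.exists_eval_toDomain_eq C H) _ hφ, hi,
    map_zero, map_zero]

end

end SuperChart

/-! ### Charts adapted to a projection -/

/-- The coordinates of the chart `C` with indices in the ranges of `e` and `k` are the pullbacks,
under a projection `p`, of the coordinates of `c`. -/
structure IsPullbackChart {P : SuperSpace.{w}} {M : SuperSpace.{u}} (p : P.Hom M)
    {ι κ ι₁ κ₁ : Type} [Fintype ι] [Fintype κ] [Fintype ι₁] [Fintype κ₁]
    (c : SuperChart M ι₁ κ₁) (C : SuperChart P ι κ) (e : ι₁ → ι) (k : κ₁ → κ) : Prop where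
  e_injective : Function.Injective e
  k_injective : Function.Injective k
  dom_le : C.dom ≤ Opens.comap p.base c.dom
  z_eq : ∀ i, C.z (e i) = P.res dom_le (p.pull c.dom (c.z i))
  ξ_eq : ∀ l, C.ξ (k l) = P.res dom_le (p.pull c.dom (c.ξ l))

namespace IsPullbackChart

variable {P : SuperSpace.{w}} {M : SuperSpace.{u}} {p : P.Hom M} {ι κ ι₁ κ₁ : Type} [Fintype ι]
  [Fintype κ] [Fintype ι₁] [Fintype κ₁] {c : SuperChart M ι₁ κ₁} {C : SuperChart P ι κ}
  {e : ι₁ → ι} {k : κ₁ → κ} (h : IsPullbackChart p c C e k)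

open ExteriorAlgebra

include h

/-- The underlying map of the projection is given by the coordinates with indices in the range of
`e`. -/
theorem base_apply {y : P.carrier} (hy : y ∈ C.dom) (i : ι₁) :
    C.base y (e i) = c.base (p.base y) i := by
  have hc : p.base y ∈ c.dom := h.dom_le hy
  have hmem : ∀ {V : Opens (ι₁ → ℂ)}, c.base (p.base y) ∈ V → y ∈ Opens.comap p.base (c.pre V) :=
    fun hV => ⟨c.mem_dom.1 hc, hV⟩
  let α : ∀ V : Opens (ι₁ → ℂ), c.base (p.base y) ∈ V → V ≤ c.image →
      DomainSec ι₁ κ₁ V →ₐ[ℂ] Grassmann κ := fun V hV hV₀ =>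
    ((C.ev (hmem hV) hy).comp (p.pull (c.pre V))).comp (c.pullSec hV₀).toAlgHom
  refine DomainSec.germHom_z_eq (α := α) (fun V W hV hW hV₀ hWV F => ?_) (c.base_mem_image hc) ?_
  · have e1 : α W hW (hWV.trans hV₀) (DomainSec.res hWV F) = C.ev (hmem hW) hy
      (p.pull (c.pre W) (c.pullSec (hWV.trans hV₀) (DomainSec.res hWV F))) := rfl
    rw [e1, ← c.res_pullSec hWV hV₀, ← p.pull_res (c.pre_mono hWV), C.ev_res]
    rfl
  · have e1 := congrArg (C.ev hy hy) (h.z_eq i)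
    rw [C.ev_z, C.ev_res] at e1
    exact e1.symm

/-- On values, pullback is the inclusion of a Grassmann algebra on fewer generators. -/
theorem ev_pull {V : Opens M.carrier} (f : M.Sec V) {y : P.carrier} {x : M.carrier}
    (hyx : p.base y = x) (hx : x ∈ V) (hc : x ∈ c.dom) (hy : y ∈ Opens.comap p.base V)
    (hC : y ∈ C.dom) : C.ev hy hC (p.pull V f) =
      ExteriorAlgebra.map (Function.ExtendByZero.linearMap ℂ k) (c.ev hx hc f) := by
  classical
  subst hyx
  have hmem : ∀ {V : Opens (ι₁ → ℂ)}, c.base (p.base y) ∈ V → y ∈ Opens.comap p.base (c.pre V) :=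
    fun hV => ⟨c.mem_dom.1 hc, hV⟩
  let α : ∀ V : Opens (ι₁ → ℂ), c.base (p.base y) ∈ V → V ≤ c.image →
      DomainSec ι₁ κ₁ V →ₐ[ℂ] Grassmann κ := fun V hV hV₀ =>
    ((C.ev (hmem hV) hC).comp (p.pull (c.pre V))).comp (c.pullSec hV₀).toAlgHom
  have hα : ∀ V hV hV₀ F, α V hV hV₀ F = C.ev (hmem hV) hC (p.pull (c.pre V) (c.pullSec hV₀ F)) :=
    fun _ _ _ _ => rfl
  have hres : ∀ (V : Opens (ι₁ → ℂ)) (hV : c.base (p.base y) ∈ V) (hV₀ : V ≤ c.image)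
      (g : M.Sec c.dom), C.ev (hmem hV) hC (p.pull (c.pre V) (M.res (c.pre_le_dom V) g)) =
        C.ev hC hC (P.res h.dom_le (p.pull c.dom g)) := fun V hV hV₀ g => by
    rw [← p.pull_res (c.pre_le_dom V), C.ev_res, C.ev_res]
  have key := DomainSec.germHom_eq (α := α)
    (β := ExteriorAlgebra.map (Function.ExtendByZero.linearMap ℂ k))
    (fun V W hV hW hV₀ hWV F => by
      rw [hα W hW (hWV.trans hV₀), ← c.res_pullSec hWV hV₀, ← p.pull_res (c.pre_mono hWV),
        C.ev_res, hα V hV hV₀])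
    (fun V hV hV₀ i => by
      have e1 : c.pullSec hV₀ (DomainSec.z κ₁ V i) = M.res (c.pre_le_dom V) (c.z i) :=
        (c.res_pullSec hV₀ le_rfl (DomainSec.z κ₁ c.image i)).symm
      rw [hα V hV hV₀, e1, hres V hV hV₀, ← h.z_eq, C.ev_z, h.base_apply hC])
    (fun V hV hV₀ l => by
      have e1 : c.pullSec hV₀ (DomainSec.ξ ι₁ V l) = M.res (c.pre_le_dom V) (c.ξ l) :=
        (c.res_pullSec hV₀ le_rfl (DomainSec.ξ ι₁ c.image l)).symm
      have e2 : Function.extend k (Pi.single l (1 : ℂ)) 0 = Pi.single (k l) 1 := by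
        ext j
        by_cases hj : ∃ l', k l' = j
        · obtain ⟨l', rfl⟩ := hj
          rw [h.k_injective.extend_apply]
          simp [Pi.single_apply, h.k_injective.eq_iff]
        · rw [Function.extend_apply' _ _ _ hj]
          have : j ≠ k l := fun e => hj ⟨l, e.symm⟩
          simp [this]
      rw [hα V hV hV₀, e1, hres V hV hV₀, ← h.ξ_eq, C.ev_ξ, DomainSec.eval_ξ,
        ExteriorAlgebra.map_apply_ι]
      refine congrArg (ExteriorAlgebra.ι ℂ) (Eq.trans ?_ (e2.symm.trans ?_))
      · congr!
      · congr!)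
    (c.push V) (c.base_mem_push hx hc) (c.push_le_image V) (c.toDomain V f)
  rw [hα _ (c.base_mem_push hx hc) (c.push_le_image V), c.pull_toDomain,
    ← p.pull_res (c.pre_push_le V), C.ev_res] at key
  exact key

theorem ev_res_pull {V : Opens M.carrier} (f : M.Sec V) {W : Opens P.carrier}
    (hW : W ≤ Opens.comap p.base V) {y : P.carrier} {x : M.carrier} (hyx : p.base y = x)
    (hx : x ∈ V) (hc : x ∈ c.dom) (hy : y ∈ W) (hC : y ∈ C.dom) :
    C.ev hy hC (P.res hW (p.pull V f)) =
      ExteriorAlgebra.map (Function.ExtendByZero.linearMap ℂ k) (c.ev hx hc f) := by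
  rw [C.ev_res, h.ev_pull f hyx hx hc]

open Classical in
theorem evPderiv_res_pull {V : Opens M.carrier} (f : M.Sec V) {W : Opens P.carrier}
    (hW : W ≤ Opens.comap p.base V) {y : P.carrier} {x : M.carrier} (hyx : p.base y = x)
    (hx : x ∈ V) (hc : x ∈ c.dom) (hy : y ∈ W) (hC : y ∈ C.dom) (i : ι₁) :
    C.evPderiv (e i) hy hC (P.res hW (p.pull V f)) =
      ExteriorAlgebra.map (Function.ExtendByZero.linearMap ℂ k) (c.evPderiv i hx hc f) := by
  subst hyx
  refine C.evPderiv_comp c (φ := LinearMap.funLeft ℂ ℂ e)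
    (L := (ExteriorAlgebra.map (Function.ExtendByZero.linearMap ℂ k)).toLinearMap)
    (fun y hy hC => ⟨p.base y, hW hy, h.dom_le hC, ?_, h.ev_res_pull f hW rfl _ _ hy hC⟩) hy hC
    (LinearMap.toContinuousLinearMap (LinearMap.funLeft ℂ ℂ e)).hasFDerivAt _ _ ?_ ?_
  · ext i; exact (h.base_apply hC i).symm
  · ext i; exact (h.base_apply hC i).symm
  · ext i'
    simp [LinearMap.funLeft_apply, Pi.single_apply, h.e_injective.eq_iff]

theorem evPderiv_res_pull_of_notMem {V : Opens M.carrier} (f : M.Sec V) {W : Opens P.carrier}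
    (hW : W ≤ Opens.comap p.base V) {y : P.carrier} (hy : y ∈ W) (hC : y ∈ C.dom) {i : ι}
    (hi : i ∉ Set.range e) : C.evPderiv i hy hC (P.res hW (p.pull V f)) = 0 := by
  classical
  refine C.evPderiv_comp_eq_zero c (φ := LinearMap.funLeft ℂ ℂ e)
    (L := (ExteriorAlgebra.map (Function.ExtendByZero.linearMap ℂ k)).toLinearMap)
    (fun y hy hC => ⟨p.base y, hW hy, h.dom_le hC, ?_, h.ev_res_pull f hW rfl _ _ hy hC⟩) hy hC
    (LinearMap.toContinuousLinearMap (LinearMap.funLeft ℂ ℂ e)).hasFDerivAt ?_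
  · ext i; exact (h.base_apply hC i).symm
  · ext i'
    have : e i' ≠ i := fun e => hi ⟨i', e⟩
    simp [LinearMap.funLeft_apply, this]

theorem proj_comp_extendByZero (l : κ₁) :
    (LinearMap.proj (k l) : Module.Dual ℂ (κ → ℂ)) ∘ₗ Function.ExtendByZero.linearMap ℂ k =
      LinearMap.proj l := by
  ext v
  simp [h.k_injective.extend_apply]

omit [Fintype κ] [Fintype κ₁] h in
theorem proj_comp_extendByZero_of_notMem {l : κ} (hl : l ∉ Set.range k) :
    (LinearMap.proj l : Module.Dual ℂ (κ → ℂ)) ∘ₗ Function.ExtendByZero.linearMap ℂ k = 0 := by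
  ext v
  simp [Function.extend_apply' _ _ _ hl]

omit h in
/-- A first order operator whose coefficients are supported on the coordinates numbered by `e` and
`k`. -/
theorem derivVal_extend (he : Function.Injective e) (hk : Function.Injective k)
    (A : ι₁ → Grassmann κ) (B : κ₁ → Grassmann κ) {W : Opens P.carrier} {y : P.carrier}
    (hy : y ∈ W) (hC : y ∈ C.dom) (f : P.Sec W) :
    C.derivVal (Function.extend e A 0) (Function.extend k B 0) hy hC f =
      (∑ i, A i * C.evPderiv (e i) hy hC f) +
        ∑ l, B l * CliffordAlgebra.contractLeft (LinearMap.proj (k l)) (C.ev hy hC f) := by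
  rw [C.derivVal_apply]
  congr 1
  · refine (Fintype.sum_of_injective e he _ _ (fun i hi => ?_) fun i => ?_).symm
    · rw [Function.extend_apply' _ _ _ hi, Pi.zero_apply, zero_mul]
    · rw [he.extend_apply]
  · refine (Fintype.sum_of_injective k hk _ _ (fun i hi => ?_) fun i => ?_).symm
    · rw [Function.extend_apply' _ _ _ hi, Pi.zero_apply, zero_mul]
    · rw [hk.extend_apply]

/-- Lifted coefficients act on pullbacks as the original ones. -/
theorem derivVal_extend_pull {V : Opens M.carrier} (f : M.Sec V) {W : Opens P.carrier}
    (hW : W ≤ Opens.comap p.base V) {y : P.carrier} {x : M.carrier} (hyx : p.base y = x)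
    (hx : x ∈ V) (hc : x ∈ c.dom) (hy : y ∈ W) (hC : y ∈ C.dom) (A : ι₁ → Grassmann κ₁)
    (B : κ₁ → Grassmann κ₁) :
    C.derivVal
      (Function.extend e
        (fun i => ExteriorAlgebra.map (Function.ExtendByZero.linearMap ℂ k) (A i)) 0)
      (Function.extend k
        (fun l => ExteriorAlgebra.map (Function.ExtendByZero.linearMap ℂ k) (B l)) 0) hy hC
      (P.res hW (p.pull V f)) =
    ExteriorAlgebra.map (Function.ExtendByZero.linearMap ℂ k)
      (c.derivVal A B hx hc f) := by
  rw [derivVal_extend h.e_injective h.k_injective, c.derivVal_apply, map_add, map_sum, map_sum]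
  congr 1
  · refine Finset.sum_congr rfl fun i _ => ?_
    rw [h.evPderiv_res_pull f hW hyx hx hc, map_mul]
  · refine Finset.sum_congr rfl fun l _ => ?_
    rw [h.ev_res_pull f hW hyx hx hc, contractLeft_map, h.proj_comp_extendByZero,
      map_mul]

/-- Coefficients supported on other coordinates annihilate pullbacks. -/
theorem derivVal_extend_pull_eq_zero {ι₂ κ₂ : Type} [Fintype ι₂] [Fintype κ₂] {e₂ : ι₂ → ι}
    {k₂ : κ₂ → κ} (he₂ : Function.Injective e₂) (hk₂ : Function.Injective k₂)
    (he : ∀ i, e₂ i ∉ Set.range e) (hk : ∀ l, k₂ l ∉ Set.range k)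
    {V : Opens M.carrier} (f : M.Sec V) {W : Opens P.carrier}
    (hW : W ≤ Opens.comap p.base V) {y : P.carrier} (hy : y ∈ W) (hC : y ∈ C.dom)
    (A : ι₂ → Grassmann κ) (B : κ₂ → Grassmann κ) :
    C.derivVal (Function.extend e₂ A 0) (Function.extend k₂ B 0) hy hC
      (P.res hW (p.pull V f)) = 0 := by
  rw [derivVal_extend he₂ hk₂]
  have h0 : ∀ x : Grassmann κ₁, CliffordAlgebra.contractLeft (0 : Module.Dual ℂ (κ₁ → ℂ)) x = 0 :=
    fun x => by rw [map_zero, LinearMap.zero_apply]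
  simp only [h.evPderiv_res_pull_of_notMem f hW hy hC (he _), mul_zero, Finset.sum_const_zero,
    zero_add]
  refine Finset.sum_eq_zero fun l _ => ?_
  rw [h.ev_res_pull f hW rfl (hW hy) (h.dom_le hC), contractLeft_map,
    proj_comp_extendByZero_of_notMem (hk l), h0, map_zero, mul_zero]

end IsPullbackChart

/-! ### Lifting superderivations to a product -/

namespace SuperSpace

theorem IsHomDer.restrict {M : SuperSpace.{u}} {U W : Opens M.carrier} {q : ZMod 2}
    {X : M.Family U} (hX : IsHomDer q X) (h : W ≤ U) : IsHomDer q (X.restrict h) :=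
  ⟨fun V V' hV f => hX.natural ⟨V.1, V.2.trans h⟩ ⟨V'.1, V'.2.trans h⟩ hV f,
    fun V => hX.map_parity ⟨V.1, V.2.trans h⟩, fun V => hX.leibniz ⟨V.1, V.2.trans h⟩⟩

theorem IsHomDer.isDer_of_even {M : SuperSpace.{u}} {U : Opens M.carrier} {X : M.Family U}
    (hX : IsHomDer 0 X) : IsDer X :=
  ⟨X, 0, hX, ⟨fun _ _ _ _ => map_zero _, fun _ _ _ _ => zero_mem _, fun _ _ _ _ g => by
    simp⟩, (add_zero X).symm⟩

/-- Superderivations on a chart domain are determined by their values on the coordinates. -/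
theorem IsHomDer.eq_of_onZ_of_onξ {M : SuperSpace.{u}} {ι κ : Type} [Fintype ι] [Fintype κ]
    {c : SuperChart M ι κ} {U : Opens M.carrier} (hU : U ≤ c.dom) {q : ZMod 2} {X Y : M.Family U}
    (hX : IsHomDer q X) (hY : IsHomDer q Y) (hz : ∀ i, X.onZ c i = Y.onZ c i)
    (hξ : ∀ k, X.onξ c k = Y.onξ c k) : X = Y := by
  funext V
  refine LinearMap.ext fun f => c.eq_of_ev_eq (V.2.trans hU) fun x hx => ?_
  rw [hX.ev_eq_derivVal c V hx (hU (V.2 hx)), hY.ev_eq_derivVal c V hx (hU (V.2 hx))]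
  simp only [hz, hξ]

end SuperSpace

/-- A chart of a product: its coordinates are the pullbacks of the coordinates of a chart of each
factor. -/
structure IsProductChart {M' : SuperSpace.{u}} {M'' : SuperSpace.{v}} {P : SuperSpace.{w}}
    (p' : P.Hom M') (p'' : P.Hom M'') {ι κ ι' κ' ι'' κ'' : Type} [Fintype ι] [Fintype κ]
    [Fintype ι'] [Fintype κ'] [Fintype ι''] [Fintype κ''] (c' : SuperChart M' ι' κ')
    (c'' : SuperChart M'' ι'' κ'') (C : SuperChart P ι κ) (e' : ι' → ι) (e'' : ι'' → ι)
    (k' : κ' → κ) (k'' : κ'' → κ) : Prop where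
  fst : IsPullbackChart p' c' C e' k'
  snd : IsPullbackChart p'' c'' C e'' k''
  e_ne : ∀ i j, e' i ≠ e'' j
  k_ne : ∀ i j, k' i ≠ k'' j
  e_cover : ∀ i, (∃ j, e' j = i) ∨ ∃ j, e'' j = i
  k_cover : ∀ i, (∃ j, k' j = i) ∨ ∃ j, k'' j = i

namespace IsProductChart

variable {M' : SuperSpace.{u}} {M'' : SuperSpace.{v}} {P : SuperSpace.{w}} {p' : P.Hom M'}
  {p'' : P.Hom M''} {ι κ ι' κ' ι'' κ'' : Type} [Fintype ι] [Fintype κ] [Fintype ι'] [Fintype κ']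
  [Fintype ι''] [Fintype κ''] {c' : SuperChart M' ι' κ'} {c'' : SuperChart M'' ι'' κ''}
  {C : SuperChart P ι κ} {e' : ι' → ι} {e'' : ι'' → ι} {k' : κ' → κ} {k'' : κ'' → κ}

theorem swap (h : IsProductChart p' p'' c' c'' C e' e'' k' k'') :
    IsProductChart p'' p' c'' c' C e'' e' k'' k' where
  fst := h.snd
  snd := h.fst
  e_ne i j := (h.e_ne j i).symm
  k_ne i j := (h.k_ne j i).symm
  e_cover i := (h.e_cover i).symm
  k_cover i := (h.k_cover i).symm

end IsProductChart

namespace SuperSpace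

variable {M' : SuperSpace.{u}} {M'' : SuperSpace.{v}} {P : SuperSpace.{w}}

/-- Every point lies in the domain of a chart of a product. -/
def HasProductCharts (p' : P.Hom M') (p'' : P.Hom M'') : Prop :=
  ∀ y : P.carrier, ∃ (ι κ ι' κ' ι'' κ'' : Type) (_ : Fintype ι) (_ : Fintype κ) (_ : Fintype ι')
    (_ : Fintype κ') (_ : Fintype ι'') (_ : Fintype κ'') (c' : SuperChart M' ι' κ')
    (c'' : SuperChart M'' ι'' κ'') (C : SuperChart P ι κ) (e' : ι' → ι) (e'' : ι'' → ι)
    (k' : κ' → κ) (k'' : κ'' → κ), IsProductChart p' p'' c' c'' C e' e'' k' k'' ∧ y ∈ C.dom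

theorem HasProductCharts.swap {p' : P.Hom M'} {p'' : P.Hom M''} (h : HasProductCharts p' p'') :
    HasProductCharts p'' p' := fun y => by
  obtain ⟨ι, κ, ι', κ', ι'', κ'', _, _, _, _, _, _, c', c'', C, e', e'', k', k'', hC, hy⟩ := h y
  exact ⟨ι, κ, ι'', κ'', ι', κ', _, _, _, _, _, _, c'', c', C, e'', e', k'', k', hC.swap, hy⟩

/-- `T` lifts the even superderivation `X'` of the first factor: it acts as `X'` on the
superfunctions pulled back from the first factor and annihilates those pulled back from the
second. -/
structure IsLift (p' : P.Hom M') (p'' : P.Hom M'') (X' : M'.Family ⊤) {U : Opens P.carrier}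
    (T : P.Family U) : Prop where
  isHomDer : IsHomDer 0 T
  apply_fst : ∀ (W : {W : Opens P.carrier // W ≤ U}) (V : Opens M'.carrier)
    (h : W.1 ≤ Opens.comap p'.base V) (f : M'.Sec V),
    T W (P.res h (p'.pull V f)) = P.res h (p'.pull V (X' ⟨V, le_top⟩ f))
  apply_snd : ∀ (W : {W : Opens P.carrier // W ≤ U}) (V : Opens M''.carrier)
    (h : W.1 ≤ Opens.comap p''.base V) (f : M''.Sec V), T W (P.res h (p''.pull V f)) = 0

namespace IsLift

variable {p' : P.Hom M'} {p'' : P.Hom M''} {X' : M'.Family ⊤} {U : Opens P.carrier}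
  {T : P.Family U}

theorem restrict (hT : IsLift p' p'' X' T) {W : Opens P.carrier} (h : W ≤ U) :
    IsLift p' p'' X' (T.restrict h) :=
  ⟨hT.isHomDer.restrict h, fun V => hT.apply_fst ⟨V.1, V.2.trans h⟩,
    fun V => hT.apply_snd ⟨V.1, V.2.trans h⟩⟩

section

variable {ι κ ι' κ' ι'' κ'' : Type} [Fintype ι] [Fintype κ] [Fintype ι'] [Fintype κ']
  [Fintype ι''] [Fintype κ''] {c' : SuperChart M' ι' κ'} {c'' : SuperChart M'' ι'' κ''}
  {C : SuperChart P ι κ} {e' : ι' → ι} {e'' : ι'' → ι} {k' : κ' → κ} {k'' : κ'' → κ}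
  (h : IsProductChart p' p'' c' c'' C e' e'' k' k'')

include h

theorem onZ_fst (hT : IsLift p' p'' X' T) (i : ι') : T.onZ C (e' i) =
    P.res (inf_le_right.trans h.fst.dom_le) (p'.pull c'.dom (X' ⟨c'.dom, le_top⟩ (c'.z i))) := by
  rw [Family.onZ, h.fst.z_eq, res_res, hT.apply_fst]

theorem onξ_fst (hT : IsLift p' p'' X' T) (l : κ') : T.onξ C (k' l) =
    P.res (inf_le_right.trans h.fst.dom_le) (p'.pull c'.dom (X' ⟨c'.dom, le_top⟩ (c'.ξ l))) := by
  rw [Family.onξ, h.fst.ξ_eq, res_res, hT.apply_fst]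

theorem onZ_snd (hT : IsLift p' p'' X' T) (i : ι'') : T.onZ C (e'' i) = 0 := by
  rw [Family.onZ, h.snd.z_eq, res_res, hT.apply_snd]

theorem onξ_snd (hT : IsLift p' p'' X' T) (l : κ'') : T.onξ C (k'' l) = 0 := by
  rw [Family.onξ, h.snd.ξ_eq, res_res, hT.apply_snd]

/-- A lift is unique on the domain of a chart of the product. -/
theorem eq_of_le_dom (hU : U ≤ C.dom) {T₂ : P.Family U} (hT : IsLift p' p'' X' T)
    (hT₂ : IsLift p' p'' X' T₂) : T = T₂ := by
  refine hT.isHomDer.eq_of_onZ_of_onξ hU hT₂.isHomDer (fun i => ?_) fun l => ?_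
  · obtain ⟨j, rfl⟩ | ⟨j, rfl⟩ := h.e_cover i
    · rw [hT.onZ_fst h, hT₂.onZ_fst h]
    · rw [hT.onZ_snd h, hT₂.onZ_snd h]
  · obtain ⟨j, rfl⟩ | ⟨j, rfl⟩ := h.k_cover l
    · rw [hT.onξ_fst h, hT₂.onξ_fst h]
    · rw [hT.onξ_snd h, hT₂.onξ_snd h]

/-- The values of the coefficients of a lift. -/
theorem ev_onZ (hT : IsLift p' p'' X' T) (hX' : IsHomDer 0 X') {y : P.carrier} {x : M'.carrier}
    (hyx : p'.base y = x) (hx : x ∈ c'.dom) (hy : y ∈ U) (hC : y ∈ C.dom) :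
    (fun i => C.ev (W := U ⊓ C.dom) ⟨hy, hC⟩ hC (T.onZ C i)) =
      Function.extend e' (fun i => ExteriorAlgebra.map (Function.ExtendByZero.linearMap ℂ k')
        (c'.ev (W := ⊤ ⊓ c'.dom) ⟨trivial, hx⟩ hx (X'.onZ c' i))) 0 := by
  funext i
  obtain ⟨j, rfl⟩ | ⟨j, rfl⟩ := h.e_cover i
  · rw [h.fst.e_injective.extend_apply, hT.onZ_fst h,
      h.fst.ev_res_pull (W := U ⊓ C.dom) _ _ hyx hx hx ⟨hy, hC⟩ hC]
    congr 1
    have e1 : X'.onZ c' j = M'.res inf_le_right (X' ⟨c'.dom, le_top⟩ (c'.z j)) :=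
      (hX'.natural ⟨c'.dom, le_top⟩ ⟨⊤ ⊓ c'.dom, inf_le_left⟩ inf_le_right (c'.z j)).symm
    rw [e1]
    exact (c'.ev_res (W' := ⊤ ⊓ c'.dom) inf_le_right _ hx _).symm
  · rw [Function.extend_apply' _ _ _ fun ⟨m, e⟩ => h.e_ne m j e, hT.onZ_snd h, map_zero]
    rfl

theorem ev_onξ (hT : IsLift p' p'' X' T) (hX' : IsHomDer 0 X') {y : P.carrier} {x : M'.carrier}
    (hyx : p'.base y = x) (hx : x ∈ c'.dom) (hy : y ∈ U) (hC : y ∈ C.dom) :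
    (fun l => C.ev (W := U ⊓ C.dom) ⟨hy, hC⟩ hC (T.onξ C l)) =
      Function.extend k' (fun l => ExteriorAlgebra.map (Function.ExtendByZero.linearMap ℂ k')
        (c'.ev (W := ⊤ ⊓ c'.dom) ⟨trivial, hx⟩ hx (X'.onξ c' l))) 0 := by
  funext l
  obtain ⟨j, rfl⟩ | ⟨j, rfl⟩ := h.k_cover l
  · rw [h.fst.k_injective.extend_apply, hT.onξ_fst h,
      h.fst.ev_res_pull (W := U ⊓ C.dom) _ _ hyx hx hx ⟨hy, hC⟩ hC]
    congr 1
    have e1 : X'.onξ c' j = M'.res inf_le_right (X' ⟨c'.dom, le_top⟩ (c'.ξ j)) :=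
      (hX'.natural ⟨c'.dom, le_top⟩ ⟨⊤ ⊓ c'.dom, inf_le_left⟩ inf_le_right (c'.ξ j)).symm
    rw [e1]
    exact (c'.ev_res (W' := ⊤ ⊓ c'.dom) inf_le_right _ hx _).symm
  · rw [Function.extend_apply' _ _ _ fun ⟨m, e⟩ => h.k_ne m j e, hT.onξ_snd h, map_zero]
    rfl

end

end IsLift

open ExteriorAlgebra

/-- On the domain of a chart of the product, a lift is the first order operator with the pulled
back coefficients. -/
theorem exists_isLift_dom {p' : P.Hom M'} {p'' : P.Hom M''} {ι κ ι' κ' ι'' κ'' : Type} [Fintype ι]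
    [Fintype κ] [Fintype ι'] [Fintype κ'] [Fintype ι''] [Fintype κ''] {c' : SuperChart M' ι' κ'}
    {c'' : SuperChart M'' ι'' κ''} {C : SuperChart P ι κ} {e' : ι' → ι} {e'' : ι'' → ι}
    {k' : κ' → κ} {k'' : κ'' → κ} (h : IsProductChart p' p'' c' c'' C e' e'' k' k'')
    {X' : M'.Family ⊤} (hX' : IsHomDer 0 X') :
    ∃ T : P.Family C.dom, IsLift p' p'' X' T := by
  have hle : C.dom ≤ Opens.comap p'.base (⊤ ⊓ c'.dom) := fun y hy => ⟨trivial, h.fst.dom_le hy⟩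
  let A : ι → P.Sec C.dom :=
    Function.extend e' (fun i => P.res hle (p'.pull _ (X'.onZ c' i))) 0
  let B : κ → P.Sec C.dom :=
    Function.extend k' (fun l => P.res hle (p'.pull _ (X'.onξ c' l))) 0
  have hA : ∀ i, A i ∈ P.parity C.dom 0 := fun i => by
    by_cases hi : ∃ j, e' j = i
    · obtain ⟨j, rfl⟩ := hi
      simp only [A, h.fst.e_injective.extend_apply]
      exact P.map_parity hle 0 _ (p'.pull_parity _ 0 _ (hX'.onZ_mem_parity c' j))
    · simp only [A, Function.extend_apply' _ _ _ hi]
      exact zero_mem _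
  have hB : ∀ l, B l ∈ P.parity C.dom (0 + 1) := fun l => by
    by_cases hl : ∃ j, k' j = l
    · obtain ⟨j, rfl⟩ := hl
      simp only [B, h.fst.k_injective.extend_apply]
      exact P.map_parity hle (0 + 1) _ (p'.pull_parity _ (0 + 1) _ (hX'.onξ_mem_parity c' j))
    · simp only [B, Function.extend_apply' _ _ _ hl]
      exact zero_mem _
  obtain ⟨T, hT, hTev⟩ := C.exists_isHomDer A B hA hB
  have hAev : ∀ y (hy : y ∈ C.dom), (fun i => C.ev hy hy (A i)) = Function.extend e'
      (fun i => ExteriorAlgebra.map (Function.ExtendByZero.linearMap ℂ k')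
        (c'.ev (W := ⊤ ⊓ c'.dom) (x := p'.base y) (hle hy) (h.fst.dom_le hy) (X'.onZ c' i))) 0 := by
    intro y hy
    funext i
    simp only [A, Function.apply_extend (C.ev hy hy)]
    congr 1
    · funext j
      exact h.fst.ev_res_pull _ hle rfl (hle hy) (h.fst.dom_le hy) hy hy
    · funext j
      exact map_zero _
  have hBev : ∀ y (hy : y ∈ C.dom), (fun l => C.ev hy hy (B l)) = Function.extend k'
      (fun l => ExteriorAlgebra.map (Function.ExtendByZero.linearMap ℂ k')
        (c'.ev (W := ⊤ ⊓ c'.dom) (x := p'.base y) (hle hy) (h.fst.dom_le hy) (X'.onξ c' l))) 0 := by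
    intro y hy
    funext l
    simp only [B, Function.apply_extend (C.ev hy hy)]
    congr 1
    · funext j
      exact h.fst.ev_res_pull _ hle rfl (hle hy) (h.fst.dom_le hy) hy hy
    · funext j
      exact map_zero _
  refine ⟨T, hT, fun W V hW f => C.eq_of_ev_eq W.2 fun y hy => ?_,
    fun W V hW f => C.eq_of_ev_eq W.2 fun y hy => ?_⟩
  · rw [hTev, hAev, hBev, h.fst.derivVal_extend_pull f hW rfl (hW hy) (h.fst.dom_le (W.2 hy)),
      h.fst.ev_res_pull _ hW rfl (hW hy) (h.fst.dom_le (W.2 hy))]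
    exact congrArg _ (hX'.ev_eq_derivVal c' ⟨V, le_top⟩ _ _ f).symm
  · rw [hTev, hAev, hBev, map_zero]
    exact h.snd.derivVal_extend_pull_eq_zero h.fst.e_injective h.fst.k_injective
      (fun i ⟨j, e⟩ => h.e_ne i j e.symm) (fun i ⟨j, e⟩ => h.k_ne i j e.symm) f hW hy _ _ _

/-- Lifts exist: the local ones agree on overlaps by uniqueness. -/
theorem exists_isLift {p' : P.Hom M'} {p'' : P.Hom M''} (h : HasProductCharts p' p'')
    {X' : M'.Family ⊤} (hX' : IsHomDer 0 X') : ∃ X : P.Family ⊤, IsLift p' p'' X' X := by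
  have hloc : ∀ y : P.carrier, ∃ (O : Opens P.carrier) (_ : y ∈ O) (T : P.Family O),
      IsLift p' p'' X' T ∧ ∀ (V : Opens P.carrier) (_ : V ≤ O) (T₁ T₂ : P.Family V),
        IsLift p' p'' X' T₁ → IsLift p' p'' X' T₂ → T₁ = T₂ := by
    intro y
    obtain ⟨ι, κ, ι', κ', ι'', κ'', _, _, _, _, _, _, c', c'', C, e', e'', k', k'', hC, hy⟩ := h y
    obtain ⟨T, hT⟩ := exists_isLift_dom hC hX'
    exact ⟨C.dom, hy, T, hT, fun V hV T₁ T₂ h₁ h₂ => h₁.eq_of_le_dom hC hV h₂⟩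
  choose O hO T hT huniq using hloc
  obtain ⟨X, hX, hXT⟩ := exists_isHomDer_of_cover O (fun y => ⟨y, hO y⟩) T
    (fun y => (hT y).isHomDer) fun y₁ y₂ V h₁ h₂ =>
      congrFun (huniq y₁ V h₁ ((T y₁).restrict h₁) ((T y₂).restrict h₂) ((hT y₁).restrict h₁)
        ((hT y₂).restrict h₂)) ⟨V, le_rfl⟩
  refine ⟨X, hX, fun W V hW f => ?_, fun W V hW f => ?_⟩
  · refine eq_of_locally_eq fun y hy => ⟨W.1 ⊓ O y, inf_le_left, ⟨hy, hO y⟩, ?_⟩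
    rw [hX.natural W ⟨W.1 ⊓ O y, le_top⟩ inf_le_left, hXT y _ inf_le_right, res_res, res_res,
      (hT y).apply_fst]
  · refine eq_of_locally_eq fun y hy => ⟨W.1 ⊓ O y, inf_le_left, ⟨hy, hO y⟩, ?_⟩
    rw [hX.natural W ⟨W.1 ⊓ O y, le_top⟩ inf_le_left, hXT y _ inf_le_right, res_res, map_zero,
      (hT y).apply_snd]

theorem IsLift.raisesDegree {p' : P.Hom M'} {p'' : P.Hom M''} (h : HasProductCharts p' p'')
    {X' : M'.Family ⊤} {X : P.Family ⊤} (hX : IsLift p' p'' X' X)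
    (hX'₀ : IsHomDer 0 X') {t : ℕ}
    (hX' : RaisesDegree t X') : RaisesDegree t X := by
  refine hX.isHomDer.isDer_of_even.raisesDegree fun y _ => ?_
  obtain ⟨ι, κ, ι', κ', ι'', κ'', _, _, _, _, _, _, c', c'', C, e', e'', k', k'', hC, hy⟩ := h y
  refine ⟨ι, κ, _, _, C, hy, fun y _ hy => ⟨fun i => ?_, fun l => ?_⟩⟩
  · have := congrFun (hX.ev_onZ hC hX'₀ rfl (hC.fst.dom_le hy) trivial hy) i
    refine this.symm ▸ ?_
    by_cases hi : ∃ j, e' j = i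
    · obtain ⟨j, rfl⟩ := hi
      rw [hC.fst.e_injective.extend_apply]
      exact map_mem_degFiltration _ (hX'.ev_onZ_mem c' trivial _ j)
    · rw [Function.extend_apply' _ _ _ hi]
      exact zero_mem _
  · have := congrFun (hX.ev_onξ hC hX'₀ rfl (hC.fst.dom_le hy) trivial hy) l
    refine this.symm ▸ ?_
    by_cases hl : ∃ j, k' j = l
    · obtain ⟨j, rfl⟩ := hl
      rw [hC.fst.k_injective.extend_apply]
      exact map_mem_degFiltration _ (hX'.ev_onξ_mem c' trivial _ j)
    · rw [Function.extend_apply' _ _ _ hl]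
      exact zero_mem _

end SuperSpace

/-! ### Components of superderivations along the fibres of a projection -/

theorem DomainSec.exists_linearMap_comp {ι κ ι₂ κ₂ : Type*} [Fintype ι] [Fintype κ] [Fintype ι₂]
    [Fintype κ₂] {V : Opens (ι → ℂ)} {V₂ : Opens (ι₂ → ℂ)} {φ : (ι → ℂ) → ι₂ → ℂ}
    (hφ : Differentiable ℂ φ) (hV : ∀ a ∈ V, φ a ∈ V₂) (L : Grassmann κ₂ →ₗ[ℂ] Grassmann κ) :
    ∃ R : DomainSec ι₂ κ₂ V₂ →ₗ[ℂ] DomainSec ι κ V,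
      ∀ G a (ha : a ∈ V), eval ha (R G) = L (eval (hV a ha) G) := by
  classical
  have hex : ∀ G : DomainSec ι₂ κ₂ V₂, ∃ F : DomainSec ι κ V,
      ∀ a (ha : a ∈ V), eval ha F = L (eval (hV a ha) G) := by
    intro G
    obtain ⟨F, hF⟩ := exists_eval_eq (V := V)
      (fun a => if h : φ a ∈ V₂ then L (eval h G) else 0) fun l => by
        have hd : DifferentiableOn ℂ (fun a => Holo.ext0 (coeff (l ∘ₗ L) G) (φ a)) V :=
          (Holo.differentiableOn_ext0 (coeff (l ∘ₗ L) G)).comp hφ.differentiableOn hV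
        refine hd.congr fun a ha => ?_
        rw [dif_pos (hV a ha), Holo.ext0_of_mem _ (hV a ha), coeff_apply _ G (hV a ha)]
        rfl
    exact ⟨F, fun a ha => by rw [hF, dif_pos (hV a ha)]⟩
  choose R hR using hex
  exact ⟨{ toFun := R
           map_add' := fun F G => ext_eval fun a ha => by
             rw [map_add (eval ha), hR, hR, hR, map_add, map_add]
           map_smul' := fun r F => ext_eval fun a ha => by
             rw [RingHom.id_apply, map_smul (eval ha), hR, hR, map_smul, map_smul] }, hR⟩

/-- Superfunctions can be composed with a holomorphic map of the coordinates and a linear map of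
the values. -/
theorem SuperChart.exists_linearMap_comp {M : SuperSpace.{u}} {P : SuperSpace.{w}}
    {ι κ ι₂ κ₂ : Type} [Fintype ι] [Fintype κ] [Fintype ι₂] [Fintype κ₂] (c : SuperChart M ι κ)
    (C : SuperChart P ι₂ κ₂) {V : Opens M.carrier} (hV : V ≤ c.dom) {W : Opens P.carrier}
    {φ : (ι → ℂ) → ι₂ → ℂ} (hφ : Differentiable ℂ φ) (L : Grassmann κ₂ →ₗ[ℂ] Grassmann κ)
    (hS : ∀ x ∈ V, ∃ y ∈ W, y ∈ C.dom ∧ C.base y = φ (c.base x)) :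
    ∃ R : P.Sec W →ₗ[ℂ] M.Sec V, ∀ G x (hx : x ∈ V) y (hy : y ∈ W) (hC : y ∈ C.dom),
      C.base y = φ (c.base x) → c.ev hx (hV hx) (R G) = L (C.ev hy hC G) := by
  obtain ⟨R, hR⟩ := DomainSec.exists_linearMap_comp (V := c.push V) (V₂ := C.push W) hφ
    (fun a ha => by
      obtain ⟨y, hy, hC, e⟩ := hS _ ha.2
      rw [c.base_symm ha.1] at e
      exact e ▸ C.base_mem_push hy hC) L
  refine ⟨(c.ofDomain hV).toLinearMap ∘ₗ R ∘ₗ (C.toDomain W).toLinearMap,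
    fun G x hx y hy hC e => ?_⟩
  have h1 : ((c.ofDomain hV).toLinearMap ∘ₗ R ∘ₗ (C.toDomain W).toLinearMap) G =
    c.ofDomain hV (R (C.toDomain W G)) := rfl
  rw [h1, c.ev_ofDomain, hR, C.ev_apply]
  simp only [e]

theorem ExteriorAlgebra.neg_one_pow_val_add_natCast (q : ZMod 2) (n : ℕ) :
    (-1 : ℂ) ^ (q + n).val = (-1) ^ q.val * (-1) ^ n := by
  induction n with
  | zero => simp
  | succ n ih => rw [Nat.cast_succ, ← add_assoc, neg_one_pow_val_add_one, ih, pow_succ]; ring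

namespace IsPullbackChart

open ExteriorAlgebra SuperSpace

variable {P : SuperSpace.{w}} {M : SuperSpace.{u}} {p : P.Hom M} {ι κ ι₁ κ₁ : Type} [Fintype ι]
  [Fintype κ] [Fintype ι₁] [Fintype κ₁] {c : SuperChart M ι₁ κ₁} {C : SuperChart P ι κ}
  {e : ι₁ → ι} {k : κ₁ → κ} (h : IsPullbackChart p c C e k)

/-- The slice `a ↦ (a, b'')` through a point `b` is an affine map. -/
theorem hasFDerivAt_extend (e : ι₁ → ι) (b : ι → ℂ) (a : ι₁ → ℂ) :
    HasFDerivAt (fun a => Function.extend e a b)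
      (LinearMap.toContinuousLinearMap (Function.ExtendByZero.linearMap ℂ e)) a := by
  have h : (fun a : ι₁ → ℂ => Function.extend e a b) = fun a =>
      LinearMap.toContinuousLinearMap (Function.ExtendByZero.linearMap ℂ e) a +
        Function.extend e 0 b := by
    funext a i
    by_cases hi : ∃ j, e j = i
    · change Function.extend e a b i = Function.extend e a 0 i + Function.extend e 0 b i
      classical
      simp [Function.extend_def, hi]
    · simp [Function.extend_apply' _ _ _ hi]
  rw [h]
  exact (ContinuousLinearMap.hasFDerivAt _).add_const _

include h

theorem funLeft_comp_extendByZero :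
    LinearMap.funLeft ℂ ℂ k ∘ₗ Function.ExtendByZero.linearMap ℂ k = LinearMap.id := by
  refine LinearMap.ext fun v => funext fun l => ?_
  simp [LinearMap.funLeft_apply, h.k_injective.extend_apply]

open Classical in
theorem extendByZero_single (i : ι₁) :
    Function.ExtendByZero.linearMap ℂ e (Pi.single i (1 : ℂ)) = Pi.single (e i) 1 := by
  funext j
  rw [Function.ExtendByZero.linearMap_apply]
  by_cases hj : ∃ i', e i' = j
  · obtain ⟨i', rfl⟩ := hj
    rw [h.e_injective.extend_apply]
    simp [Pi.single_apply, h.e_injective.eq_iff]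
  · rw [Function.extend_apply' _ _ _ hj]
    have : j ≠ e i := fun e => hj ⟨i, e.symm⟩
    simp [this]

/-- The slices are sections of the projection. -/
theorem base_eq_of_extend {b : ι → ℂ} {y : P.carrier} {x : M.carrier} (hC : y ∈ C.dom)
    (hc : x ∈ c.dom) (hyx : C.base y = Function.extend e (c.base x) b) : p.base y = x := by
  refine c.base.injOn (c.mem_dom.1 (h.dom_le hC)) (c.mem_dom.1 hc) (funext fun i => ?_)
  rw [← h.base_apply hC, hyx, h.e_injective.extend_apply]

/-- Apply a homogeneous superderivation `Y` to pullbacks of superfunctions on `M`, restrict the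
result to the slice of points whose remaining even coordinates are those of `b`, and take the
component along odd directions `J` transversal to `M`. The outcome is a homogeneous superderivation
`D` on `M`; its parity is that of `Y` shifted by the length of `J`. -/
theorem exists_isHomDer_slice {U : Opens P.carrier} {Y : P.Family U} {q : ZMod 2}
    (hY : IsHomDer q Y) {b : ι → ℂ} {J : List (Module.Dual ℂ (κ → ℂ))}
    (hJ : ∀ d ∈ J, d ∘ₗ Function.ExtendByZero.linearMap ℂ k = 0) {U₁ : Opens M.carrier}
    (hU₁c : U₁ ≤ c.dom)
    (hU₁ : ∀ x ∈ U₁, ∃ y ∈ U, y ∈ C.dom ∧ C.base y = Function.extend e (c.base x) b) :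
    ∃ D : M.Family U₁, IsHomDer (q + J.length) D ∧
      ∀ (V : {V : Opens M.carrier // V ≤ U₁}) (f : M.Sec V.1) x (hx : x ∈ V.1) y
        (hy : y ∈ U ⊓ Opens.comap p.base V.1) (hC : y ∈ C.dom),
        C.base y = Function.extend e (c.base x) b → c.ev hx (hU₁c (V.2 hx)) (D V f) =
          slice (LinearMap.funLeft ℂ ℂ k) J (C.ev hy hC
            (Y ⟨U ⊓ Opens.comap p.base V.1, inf_le_left⟩ (P.res inf_le_right (p.pull V.1 f)))) := by
  have hS : ∀ V : {V : Opens M.carrier // V ≤ U₁}, ∀ x ∈ V.1,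
      ∃ y ∈ U ⊓ Opens.comap p.base V.1, y ∈ C.dom ∧
        C.base y = Function.extend e (c.base x) b := by
    intro V x hx
    obtain ⟨y, hy, hC, hyx⟩ := hU₁ x (V.2 hx)
    have hp := h.base_eq_of_extend hC (hU₁c (V.2 hx)) hyx
    exact ⟨y, ⟨hy, show p.base y ∈ V.1 from hp.symm ▸ hx⟩, hC, hyx⟩
  choose R hR using fun V : {V : Opens M.carrier // V ≤ U₁} =>
    c.exists_linearMap_comp C (V.2.trans hU₁c)
      (fun a => (hasFDerivAt_extend e b a).differentiableAt)
      (slice (LinearMap.funLeft ℂ ℂ k) J) (hS V)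
  let D : M.Family U₁ := fun V => R V ∘ₗ Y ⟨U ⊓ Opens.comap p.base V.1, inf_le_left⟩ ∘ₗ
    (P.res (inf_le_right : U ⊓ Opens.comap p.base V.1 ≤ _)).toLinearMap ∘ₗ
      (p.pull V.1).toLinearMap
  have hD : ∀ (V : {V : Opens M.carrier // V ≤ U₁}) (f : M.Sec V.1) x (hx : x ∈ V.1) y
        (hy : y ∈ U ⊓ Opens.comap p.base V.1) (hC : y ∈ C.dom),
        C.base y = Function.extend e (c.base x) b → c.ev hx (hU₁c (V.2 hx)) (D V f) =
          slice (LinearMap.funLeft ℂ ℂ k) J (C.ev hy hC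
            (Y ⟨U ⊓ Opens.comap p.base V.1, inf_le_left⟩ (P.res inf_le_right (p.pull V.1 f)))) :=
    fun V f x hx y hy hC hyx => hR V _ x hx y hy hC hyx
  refine ⟨D, ⟨fun V V' hV f => ?_, fun V q' f hf => ?_, fun V q' f hf g => ?_⟩, hD⟩
  · refine c.eq_of_ev_eq (V'.2.trans hU₁c) fun x hx => ?_
    obtain ⟨y, hy, hC, hyx⟩ := hS V' x hx
    have hVV' : U ⊓ Opens.comap p.base V'.1 ≤ U ⊓ Opens.comap p.base V.1 :=
      inf_le_inf_left U fun _ hz => hV hz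
    have e1 := hY.natural ⟨U ⊓ Opens.comap p.base V.1, inf_le_left⟩
      ⟨U ⊓ Opens.comap p.base V'.1, inf_le_left⟩ hVV' (P.res inf_le_right (p.pull V.1 f))
    rw [res_res] at e1
    rw [c.ev_res, hD V f x (hV hx) y (hVV' hy) hC hyx, hD V' _ x hx y hy hC hyx, ← p.pull_res hV,
      res_res, ← e1, C.ev_res]
  · refine c.mem_parity_of_ev_mem (V.2.trans hU₁c) fun x hx => ?_
    obtain ⟨y, hy, hC, hyx⟩ := hS V x hx
    rw [hD V f x hx y hy hC hyx, add_right_comm]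
    have hf' : P.res (inf_le_right : U ⊓ Opens.comap p.base V.1 ≤ _) (p.pull V.1 f) ∈
      P.parity _ q' := P.map_parity inf_le_right q' _ (p.pull_parity V.1 q' f hf)
    have hf'' := hY.map_parity ⟨U ⊓ Opens.comap p.base V.1, inf_le_left⟩ q' _ hf'
    exact slice_mem_evenOdd _ J (C.ev_mem_evenOdd hf'' hy hC)
  · refine c.eq_of_ev_eq (V.2.trans hU₁c) fun x hx => ?_
    obtain ⟨y, hy, hC, hyx⟩ := hS V x hx
    have hp := h.base_eq_of_extend hC (hU₁c (V.2 hx)) hyx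
    have hf' : P.res (inf_le_right : U ⊓ Opens.comap p.base V.1 ≤ _) (p.pull V.1 f) ∈
      P.parity _ q' := P.map_parity inf_le_right q' _ (p.pull_parity V.1 q' f hf)
    have hpull : ∀ g : M.Sec V.1, C.ev hy hC (P.res inf_le_right (p.pull V.1 g)) =
        ExteriorAlgebra.map (Function.ExtendByZero.linearMap ℂ k)
          (c.ev hx (hU₁c (V.2 hx)) g) :=
      fun g => h.ev_res_pull g _ hp hx _ hy hC
    -- the second sign comes from moving `f` past the contractions in `slice`
    have hs : ((-1 : ℂ) ^ (q.val * q'.val)) * ((-1) ^ q'.val) ^ J.length =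
        (-1) ^ ((q + J.length).val * q'.val) := by
      rw [pow_mul, pow_mul, neg_one_pow_val_add_natCast, mul_pow, ← pow_mul (-1) q'.val,
        ← pow_mul (-1) J.length, mul_comm q'.val]
    have e1 := hY.leibniz ⟨U ⊓ Opens.comap p.base V.1, inf_le_left⟩ q' _ hf'
      (P.res inf_le_right (p.pull V.1 g))
    have e2 : P.res (inf_le_right : U ⊓ Opens.comap p.base V.1 ≤ _) (p.pull V.1 (f * g)) =
        P.res inf_le_right (p.pull V.1 f) * P.res inf_le_right (p.pull V.1 g) := by
      rw [map_mul, map_mul]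
    have e3 := congrArg (C.ev hy hC) e1
    have hm : ∀ F G : P.Sec (U ⊓ Opens.comap p.base V.1),
      C.ev hy hC (F * G) = C.ev hy hC F * C.ev hy hC G := map_mul _
    rw [map_add, map_smul, hm (Y ⟨U ⊓ Opens.comap p.base V.1, inf_le_left⟩ _) _,
      hm _ (Y ⟨U ⊓ Opens.comap p.base V.1, inf_le_left⟩ _), hpull f, hpull g] at e3
    rw [hD V (f * g) x hx y hy hC hyx, e2, e3, map_add, map_smul,
      slice_mul_map h.funLeft_comp_extendByZero hJ,
      slice_map_mul h.funLeft_comp_extendByZero hJ _ (c.involute_ev hf hx _), smul_smul, hs,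
      ← hD V f x hx y hy hC hyx, ← hD V g x hx y hy hC hyx, map_add, map_smul, map_mul, map_mul]

end IsPullbackChart

/-! ### Superderivations of products commuting with lifts -/

namespace SuperSpace

theorem IsDer.natural {M : SuperSpace.{u}} {U : Opens M.carrier} {Y : M.Family U} (hY : IsDer Y)
    (V W : {V : Opens M.carrier // V ≤ U}) (h : W.1 ≤ V.1) (f : M.Sec V.1) :
    M.res h (Y V f) = Y W (M.res h f) := by
  obtain ⟨Y₀, Y₁, h₀, h₁, rfl⟩ := hY
  rw [Pi.add_apply, Pi.add_apply, LinearMap.add_apply, LinearMap.add_apply, map_add,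
    h₀.natural V W h, h₁.natural V W h]

/-- The value of `Y f` at a point depends only on the germ of `f`. -/
theorem IsDer.ev_eq_of_res_eq {M : SuperSpace.{u}} {ι κ : Type} [Fintype ι] [Fintype κ]
    (c : SuperChart M ι κ) {U : Opens M.carrier} {Y : M.Family U} (hY : IsDer Y)
    (V W : {V : Opens M.carrier // V ≤ U}) {f : M.Sec V.1} {g : M.Sec W.1}
    (hfg : M.res (inf_le_left : V.1 ⊓ W.1 ≤ V.1) f = M.res (inf_le_right : V.1 ⊓ W.1 ≤ W.1) g)
    {x : M.carrier} (hV : x ∈ V.1) (hW : x ∈ W.1) (hc : x ∈ c.dom) :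
    c.ev hV hc (Y V f) = c.ev hW hc (Y W g) := by
  have hx : x ∈ V.1 ⊓ W.1 := ⟨hV, hW⟩
  have hU : V.1 ⊓ W.1 ≤ U := inf_le_left.trans V.2
  rw [← c.ev_res inf_le_left hx hc (Y V f), ← c.ev_res inf_le_right hx hc (Y W g),
    hY.natural V ⟨_, hU⟩, hY.natural W ⟨_, hU⟩, hfg]

end SuperSpace

open ExteriorAlgebra SuperSpace

namespace IsPullbackChart

variable {P : SuperSpace.{w}} {M : SuperSpace.{u}} {p : P.Hom M} {ι κ ι₁ κ₁ : Type} [Fintype ι]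
  [Fintype κ] [Fintype ι₁] [Fintype κ₁] {c : SuperChart M ι₁ κ₁} {C : SuperChart P ι κ}
  {e : ι₁ → ι} {k : κ₁ → κ} (h : IsPullbackChart p c C e k)

include h

theorem exists_isDer_slice {U : Opens P.carrier} {Y : P.Family U} (hY : IsDer Y) {b : ι → ℂ}
    {J : List (Module.Dual ℂ (κ → ℂ))}
    (hJ : ∀ d ∈ J, d ∘ₗ Function.ExtendByZero.linearMap ℂ k = 0) {U₁ : Opens M.carrier}
    (hU₁c : U₁ ≤ c.dom)
    (hU₁ : ∀ x ∈ U₁, ∃ y ∈ U, y ∈ C.dom ∧ C.base y = Function.extend e (c.base x) b) :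
    ∃ D : M.Family U₁, IsDer D ∧
      ∀ (V : {V : Opens M.carrier // V ≤ U₁}) (f : M.Sec V.1) x (hx : x ∈ V.1) y
        (hy : y ∈ U ⊓ Opens.comap p.base V.1) (hC : y ∈ C.dom),
        C.base y = Function.extend e (c.base x) b → c.ev hx (hU₁c (V.2 hx)) (D V f) =
          slice (LinearMap.funLeft ℂ ℂ k) J (C.ev hy hC
            (Y ⟨U ⊓ Opens.comap p.base V.1, inf_le_left⟩ (P.res inf_le_right (p.pull V.1 f)))) := by
  obtain ⟨Y₀, Y₁, h₀, h₁, rfl⟩ := hY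
  obtain ⟨D₀, hD₀, hev₀⟩ := h.exists_isHomDer_slice h₀ (b := b) hJ hU₁c hU₁
  obtain ⟨D₁, hD₁, hev₁⟩ := h.exists_isHomDer_slice h₁ (b := b) hJ hU₁c hU₁
  refine ⟨D₀ + D₁, ?_, fun V f x hx y hy hC hyx => ?_⟩
  -- for `J` of odd length, `D₀` is odd and `D₁` is even
  · obtain hq | hq := zmod_two_cases (J.length : ZMod 2)
    · rw [hq, add_zero] at hD₀ hD₁
      exact ⟨D₀, D₁, hD₀, hD₁, rfl⟩
    · rw [hq] at hD₀ hD₁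
      exact ⟨D₁, D₀, hD₁, hD₀, add_comm _ _⟩
  · rw [Pi.add_apply, LinearMap.add_apply, map_add, hev₀ V f x hx y hy hC hyx,
      hev₁ V f x hx y hy hC hyx, ← map_add, ← map_add, Pi.add_apply, LinearMap.add_apply]

end IsPullbackChart

namespace IsProductChart

variable {M' : SuperSpace.{u}} {M'' : SuperSpace.{v}} {P : SuperSpace.{w}} {p' : P.Hom M'}
  {p'' : P.Hom M''} {ι κ ι' κ' ι'' κ'' : Type} [Fintype ι] [Fintype κ] [Fintype ι'] [Fintype κ']
  [Fintype ι''] [Fintype κ''] {c' : SuperChart M' ι' κ'} {c'' : SuperChart M'' ι'' κ''}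
  {C : SuperChart P ι κ} {e' : ι' → ι} {e'' : ι'' → ι} {k' : κ' → κ} {k'' : κ'' → κ}

/-- If `Y` commutes with a lift `X` of `X'`, then the components of `Y` along a slice commute with
`X'`. -/
theorem commutes_of_slice (h : IsProductChart p' p'' c' c'' C e' e'' k' k'') {X' : M'.Family ⊤}
    (hX' : IsHomDer 0 X') {X : P.Family ⊤} (hX : IsLift p' p'' X' X) {U : Opens P.carrier}
    {Y : P.Family U} (hXY : ∀ (V : {V : Opens P.carrier // V ≤ U}) (f : P.Sec V.1),
      X ⟨V.1, le_top⟩ (Y V f) = Y V (X ⟨V.1, le_top⟩ f))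
    {b : ι → ℂ} {J : List (Module.Dual ℂ (κ → ℂ))}
    (hJ : ∀ d ∈ J, d ∘ₗ Function.ExtendByZero.linearMap ℂ k' = 0) {U₁ : Opens M'.carrier}
    (hU₁c : U₁ ≤ c'.dom)
    (hU₁ : ∀ x ∈ U₁, ∃ y ∈ U, y ∈ C.dom ∧ C.base y = Function.extend e' (c'.base x) b)
    {D : M'.Family U₁}
    (hD : ∀ (V : {V : Opens M'.carrier // V ≤ U₁}) (f : M'.Sec V.1) x (hx : x ∈ V.1) y
        (hy : y ∈ U ⊓ Opens.comap p'.base V.1) (hC : y ∈ C.dom),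
        C.base y = Function.extend e' (c'.base x) b → c'.ev hx (hU₁c (V.2 hx)) (D V f) =
          slice (LinearMap.funLeft ℂ ℂ k') J (C.ev hy hC
            (Y ⟨U ⊓ Opens.comap p'.base V.1, inf_le_left⟩
              (P.res inf_le_right (p'.pull V.1 f)))))
    (V : {V : Opens M'.carrier // V ≤ U₁}) (f : M'.Sec V.1) :
    X' ⟨V.1, le_top⟩ (D V f) = D V (X' ⟨V.1, le_top⟩ f) := by
  classical
  refine c'.eq_of_ev_eq (V.2.trans hU₁c) fun x hx => ?_
  have hc : x ∈ c'.dom := hU₁c (V.2 hx)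
  have hS : ∀ x (hx : x ∈ V.1), ∃ (y : P.carrier) (_ : y ∈ U ⊓ Opens.comap p'.base V.1)
      (_ : y ∈ C.dom), C.base y = Function.extend e' (c'.base x) b ∧ p'.base y = x := by
    intro x hx
    obtain ⟨y, hy, hC, hyx⟩ := hU₁ x (V.2 hx)
    have hp := h.fst.base_eq_of_extend hC (hU₁c (V.2 hx)) hyx
    exact ⟨y, ⟨hy, show p'.base y ∈ V.1 from hp.symm ▸ hx⟩, hC, hyx, hp⟩
  obtain ⟨y, hy, hC, hyx, hp⟩ := hS x hx
  set G := Y ⟨U ⊓ Opens.comap p'.base V.1, inf_le_left⟩ (P.res inf_le_right (p'.pull V.1 f))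
    with hG
  -- the right hand side is the component of `X G`
  have e1 : P.res (inf_le_right : U ⊓ Opens.comap p'.base V.1 ≤ _)
      (p'.pull V.1 (X' ⟨V.1, le_top⟩ f)) =
      X ⟨U ⊓ Opens.comap p'.base V.1, le_top⟩ (P.res inf_le_right (p'.pull V.1 f)) :=
    (hX.apply_fst ⟨U ⊓ Opens.comap p'.base V.1, le_top⟩ V.1 inf_le_right f).symm
  have e2 := hXY ⟨U ⊓ Opens.comap p'.base V.1, inf_le_left⟩ (P.res inf_le_right (p'.pull V.1 f))
  rw [hD V _ x hx y hy hC hyx, e1, ← e2, ← hG,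
    hX.isHomDer.ev_eq_derivVal C ⟨U ⊓ Opens.comap p'.base V.1, le_top⟩ hy hC G,
    hX.ev_onZ h hX' hp hc trivial hC, hX.ev_onξ h hX' hp hc trivial hC,
    IsPullbackChart.derivVal_extend h.fst.e_injective h.fst.k_injective,
    hX'.ev_eq_derivVal c' ⟨V.1, le_top⟩ hx hc, c'.derivVal_apply, map_add, map_sum, map_sum]
  have hr := h.fst.funLeft_comp_extendByZero
  -- coefficients of `X` are pullbacks, so that `slice` is linear over them up to sign; for the odd
  -- coefficients, this sign cancels the one from exchanging `slice` with a contraction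
  congr 1
  · refine Finset.sum_congr rfl fun i _ => ?_
    have he := c'.involute_ev (hX'.onZ_mem_parity c' i) (x := x) ⟨trivial, hc⟩ hc
    rw [slice_map_mul hr hJ _ he, ZMod.val_zero, pow_zero, one_pow, one_smul]
    congr 1
    refine c'.evPderiv_comp C (fun x hx hc => ?_) hx hc
      (IsPullbackChart.hasFDerivAt_extend e' b (c'.base x)) hy hC hyx ?_
    · obtain ⟨y, hy, hC, hyx, -⟩ := hS x hx
      exact ⟨y, hy, hC, hyx, hD V f x hx y hy hC hyx⟩
    · exact h.fst.extendByZero_single i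
  · refine Finset.sum_congr rfl fun l _ => ?_
    have he := c'.involute_ev (hX'.onξ_mem_parity c' l) (x := x) ⟨trivial, hc⟩ hc
    have hl : (LinearMap.proj (k' l) : Module.Dual ℂ (κ → ℂ)) =
      LinearMap.proj l ∘ₗ LinearMap.funLeft ℂ ℂ k' := rfl
    rw [slice_map_mul hr hJ _ he, hl, slice_contractLeft, zero_add, ZMod.val_one, pow_one,
      mul_smul_comm, smul_smul, ← mul_pow, neg_one_mul, neg_neg, one_pow, one_smul,
      hD V f x hx y hy hC hyx]

/-- A superderivation on the product that commutes with all lifts from a strictly `t`-nildominated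
factor raises the degree of the coordinates coming from this factor by at least `t`. -/
theorem ev_mem_degFiltration (h : IsProductChart p' p'' c' c'' C e' e'' k' k'')
    (hP : HasProductCharts p' p'') {t : ℕ} (hM' : M'.StrictlyNildominated t)
    {U : Opens P.carrier} {Y : P.Family U} (hY : IsDer Y)
    (hcomm : ∀ X : P.Family ⊤, IsHomDer 0 X → RaisesDegree 2 X →
      ⁅X.restrict (le_top : U ≤ ⊤), Y⁆ = 0) {y : P.carrier} (hy : y ∈ U) (hC : y ∈ C.dom) :
    (∀ i, C.ev (W := U ⊓ C.dom) ⟨hy, hC⟩ hC (Y.onZ C (e' i)) ∈ degFiltration ℂ (κ → ℂ) t) ∧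
      ∀ l, C.ev (W := U ⊓ C.dom) ⟨hy, hC⟩ hC (Y.onξ C (k' l)) ∈
        degFiltration ℂ (κ → ℂ) (t + 1) := by
  have hφ : Continuous fun a : ι' → ℂ => Function.extend e' a (C.base y) :=
    continuous_iff_continuousAt.2 fun a =>
      (IsPullbackChart.hasFDerivAt_extend e' (C.base y) a).continuousAt
  -- the part of the slice through `y` on which `Y` is defined
  let V₁ : Opens (ι' → ℂ) := ⟨_, (C.push U).isOpen.preimage hφ⟩
  have hU₁c : c'.pre V₁ ≤ c'.dom := c'.pre_le_dom V₁
  have hU₁ : ∀ x ∈ c'.pre V₁, ∃ z ∈ U, z ∈ C.dom ∧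
      C.base z = Function.extend e' (c'.base x) (C.base y) := fun x hx =>
    ⟨C.base.symm (Function.extend e' (c'.base x) (C.base y)), hx.2.2, C.symm_mem_dom hx.2.1,
      C.base_symm hx.2.1⟩
  have hc : p'.base y ∈ c'.dom := h.fst.dom_le hC
  have hyx : C.base y = Function.extend e' (c'.base (p'.base y)) (C.base y) := by
    funext i
    by_cases hi : ∃ j, e' j = i
    · obtain ⟨j, rfl⟩ := hi
      rw [h.fst.e_injective.extend_apply, h.fst.base_apply hC]
    · rw [Function.extend_apply' _ _ _ hi]
  have hx : p'.base y ∈ c'.pre V₁ := ⟨c'.mem_dom.1 hc, by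
    change Function.extend e' (c'.base (p'.base y)) (C.base y) ∈ C.push U
    rw [← hyx]
    exact C.base_mem_push hy hC⟩
  have key : ∀ J : List (Module.Dual ℂ (κ → ℂ)),
      (∀ d ∈ J, d ∘ₗ Function.ExtendByZero.linearMap ℂ k' = 0) →
      (∀ i, slice (LinearMap.funLeft ℂ ℂ k') J (C.ev (W := U ⊓ C.dom) ⟨hy, hC⟩ hC
        (Y.onZ C (e' i))) ∈ degFiltration ℂ (κ' → ℂ) t) ∧
      ∀ l, slice (LinearMap.funLeft ℂ ℂ k') J (C.ev (W := U ⊓ C.dom) ⟨hy, hC⟩ hC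
        (Y.onξ C (k' l))) ∈ degFiltration ℂ (κ' → ℂ) (t + 1) := by
    intro J hJ
    obtain ⟨D, hD, hDev⟩ := h.fst.exists_isDer_slice hY hJ hU₁c hU₁
    have hdeg : RaisesDegree t D := hM' _ D hD fun X' hX' hX'2 => by
      -- `X'` commutes with `D`, as its lift `X` commutes with `Y`
      obtain ⟨X, hX⟩ := exists_isLift hP hX'
      have hXY := hcomm X hX.isHomDer (hX.raisesDegree hP hX' hX'2)
      funext V
      refine LinearMap.ext fun f => ?_
      rw [Ring.lie_def]
      refine sub_eq_zero.2 (h.commutes_of_slice hX' hX (fun W g => ?_) hJ hU₁c hU₁ hDev V f)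
      have := LinearMap.congr_fun (congrFun hXY W) g
      rw [Ring.lie_def] at this
      exact sub_eq_zero.1 this
    have hyV : y ∈ U ⊓ Opens.comap p'.base (c'.pre V₁ ⊓ c'.dom) := ⟨hy, hx, hc⟩
    refine ⟨fun i => ?_, fun l => ?_⟩
    · have h1 := hdeg.ev_onZ_mem c' hx hc i
      have h2 := hDev ⟨c'.pre V₁ ⊓ c'.dom, inf_le_left⟩ (M'.res inf_le_right (c'.z i)) _
        ⟨hx, hc⟩ y hyV hC hyx
      have h3 : C.ev hyV hC (Y ⟨U ⊓ Opens.comap p'.base (c'.pre V₁ ⊓ c'.dom), inf_le_left⟩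
          (P.res inf_le_right (p'.pull _ (M'.res inf_le_right (c'.z i))))) =
          C.ev (W := U ⊓ C.dom) ⟨hy, hC⟩ hC (Y.onZ C (e' i)) := by
        refine hY.ev_eq_of_res_eq C ⟨_, _⟩ ⟨_, _⟩ ?_ _ _ hC
        rw [← p'.pull_res inf_le_right, h.fst.z_eq]
        simp only [res_res]
      rw [← h3, ← h2]
      exact h1
    · have h1 := hdeg.ev_onξ_mem c' hx hc l
      have h2 := hDev ⟨c'.pre V₁ ⊓ c'.dom, inf_le_left⟩ (M'.res inf_le_right (c'.ξ l)) _
        ⟨hx, hc⟩ y hyV hC hyx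
      have h3 : C.ev hyV hC (Y ⟨U ⊓ Opens.comap p'.base (c'.pre V₁ ⊓ c'.dom), inf_le_left⟩
          (P.res inf_le_right (p'.pull _ (M'.res inf_le_right (c'.ξ l))))) =
          C.ev (W := U ⊓ C.dom) ⟨hy, hC⟩ hC (Y.onξ C (k' l)) := by
        refine hY.ev_eq_of_res_eq C ⟨_, _⟩ ⟨_, _⟩ ?_ _ _ hC
        rw [← p'.pull_res inf_le_right, h.fst.ξ_eq]
        simp only [res_res]
      rw [← h3, ← h2]
      exact h1
  have hr := h.fst.funLeft_comp_extendByZero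
  exact ⟨fun i => mem_degFiltration_of_slice hr fun J hJ => (key J hJ).1 i,
    fun l => mem_degFiltration_of_slice hr fun J hJ => (key J hJ).2 l⟩

end IsProductChart

theorem SuperSpace.HasProductCharts.strictlyNildominated {M' : SuperSpace.{u}}
    {M'' : SuperSpace.{v}} {P : SuperSpace.{w}} {p' : P.Hom M'} {p'' : P.Hom M''}
    (hP : HasProductCharts p' p'') {t : ℕ} (hM' : M'.StrictlyNildominated t)
    (hM'' : M''.StrictlyNildominated t) : P.StrictlyNildominated t := by
  intro U Y hY hcomm
  refine hY.raisesDegree fun y _ => ?_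
  obtain ⟨ι, κ, ι', κ', ι'', κ'', _, _, _, _, _, _, c', c'', C, e', e'', k', k'', h, hC⟩ := hP y
  refine ⟨ι, κ, _, _, C, hC, fun y hy hC => ?_⟩
  have h' := h.ev_mem_degFiltration hP hM' hY hcomm hy hC
  have h'' := h.swap.ev_mem_degFiltration hP.swap hM'' hY hcomm hy hC
  refine ⟨fun i => ?_, fun l => ?_⟩
  · obtain ⟨j, rfl⟩ | ⟨j, rfl⟩ := h.e_cover i
    exacts [h'.1 j, h''.1 j]
  · obtain ⟨j, rfl⟩ | ⟨j, rfl⟩ := h.k_cover l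
    exacts [h'.2 j, h''.2 j]

theorem IsSuperProduct.hasProductCharts {M' : ComplexSupermanifold.{u}}
    {M'' : ComplexSupermanifold.{v}} {P : ComplexSupermanifold.{w}}
    {p' : P.toSuperSpace.Hom M'.toSuperSpace} {p'' : P.toSuperSpace.Hom M''.toSuperSpace}
    (hP : IsSuperProduct p' p'') : HasProductCharts p' p'' := by
  intro y
  obtain ⟨m', n', m'', n'', c', c'', C, h', h'', hx', hx'', hdom, -, hz', hz'', hξ', hξ''⟩ :=
    hP (p'.base y) (p''.base y)
  refine ⟨_, _, _, _, _, _, _, _, _, _, _, _, c', c'', C, Sum.inl, Sum.inr, Sum.inl, Sum.inr,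
    ⟨⟨Sum.inl_injective, Sum.inl_injective, h', hz', hξ'⟩,
      ⟨Sum.inr_injective, Sum.inr_injective, h'', hz'', hξ''⟩, by simp, by simp, ?_, ?_⟩,
    hdom y hx' hx''⟩
  · rintro (i | i)
    exacts [.inl ⟨i, rfl⟩, .inr ⟨i, rfl⟩]
  · rintro (i | i)
    exacts [.inl ⟨i, rfl⟩, .inr ⟨i, rfl⟩]

end

theorem mainTheorem6 (t : ℕ) {M' : ComplexSupermanifold.{u}} {M'' : ComplexSupermanifold.{v}}
    {P : ComplexSupermanifold.{w}}
    (p' : P.toSuperSpace.Hom M'.toSuperSpace) (p'' : P.toSuperSpace.Hom M''.toSuperSpace)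
    (hP : IsSuperProduct p' p'')
    (hM' : M'.toSuperSpace.StrictlyNildominated t)
    (hM'' : M''.toSuperSpace.StrictlyNildominated t) :
    P.toSuperSpace.StrictlyNildominated t :=
  hP.hasProductCharts.strictlyNildominated hM' hM''
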